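/- Let $(W,S)$ be a Coxeter system with $S$ finite and $\Gamma$ its presentation diagram: the graph with vertex set $S$ in which distinct $s,t$ are adjacent iff $st$ has finite order. For $A\subseteq S$ let $\langle A\rangle$ be the special subgroup generated by $A$. For $A,C\subseteq S$ say that $A$ separates $C$ in $\Gamma$ if there are $c_1,c_2\in C\setminus A$ such that every path of $\Gamma$ from $c_1$ to $c_2$ meets $A$. Decompositions. A graph of groups decomposition of a subgroup $H\le W$ is given by a tree (no other underlying graphs occur for Coxeter groups), subgroups $\Lambda(u)\le H$ at the vertices and $\Lambda(e)$ at the edges, each edge group being contained in both endpoint groups, such that the inclusions of the vertex groups induce an isomorphism of the fundamental group of this graph of groups onto $H$. It is reduced if no edge group equals the group of an endpoint, and reducing means collapsing edges whose group equals that of an endpoint until the result is reduced. It is visual if all vertex and edge groups are special. A decomposition $\Phi$ of a vertex group $\Lambda(u)$ is compatible with $\Lambda$ if every edge group of $\Lambda$ at $u$ lies in a $\Lambda(u)$-conjugate of a vertex group of $\Phi$; then $u$ can be replaced by $\Phi$ (after conjugating the branches at $u$ by elements of $\Lambda(u)$). A nontrivial splitting of $H$ over $C$ is a decomposition $H=P*_CQ$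 with $P\ne C\ne Q$. A visual decomposition $\Psi$ of $W$ is JSJ-amenable if it is reduced and, whenever $\langle V\rangle$ is a vertex group, $\langle E\rangle$ the group of an edge incident to that vertex, and $A\subseteq V$ generates a virtually abelian group, $A$ does not separate $E$ in $\Gamma$. Let $V$ be a vertex of $\Psi$, with group $G=\langle V\rangle$. $M(\Psi,G)$ is the set of virtually abelian $A\le G$ over which $G$ splits nontrivially and compatibly with $\Psi$ and for which there is no virtually abelian $C\le W$ such that $G$ splits nontrivially and compatibly with $\Psi$ over $C$, $C\cap A$ has infinite index in $A$, and $C\cap A$ has finite index in $C$. A reduced $\Psi$-compatible decomposition $\Lambda$ of $G$ is weakly $M(\Psi,G)$-JSJ if all its edge groups are in $M(\Psi,G)$ and each member of $M(\Psi,G)$ lies in a $G$-conjugate of a vertex group of $\Lambda$. A weakly $M(\Psi,G)$-JSJ decomposition $\Lambda$ is $M(\Psi,G)$-JSJ if, whenever a vertex group of $\Lambda$ is replaced by a nontrivial $\Lambda$-compatible splitting of it over a member of $M(\Psi,G)$ and the result is reduced, the decomposition obtained is not weakly $M(\Psi,G)$-JSJ. For a decomposition $\Lambda$ of $G=\langle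 V\rangle$ with Bass–Serre tree $T$, consider the graph of groups with graph $T$ in which the group of a vertex or edge of $T$ is generated by the elements of $V$ that stabilize it. A reduced graph of groups $\Psi_1$ obtained from it by reducing is called derived from $\Lambda$. Theorem. Let $\Psi$ be a JSJ-amenable visual decomposition of $(W,S)$, $V\subseteq S$ a vertex of $\Psi$, and $\Lambda$ a (reduced) $M(\Psi,\langle V\rangle)$-JSJ decomposition of $\langle V\rangle$. Then there is a $\Psi_1$ derived from $\Lambda$ with finite graph, and for every $\Psi_1$ derived from $\Lambda$: 1. $\Psi_1$ is an $M(\Psi,\langle V\rangle)$-JSJ decomposition of $\langle V\rangle$. 2. There is a unique bijection $\alpha$ from the vertices of $\Lambda$ to the vertices of $\Psi_1$ such that, for each vertex $u$ of $\Lambda$, $\Lambda(u)$ is conjugate in $\langle V\rangle$ to $\Psi_1(\alpha(u))$. Moreover: 3. Each edge group of $\Lambda$ is conjugate in $\langle V\rangle$ to $\langle A\rangle$ for some $A\subseteq V$. -/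

import Mathlib

/-! ### Subgroups -/

/-- The conjugate `g K g⁻¹`. -/
def conjBy {W : Type*} [Group W] (g : W) (K : Subgroup W) : Subgroup W :=
  K.map (MulAut.conj g).toMonoidHom

/-- `A` has an abelian subgroup of finite index. -/
def IsVirtuallyAbelian {W : Type*} [Group W] (A : Subgroup W) : Prop :=
  ∃ K : Subgroup W, K ≤ A ∧ IsMulCommutative K ∧ K.relIndex A ≠ 0

/-! ### Graphs of groups and decompositions

A group without nontrivial homomorphisms to `ℤ`, in particular every group generated by
involutions, has only graph of groups decompositions whose underlying graph is a tree. The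
fundamental group of a graph of groups over a tree is the free product of the vertex groups,
amalgamated along the edge groups, and the vertex and edge groups embed in it. A decomposition
of a subgroup `H` of `W` is therefore given by subgroups of `W`, indexed by the
vertices and edges of a tree, with inclusions as edge maps. -/

/-- A graph of groups whose vertex and edge groups are subgroups of `W` and whose edge maps are
inclusions. The value `egrp v w` matters only when `v` and `w` are adjacent. -/
structure SubgroupGraph (W : Type*) [Group W] (ι : Type*) where
  graph : SimpleGraph ι
  vgrp : ι → Subgroup W
  egrp : ι → ι → Subgroup W
  egrp_comm : ∀ v w, egrp v w = egrp w v
  egrp_le : ∀ {v w}, graph.Adj v w → egrp v w ≤ vgrp v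

namespace SubgroupGraph

/-- The homomorphism from the free product of the vertex groups to `W` that is induced by the
inclusions of the vertex groups. -/
noncomputable def coprodHom {W ι : Type*} [Group W] (Λ : SubgroupGraph W ι) :
    Monoid.CoprodI (fun v => Λ.vgrp v) →* W :=
  Monoid.CoprodI.lift fun v => (Λ.vgrp v).subtype

/-- The relators that identify, for every edge, the two copies of an element of the edge group
in the two endpoint groups. -/
def relators {W ι : Type*} [Group W] (Λ : SubgroupGraph W ι) :
    Set (Monoid.CoprodI (fun v => Λ.vgrp v)) :=
  {r | ∃ (v w : ι) (h : Λ.graph.Adj v w) (x : W) (hx : x ∈ Λ.egrp v w),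
    r = (Monoid.CoprodI.of (M := fun v => Λ.vgrp v) (i := v) ⟨x, Λ.egrp_le h hx⟩) *
      (Monoid.CoprodI.of (M := fun v => Λ.vgrp v) (i := w)
        ⟨x, Λ.egrp_le h.symm (Λ.egrp_comm v w ▸ hx)⟩)⁻¹}

/-- `Λ` is a graph of groups decomposition of `H`: the graph is a tree, and the inclusions of the
vertex groups induce an isomorphism of the fundamental group of `Λ` onto `H`. -/
structure IsDecompositionOf {W ι : Type*} [Group W] (Λ : SubgroupGraph W ι)
    (H : Subgroup W) : Prop where
  isTree : Λ.graph.IsTree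
  range_eq : Λ.coprodHom.range = H
  ker_eq : Λ.coprodHom.ker = Subgroup.normalClosure Λ.relators

/-- No edge group equals the group of an endpoint. -/
def IsReduced {W ι : Type*} [Group W] (Λ : SubgroupGraph W ι) : Prop :=
  ∀ v w, Λ.graph.Adj v w → Λ.egrp v w ≠ Λ.vgrp v

/-- A decomposition `Φ` of the vertex group `Λ(v)` is compatible with `Λ`: every edge group at
`v` is contained in a `Λ(v)`-conjugate of a vertex group of `Φ`. -/
def Compatible {W ι κ : Type*} [Group W] (Λ : SubgroupGraph W ι) (v : ι)
    (Φ : SubgroupGraph W κ) : Prop :=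
  ∀ w, Λ.graph.Adj v w → ∃ g ∈ Λ.vgrp v, ∃ x, Λ.egrp v w ≤ conjBy g (Φ.vgrp x)

/-- The graph of groups of an amalgamated product `P *_C Q`, with one edge. -/
def amalgam {W : Type*} [Group W] (P Q C : Subgroup W) (hP : C ≤ P) (hQ : C ≤ Q) :
    SubgroupGraph W Bool where
  graph := ⊤
  vgrp b := if b then Q else P
  egrp _ _ := C
  egrp_comm _ _ := rfl
  egrp_le := by
    intro v w _
    cases v <;> simpa

/-- `H = P *_C Q` with `P ≠ C ≠ Q`. -/
structure IsNontrivialSplitting {W : Type*} [Group W] (H P Q C : Subgroup W)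
    (hP : C ≤ P) (hQ : C ≤ Q) : Prop where
  decomp : (amalgam P Q C hP hQ).IsDecompositionOf H
  left_ne : P ≠ C
  right_ne : Q ≠ C

/-- The vertex group `Λ(v)` splits nontrivially and compatibly with `Λ` over `C`. -/
def SplitsCompatibly {W ι : Type*} [Group W] (Λ : SubgroupGraph W ι) (v : ι)
    (C : Subgroup W) : Prop :=
  ∃ (P Q : Subgroup W) (hP : C ≤ P) (hQ : C ≤ Q),
    IsNontrivialSplitting (Λ.vgrp v) P Q C hP hQ ∧ Λ.Compatible v (amalgam P Q C hP hQ)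

/-- The set `M(Λ, Λ(v))` of minimal virtually abelian splitting subgroups. -/
def minimalSplitters {W ι : Type*} [Group W] (Λ : SubgroupGraph W ι) (v : ι) :
    Set (Subgroup W) :=
  {A | IsVirtuallyAbelian A ∧ Λ.SplitsCompatibly v A ∧
    ¬ ∃ C : Subgroup W, IsVirtuallyAbelian C ∧ Λ.SplitsCompatibly v C ∧
      (C ⊓ A).relIndex A = 0 ∧ (C ⊓ A).relIndex C ≠ 0}

/-- `Λ₁` is obtained from `Λ` by collapsing edges whose group equals the group of an endpoint. The
map `p` sends a vertex of `Λ` to the vertex of `Λ₁` into which it is collapsed. Every collapsed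
subtree has a vertex whose group contains the others, and this is the group of the
resulting vertex; edges that are not collapsed keep their groups. (Infinitely many edges may be
collapsed.) -/
structure IsCollapseVia {W ι κ : Type*} [Group W] (Λ : SubgroupGraph W ι)
    (Λ₁ : SubgroupGraph W κ) (p : ι → κ) : Prop where
  fiber_connected : ∀ a, (Λ.graph.induce (p ⁻¹' {a})).Connected
  vgrp_eq : ∀ a, ∃ v, p v = a ∧ Λ₁.vgrp a = Λ.vgrp v ∧ ∀ w, p w = a → Λ.vgrp w ≤ Λ.vgrp v
  collapsed_edge : ∀ v w, Λ.graph.Adj v w → p v = p w →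
    Λ.egrp v w = Λ.vgrp v ∨ Λ.egrp v w = Λ.vgrp w
  adj_iff : ∀ a b, Λ₁.graph.Adj a b ↔ a ≠ b ∧ ∃ v w, p v = a ∧ p w = b ∧ Λ.graph.Adj v w
  egrp_eq : ∀ v w, Λ.graph.Adj v w → p v ≠ p w → Λ₁.egrp (p v) (p w) = Λ.egrp v w

/-- `Λ₁` is reduced and obtained from `Λ` by collapsing. -/
def IsReduction {W ι κ : Type*} [Group W] (Λ : SubgroupGraph W ι)
    (Λ₁ : SubgroupGraph W κ) : Prop :=
  Λ₁.IsReduced ∧ ∃ p : ι → κ, Λ.IsCollapseVia Λ₁ p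

/-- `Λ'` is obtained from `Λ` by replacing the vertex `u` by a splitting `P *_C Q` of its group.
The vertices `some u` and `none` of `Λ'` carry `P` and `Q`. An edge from `u` to `w` is attached to
one of the two; for this, its group and the whole branch behind it are
conjugated by an element `k w` of `Λ(u)`, which carries the edge group into `P` or `Q`. -/
structure IsVertexSplittingVia {W ι : Type*} [Group W] (Λ : SubgroupGraph W ι) (u : ι)
    (P Q C : Subgroup W) (Λ' : SubgroupGraph W (Option ι)) (k : ι → W) : Prop where
  vgrp_left : Λ'.vgrp (some u) = P
  vgrp_right : Λ'.vgrp none = Q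
  adj_new : Λ'.graph.Adj (some u) none
  egrp_new : Λ'.egrp (some u) none = C
  mem : ∀ v, v ≠ u → k v ∈ Λ.vgrp u
  vgrp_old : ∀ v, v ≠ u → Λ'.vgrp (some v) = conjBy (k v) (Λ.vgrp v)
  adj_old : ∀ v w, v ≠ u → w ≠ u → (Λ'.graph.Adj (some v) (some w) ↔ Λ.graph.Adj v w)
  branch : ∀ v w, v ≠ u → w ≠ u → Λ.graph.Adj v w → k v = k w
  egrp_old : ∀ v w, v ≠ u → w ≠ u → Λ.graph.Adj v w →
    Λ'.egrp (some v) (some w) = conjBy (k v) (Λ.egrp v w)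
  adj_iff : ∀ w, w ≠ u →
    (Λ.graph.Adj u w ↔ Λ'.graph.Adj (some u) (some w) ∨ Λ'.graph.Adj none (some w))
  not_both : ∀ w, w ≠ u → ¬ (Λ'.graph.Adj (some u) (some w) ∧ Λ'.graph.Adj none (some w))
  egrp_left : ∀ w, w ≠ u → Λ'.graph.Adj (some u) (some w) →
    Λ'.egrp (some u) (some w) = conjBy (k w) (Λ.egrp u w)
  egrp_right : ∀ w, w ≠ u → Λ'.graph.Adj none (some w) →
    Λ'.egrp none (some w) = conjBy (k w) (Λ.egrp u w)

/-- `Λ` is a reduced, `Ψ`-compatible decomposition of `G = Ψ(v)` that is weakly `M(Ψ, G)`-JSJ. -/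
structure IsWeaklyJSJ {W ι κ : Type*} [Group W] (Ψ : SubgroupGraph W ι) (v : ι)
    (Λ : SubgroupGraph W κ) : Prop where
  decomp : Λ.IsDecompositionOf (Ψ.vgrp v)
  reduced : Λ.IsReduced
  compatible : Ψ.Compatible v Λ
  egrp_mem : ∀ a b, Λ.graph.Adj a b → Λ.egrp a b ∈ Ψ.minimalSplitters v
  elliptic : ∀ A ∈ Ψ.minimalSplitters v,
    ∃ g ∈ Ψ.vgrp v, ∃ a, A ≤ conjBy g (Λ.vgrp a)

/-- `Λ` is `M(Ψ, Ψ(v))`-JSJ: it is weakly so, and if a vertex group of `Λ` is split nontrivially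
and `Λ`-compatibly over a member of `M(Ψ, Ψ(v))`, then the resulting decomposition, after
reduction, is not weakly `M(Ψ, Ψ(v))`-JSJ. -/
def IsJSJ.{x, y, z} {W : Type x} {ι : Type y} {κ : Type z} [Group W] (Ψ : SubgroupGraph W ι)
    (v : ι) (Λ : SubgroupGraph W κ) : Prop :=
  IsWeaklyJSJ Ψ v Λ ∧
    ∀ (u : κ) (P Q C : Subgroup W) (hP : C ≤ P) (hQ : C ≤ Q), C ∈ Ψ.minimalSplitters v →
      IsNontrivialSplitting (Λ.vgrp u) P Q C hP hQ → Λ.Compatible u (amalgam P Q C hP hQ) →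
      ∀ (Λ' : SubgroupGraph W (Option κ)) (k : κ → W), Λ.IsVertexSplittingVia u P Q C Λ' k →
      ∀ (ρ : Type z) (Λ'' : SubgroupGraph W ρ), Λ'.IsReduction Λ'' → ¬ IsWeaklyJSJ Ψ v Λ''

/-- The vertices of the Bass–Serre tree of a decomposition `Λ` of `H`: the cosets in `H` of the
vertex groups. -/
abbrev BassSerreVertex {W ι : Type*} [Group W] (Λ : SubgroupGraph W ι) (H : Subgroup W) :=
  Σ v : ι, H ⧸ (Λ.vgrp v).subgroupOf H

/-- The Bass–Serre tree: for every edge `v w` of `Λ` and `g ∈ H` there is an edge between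
`g Λ(v)` and `g Λ(w)`. -/
def bassSerre {W ι : Type*} [Group W] (Λ : SubgroupGraph W ι) (H : Subgroup W) :
    SimpleGraph (Λ.BassSerreVertex H) where
  Adj x y := ∃ (v w : ι) (g : H), Λ.graph.Adj v w ∧
    x = ⟨v, (g : H ⧸ (Λ.vgrp v).subgroupOf H)⟩ ∧ y = ⟨w, (g : H ⧸ (Λ.vgrp w).subgroupOf H)⟩
  symm := ⟨by
    rintro x y ⟨v, w, g, h, hx, hy⟩
    exact ⟨w, v, g, h.symm, hy, hx⟩⟩
  loopless := ⟨by
    rintro x ⟨v, w, g, h, hx, hy⟩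
    exact h.ne (congrArg Sigma.fst (hx.symm.trans hy))⟩

end SubgroupGraph

/-! ### Coxeter systems and visual decompositions

The generators of a Coxeter system `cs : CoxeterSystem M W` are indexed by `B`, so sets of
generators are given as sets of indices; the entry `0` of `M` stands for `∞`. -/

/-- The special subgroup `⟨A⟩`. -/
def CoxeterSystem.special {B W : Type*} [Group W] {M : CoxeterMatrix B}
    (cs : CoxeterSystem M W) (A : Set B) : Subgroup W :=
  Subgroup.closure (cs.simple '' A)

/-- The presentation diagram (without labels): distinct generators whose product has finite order
are adjacent. -/
def CoxeterMatrix.diagram {B : Type*} (M : CoxeterMatrix B) : SimpleGraph B where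
  Adj s t := s ≠ t ∧ M s t ≠ 0
  symm := ⟨fun s t h => ⟨h.1.symm, by rw [M.symmetric]; exact h.2⟩⟩
  loopless := ⟨fun _ h => h.1 rfl⟩

/-- `A` separates `C` in `Γ`: there are two points of `C \ A` such that every path of `Γ` from one
to the other meets `A`. -/
def SimpleGraph.Separates {B : Type*} (Γ : SimpleGraph B) (A C : Set B) : Prop :=
  ∃ b₁ ∈ C \ A, ∃ b₂ ∈ C \ A, ∀ q : Γ.Walk b₁ b₂, ∃ a ∈ q.support, a ∈ A

/-- A graph with subsets of the generating set at its vertices and edges. -/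
structure VisualGraph (B : Type*) (ι : Type*) where
  graph : SimpleGraph ι
  vset : ι → Set B
  eset : ι → ι → Set B
  eset_comm : ∀ v w, eset v w = eset w v
  eset_subset : ∀ {v w}, graph.Adj v w → eset v w ⊆ vset v

namespace VisualGraph

/-- The graph of groups given by the special subgroups. -/
def groups {B W ι : Type*} [Group W] {M : CoxeterMatrix B} (Ψ : VisualGraph B ι)
    (cs : CoxeterSystem M W) : SubgroupGraph W ι where
  graph := Ψ.graph
  vgrp v := cs.special (Ψ.vset v)
  egrp v w := cs.special (Ψ.eset v w)
  egrp_comm v w := by rw [Ψ.eset_comm]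
  egrp_le h := Subgroup.closure_mono (Set.image_mono (Ψ.eset_subset h))

/-- `Ψ` is a JSJ-amenable visual decomposition of the Coxeter system. -/
structure IsJSJAmenable {B W ι : Type*} [Group W] {M : CoxeterMatrix B} (Ψ : VisualGraph B ι)
    (cs : CoxeterSystem M W) : Prop where
  decomp : (Ψ.groups cs).IsDecompositionOf ⊤
  reduced : (Ψ.groups cs).IsReduced
  not_separates : ∀ v w, Ψ.graph.Adj v w → ∀ A ⊆ Ψ.vset v,
    IsVirtuallyAbelian (cs.special A) → ¬ M.diagram.Separates A (Ψ.eset v w)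

end VisualGraph

/-- For a decomposition `Λ` of `⟨V⟩`: the graph of groups whose graph is the Bass–Serre tree of `Λ`
and whose vertex and edge groups are generated by the elements of `V` that stabilize the vertex
or edge. (An element of `⟨V⟩` stabilizes an edge if and only if it fixes both endpoints.) -/
def CoxeterSystem.visualBassSerre {B W κ : Type*} [Group W] {M : CoxeterMatrix B}
    (cs : CoxeterSystem M W) (V : Set B) (Λ : SubgroupGraph W κ) :
    VisualGraph B (Λ.BassSerreVertex (cs.special V)) where
  graph := Λ.bassSerre (cs.special V)
  vset x := {s | s ∈ V ∧ ∃ h : cs.special V, (h : W) = cs.simple s ∧ h • x.2 = x.2}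
  eset x y := {s | s ∈ V ∧ ∃ h : cs.special V, (h : W) = cs.simple s ∧
    h • x.2 = x.2 ∧ h • y.2 = y.2}
  eset_comm x y := by
    ext s
    simp only [and_comm]
  eset_subset := by
    rintro x y - s ⟨hs, h, h₁, h₂, -⟩
    exact ⟨hs, h, h₁, h₂⟩

/-- `Ψ₁` is a reduced visual graph of groups derived from the decomposition `Λ` of `⟨V⟩`: it is
obtained by reducing the visual graph of groups on the Bass–Serre tree of `Λ`. -/
def VisualGraph.IsDerivedFrom {B W κ ρ : Type*} [Group W] {M : CoxeterMatrix B}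
    (Ψ₁ : VisualGraph B ρ) (cs : CoxeterSystem M W) (V : Set B) (Λ : SubgroupGraph W κ) : Prop :=
  ((cs.visualBassSerre V Λ).groups cs).IsReduction (Ψ₁.groups cs)

/-! Write `G = ⟨V⟩`, and call a subgroup elliptic in a decomposition of `G` if it fixes a vertex of
the Bass–Serre tree. In a reduced decomposition no vertex group lies in a conjugate of another one
(`eq_of_vgrp_le`). Hence two reduced decompositions whose vertex groups are elliptic in each other
have the same vertex groups up to conjugacy, by a unique bijection (`existsUnique_equiv`). The
theorem comes down to this mutual ellipticity for `Λ` and `Ψ₁`.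

One half is built in: a vertex group of `Ψ₁` is generated by elements that fix a common vertex of
the tree of `Λ`. That `Ψ₁` is a decomposition of `G` at all holds because each generator fixes a
subtree, and two generators whose product has finite order generate a finite group and so fix a
common vertex. The Coxeter presentation of `G` is thereby distributed over the vertex groups
(`groups_isDecompositionOf`). Only finitely many subsets of `V` exist, so the visual graph on the
infinite tree reduces to a finite one (`IsConvex.exists_isReduction`).

Edge groups are controlled by minimality. If `G` still splits compatibly over a subgroup of a
minimal splitter, then this subgroup is itself minimal and has finite index
(`mem_minimalSplitters_of_le`). The edge groups of `Ψ₁` lie in conjugates of edge groups of `Λ`, so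
they are minimal splitters. The visual counterpart of a splitting over `A ∈ M(Ψ, G)` shows that a
conjugate of `A` contains a special member of `M(Ψ, G)` with finite index
(`exists_special_mem_minimalSplitters`). Special subgroups that are elliptic in `Λ` are elliptic in
`Ψ₁`, and ellipticity passes to overgroups of finite index; so `Ψ₁` is weakly JSJ.

The other half uses the maximality of `Λ`. Suppose that `Λ(u)` fixes no vertex of the tree of `Ψ₁`.
It is finitely generated, and it has no nontrivial homomorphism to `ℤ` that kills its elliptic
elements, since one would extend to `G`, which is generated by involutions. So the action gives a
nontrivial amalgam over an edge stabilizer (`ActsOn.exists_splitting`). This stabilizer lies in a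
member of `M(Ψ, G)`, and the members of `M(Ψ, G)` and the edge groups of `Ψ` at `V` stay elliptic,
so refining `Λ` at `u` contradicts that `Λ` is JSJ (`IsJSJ.false_of_splitting`). The same lemma
turns a violation of maximality for `Ψ₁` into one for `Λ`. Finally, an edge group of `Λ` is the
intersection of the adjacent vertex groups, which are conjugates of special subgroups, and such
intersections are conjugate to special subgroups (`exists_special_eq_inf_conjBy`).

Decompositions are handled through the universal property of the fundamental group. The Bass–Serre
tree is obtained from an affine action on edge chains modulo 2, and the facts on special subgroups
from the exchange condition. -/

/-! ### Trees -/

namespace SimpleGraph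

variable {X : Type*} {T : SimpleGraph X}

/-- `y` is the neighbour of `x` on the way to `k`. -/
def Toward (T : SimpleGraph X) (k x y : X) : Prop :=
  T.Adj x y ∧ T.dist y k + 1 = T.dist x k

theorem Connected.exists_toward (hT : T.Connected) {x k : X} (h : x ≠ k) :
    ∃ y, T.Toward k x y := by
  obtain ⟨p, hp⟩ := hT.exists_walk_length_eq_dist x k
  cases p with
  | nil => exact absurd rfl h
  | cons hxy q =>
    refine ⟨_, hxy, ?_⟩
    have h1 := dist_le q
    have h2 := hT.dist_triangle (u := x) (v := _) (w := k) |>.trans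
      (Nat.add_le_add_right (dist_eq_one_iff_adj.2 hxy).le _)
    simp only [Walk.length_cons] at hp
    omega

theorem IsTree.toward_unique (hT : T.IsTree) {x k y y' : X} (h : T.Toward k x y)
    (h' : T.Toward k x y') : y = y' := by
  have key : ∀ z, T.Toward k x z → ∃ p : T.Walk x k, p.IsPath ∧ p.snd = z := by
    rintro z ⟨hz, hd⟩
    obtain ⟨q, hq⟩ := hT.connected.exists_walk_length_eq_dist z k
    refine ⟨q.cons hz, Walk.isPath_of_length_eq_dist _ (by simp [hq, hd]), by simp⟩
  obtain ⟨p, hp, rfl⟩ := key _ h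
  obtain ⟨q, hq, rfl⟩ := key _ h'
  rw [(hT.existsUnique_path x k).unique hp hq]

theorem IsTree.toward_or_toward (hT : T.IsTree) {x y : X} (h : T.Adj x y) (k : X) :
    T.Toward k x y ∨ T.Toward k y x := by
  have := hT.dist_eq_dist_add_one_of_adj k h
  rcases this with h1 | h1
  · left; refine ⟨h, ?_⟩; rw [dist_comm, dist_comm (u := x)]; omega
  · right; refine ⟨h.symm, ?_⟩; rw [dist_comm, dist_comm (u := y)]; omega

theorem Toward.not_swap {k x y : X} (h : T.Toward k x y) : ¬ T.Toward k y x := by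
  rintro ⟨-, h'⟩
  have := h.2
  omega

/-- Moving the target across another edge does not change the side of `x y` on which it lies.
Otherwise the triangle inequality forces `dist y z = dist x w`. If this is 0, the two edges
coincide; if not, the step from `y` toward `z` also leads toward `w`, so by uniqueness it goes to
`x`, which is farther from `z`. -/
theorem IsTree.toward_iff_of_adj (hT : T.IsTree) {x y z w : X} (hxy : T.Adj x y)
    (hzw : T.Adj z w) (hne : s(z, w) ≠ s(x, y)) : T.Toward z x y ↔ T.Toward w x y := by
  have key : ∀ {z w : X}, T.Adj z w → s(z, w) ≠ s(x, y) → T.Toward z x y → T.Toward w x y := by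
    intro z w hzw hne hz
    rcases hT.toward_or_toward hxy w with hw | hw
    · exact hw
    exfalso
    have t1 := hT.connected.dist_triangle (u := x) (v := w) (w := z)
    have t2 := hT.connected.dist_triangle (u := y) (v := z) (w := w)
    have e1 := dist_eq_one_iff_adj.2 hzw
    have e2 := dist_eq_one_iff_adj.2 hzw.symm
    have d1 := hz.2
    have d2 := hw.2
    by_cases hyz : y = z
    · subst hyz
      have : T.dist y y = 0 := dist_self
      have hxw : T.dist x w = 0 := by omega
      rw [hT.connected.dist_eq_zero_iff] at hxw
      subst hxw
      exact hne Sym2.eq_swap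
    · obtain ⟨y', hy'⟩ := hT.connected.exists_toward hyz
      have : T.Toward w y y' := by
        refine ⟨hy'.1, ?_⟩
        have t3 := hT.connected.dist_triangle (u := y') (v := z) (w := w)
        have t4 := hT.connected.dist_triangle (u := y) (v := y') (w := w)
        have e3 := dist_eq_one_iff_adj.2 hy'.1
        have d3 := hy'.2
        omega
      have hx := hT.toward_unique this hw
      subst hx
      exact hz.not_swap hy'
  exact ⟨key hzw hne, key hzw.symm (by rwa [Sym2.eq_swap])⟩

/-- An edge that separates `k'` from `k` lies on the path between them. -/
theorem IsTree.dist_eq_of_toward (hT : T.IsTree) {x y k k' : X} (h : T.Toward k x y)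
    (h' : T.Toward k' y x) : T.dist k' k = T.dist k' x + 1 + T.dist y k := by
  apply le_antisymm
  · have t1 := hT.connected.dist_triangle (u := k') (v := x) (w := k)
    have := h.2
    omega
  · obtain ⟨p, hp⟩ := hT.connected.exists_walk_length_eq_dist k' k
    rw [← hp]
    clear hp
    induction p with
    | nil => exact absurd h' h.not_swap
    | cons hab q ih =>
      rename_i a b c
      by_cases hs : s(a, b) = s(x, y)
      · have hax : a = x := by
          rcases Sym2.eq_iff.1 hs with ⟨rfl, rfl⟩ | ⟨rfl, rfl⟩
          · rfl
          · have := h'.2; simp at this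
        have hby : b = y := by
          subst hax
          exact Sym2.congr_right.1 hs
        subst hax hby
        have := dist_le q
        simp only [dist_self, Walk.length_cons]
        omega
      · have := ih h ((hT.toward_iff_of_adj h.1.symm hab
          (by rwa [Sym2.eq_swap (a := y)])).1 h')
        have t := hT.connected.dist_triangle (u := a) (v := b) (w := x)
        rw [dist_eq_one_iff_adj.2 hab] at t
        simp only [Walk.length_cons]
        omega

theorem Walk.iff_of_locally_const {P : X → Prop} {x y : X} (p : T.Walk x y)
    (h : ∀ a b, T.Adj a b → (P a ↔ P b)) : P x ↔ P y := by
  induction p with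
  | nil => rfl
  | cons hab _ ih => exact (h _ _ hab).trans ih

theorem Reachable.iff_of_locally_const {P : X → Prop} {x y : X} (p : T.Reachable x y)
    (h : ∀ a b, T.Adj a b → (P a ↔ P b)) : P x ↔ P y :=
  p.some.iff_of_locally_const h

theorem Reachable.of_forall_adj {Y : Type*} {U : SimpleGraph Y} {f : X → Y} {x y : X}
    (p : T.Reachable x y) (h : ∀ a b, T.Adj a b → U.Reachable (f a) (f b)) :
    U.Reachable (f x) (f y) := by
  obtain ⟨p⟩ := p
  induction p with
  | nil => rfl
  | cons hab _ ih => exact (h _ _ hab).trans ih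

/-- A connected graph is a tree if every edge is the only one across some cut. -/
theorem Connected.isTree_of_cut (hT : T.Connected)
    (h : ∀ x y, T.Adj x y → ∃ P : X → Prop, P x ∧ ¬ P y ∧
      ∀ z w, T.Adj z w → s(z, w) ≠ s(x, y) → (P z ↔ P w)) : T.IsTree := by
  refine ⟨hT, isAcyclic_iff_forall_adj_isBridge.2 fun x y hxy => ?_⟩
  rw [isBridge_iff]
  intro hr
  obtain ⟨P, hx, hy, hP⟩ := h x y hxy
  refine hy ((hr.iff_of_locally_const (P := P) ?_).1 hx)
  intro a b hab
  rw [deleteEdges_adj] at hab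
  exact hP a b hab.1 (by simpa using hab.2)

theorem IsTree.exists_cut (hT : T.IsTree) {x y : X} (hxy : T.Adj x y) :
    ∃ P : X → Prop, P x ∧ ¬ P y ∧ ∀ z w, T.Adj z w → s(z, w) ≠ s(x, y) → (P z ↔ P w) := by
  have h1 := dist_eq_one_iff_adj.2 hxy
  refine ⟨fun z => T.Toward z y x, ⟨hxy.symm, by simp [dist_comm, h1]⟩, ?_, ?_⟩
  · rintro ⟨-, h⟩
    simp at h
  · intro z w hzw hne
    exact hT.toward_iff_of_adj hxy.symm hzw (by rwa [Sym2.eq_swap (a := y)])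

/-- A tree is simply connected: cocycles on it are coboundaries. -/
theorem IsTree.exists_potential {K : Type*} [Group K] (hT : T.IsTree) (c : X → X → K)
    (hc : ∀ x y, T.Adj x y → c y x = (c x y)⁻¹) :
    ∃ σ : X → K, ∀ x y, T.Adj x y → σ y = σ x * c x y := by
  obtain ⟨x₀⟩ := hT.connected.nonempty
  have hn : ∀ x, x ≠ x₀ → ∃ y, T.Toward x₀ x y := fun x h => hT.connected.exists_toward h
  choose! nx hnx using hn
  -- Recursion on the distance to the base vertex `x₀`: the value at `x` is the value at its
  -- neighbour nearer to `x₀` times the increment along that edge.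
  let rec_fun : ℕ → X → K := fun n =>
    Nat.rec (fun _ => 1) (fun _ f x => f (nx x) * c (nx x) x) n
  let σ : X → K := fun x => rec_fun (T.dist x x₀) x
  have hσ : ∀ x, x ≠ x₀ → σ x = σ (nx x) * c (nx x) x := by
    intro x hx
    have hd := (hnx x hx).2
    simp only [σ, ← hd]
    rfl
  refine ⟨σ, fun x y hxy => ?_⟩
  have key : ∀ {x y}, T.Toward x₀ x y → σ x = σ y * c y x := by
    intro x y h
    have hx : x ≠ x₀ := by
      rintro rfl
      have := h.2
      simp at this
    rw [hσ x hx, hT.toward_unique (hnx x hx) h]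
  rcases hT.toward_or_toward hxy x₀ with h | h
  · rw [key h, hc _ _ hxy.symm]; group
  · exact key h

/-- The edge `v w` lies in no fibre, since its ends have different images. A cut at this edge is
therefore constant on the connected fibres and descends to the collapsed graph. -/
theorem cut_const_of_fiber_connected {Y : Type*} (p : X → Y)
    (hfib : ∀ a, (T.induce (p ⁻¹' {a})).Connected) {v w : X} (hne : p v ≠ p w) {P : X → Prop}
    (hP : ∀ z z', T.Adj z z' → s(z, z') ≠ s(v, w) → (P z ↔ P z')) (x y : X) (hxy : p x = p y) :
    P x ↔ P y := by
  have := (hfib (p y)).preconnected ⟨x, hxy⟩ ⟨y, rfl⟩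
  refine this.iff_of_locally_const (P := fun z => P z.1) ?_
  rintro ⟨z, hz⟩ ⟨z', hz'⟩ hzz
  refine hP z z' hzz fun hs => hne ?_
  simp only [Set.mem_preimage, Set.mem_singleton_iff] at hz hz'
  rcases Sym2.eq_iff.1 hs with ⟨rfl, rfl⟩ | ⟨rfl, rfl⟩ <;> rw [hz, hz']

/-- Collapsing connected subgraphs of a tree gives a tree. -/
theorem IsTree.of_collapse {Y : Type*} {U : SimpleGraph Y} (hT : T.IsTree) (p : X → Y)
    (hfib : ∀ a, (T.induce (p ⁻¹' {a})).Connected)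
    (hadj : ∀ a b, U.Adj a b ↔ a ≠ b ∧ ∃ v w, p v = a ∧ p w = b ∧ T.Adj v w) : U.IsTree := by
  have hsurj : ∀ a, ∃ x, p x = a := fun a => by
    obtain ⟨⟨x, hx⟩⟩ := (hfib a).nonempty
    exact ⟨x, hx⟩
  have hconn : U.Connected := by
    have : Nonempty Y := hT.connected.nonempty.map p
    refine ⟨fun a b => ?_⟩
    obtain ⟨x, rfl⟩ := hsurj a
    obtain ⟨y, rfl⟩ := hsurj b
    refine (hT.connected.preconnected x y).of_forall_adj (f := p) fun v w hvw => ?_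
    by_cases h : p v = p w
    · rw [h]
    · exact ((hadj _ _).2 ⟨h, v, w, rfl, rfl, hvw⟩).reachable
  refine hconn.isTree_of_cut fun a b hab => ?_
  obtain ⟨hne, v, w, hv, hw, hvw⟩ := (hadj a b).1 hab
  obtain ⟨P, hPv, hPw, hP⟩ := hT.exists_cut hvw
  have hconst := cut_const_of_fiber_connected p hfib (by rwa [hv, hw]) hP
  refine ⟨fun c => ∃ x, p x = c ∧ P x, ⟨v, hv, hPv⟩, ?_, ?_⟩
  · rintro ⟨x, hx, hPx⟩
    exact hPw ((hconst x w (hx.trans hw.symm)).1 hPx)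
  · have key : ∀ c d, U.Adj c d → s(c, d) ≠ s(a, b) → (∃ x, p x = c ∧ P x) →
        ∃ x, p x = d ∧ P x := by
      rintro c d hcd hs ⟨x, hx, hPx⟩
      obtain ⟨-, z, z', rfl, rfl, hzz⟩ := (hadj c d).1 hcd
      refine ⟨z', rfl, (hP z z' hzz fun h => hs ?_).1 ((hconst _ _ hx).1 hPx)⟩
      rw [← hv, ← hw]
      simpa using congrArg (Sym2.map p) h
    exact fun c d hcd hs => ⟨key c d hcd hs, key d c hcd.symm (by rwa [Sym2.eq_swap])⟩

/-- In a tree, two disjoint connected subsets are joined by at most one edge. -/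
theorem IsTree.edge_unique_of_collapse {Y : Type*} (hT : T.IsTree) (p : X → Y)
    (hfib : ∀ a, (T.induce (p ⁻¹' {a})).Connected) {v w v' w' : X} (hvw : T.Adj v w)
    (hvw' : T.Adj v' w') (hv : p v = p v') (hw : p w = p w') (hne : p v ≠ p w) :
    v = v' ∧ w = w' := by
  obtain ⟨P, hPv, hPw, hP⟩ := hT.exists_cut hvw
  have hconst := cut_const_of_fiber_connected p hfib hne hP
  by_contra hcon
  have : s(v', w') ≠ s(v, w) := by
    intro hs
    rcases Sym2.eq_iff.1 hs with ⟨rfl, rfl⟩ | ⟨rfl, rfl⟩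
    · exact hcon ⟨rfl, rfl⟩
    · exact hne hv
  exact hPw ((hconst _ _ hw).2 ((hP v' w' hvw' this).1 ((hconst _ _ hv).1 hPv)))

end SimpleGraph

/-! ### Decompositions and their universal property -/

theorem mem_conjBy {W : Type*} [Group W] {g x : W} {K : Subgroup W} :
    x ∈ conjBy g K ↔ g⁻¹ * x * g ∈ K := by
  constructor
  · rintro ⟨y, hy, rfl⟩
    simpa [mul_assoc] using hy
  · intro h
    exact ⟨_, h, by simp [mul_assoc]⟩

theorem conjBy_one {W : Type*} [Group W] (K : Subgroup W) : conjBy 1 K = K := by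
  ext x; simp [mem_conjBy]

theorem conjBy_conjBy {W : Type*} [Group W] (g h : W) (K : Subgroup W) :
    conjBy g (conjBy h K) = conjBy (g * h) K := by
  ext x; simp [mem_conjBy, mul_assoc]

theorem conjBy_mono {W : Type*} [Group W] (g : W) {K K' : Subgroup W} (h : K ≤ K') :
    conjBy g K ≤ conjBy g K' :=
  Subgroup.map_mono h

theorem conjBy_le_iff {W : Type*} [Group W] {g : W} {K K' : Subgroup W} :
    conjBy g K ≤ K' ↔ K ≤ conjBy g⁻¹ K' := by
  constructor
  · intro h
    simpa [conjBy_conjBy, conjBy_one] using conjBy_mono g⁻¹ h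
  · intro h
    simpa [conjBy_conjBy, conjBy_one] using conjBy_mono g h

theorem conjBy_of_mem {W : Type*} [Group W] {g : W} {K : Subgroup W} (hg : g ∈ K) :
    conjBy g K = K := by
  ext x
  rw [mem_conjBy, K.mul_mem_cancel_right hg, K.mul_mem_cancel_left (K.inv_mem hg)]

theorem conjBy_injective {W : Type*} [Group W] (g : W) :
    Function.Injective (conjBy g : Subgroup W → Subgroup W) := by
  intro K K' h
  simpa [conjBy_conjBy, conjBy_one] using congrArg (conjBy g⁻¹) h

theorem conjBy_le_of_mem {W : Type*} [Group W] {g : W} {K H : Subgroup W} (hg : g ∈ H)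
    (h : K ≤ H) : conjBy g K ≤ H :=
  (conjBy_mono g h).trans (conjBy_of_mem hg).le

theorem conjBy_inf {W : Type*} [Group W] (g : W) (K K' : Subgroup W) :
    conjBy g (K ⊓ K') = conjBy g K ⊓ conjBy g K' := by
  ext x; simp [mem_conjBy]

namespace SubgroupGraph

section

variable {W : Type*} [Group W] {ι : Type*} {Λ : SubgroupGraph W ι} {H : Subgroup W}

@[simp]
theorem coprodHom_of (v : ι) (x : Λ.vgrp v) :
    Λ.coprodHom (Monoid.CoprodI.of (M := fun v => Λ.vgrp v) x) = x := by
  simp [coprodHom]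

theorem range_coprodHom (Λ : SubgroupGraph W ι) : Λ.coprodHom.range = ⨆ v, Λ.vgrp v := by
  simp [coprodHom, Monoid.CoprodI.range_eq_iSup]

theorem IsDecompositionOf.iSup_eq (h : Λ.IsDecompositionOf H) : ⨆ v, Λ.vgrp v = H := by
  rw [← range_coprodHom, h.range_eq]

theorem IsDecompositionOf.vgrp_le (h : Λ.IsDecompositionOf H) (v : ι) : Λ.vgrp v ≤ H :=
  (le_iSup _ v).trans h.iSup_eq.le

theorem egrp_le_right (Λ : SubgroupGraph W ι) {v w : ι} (h : Λ.graph.Adj v w) :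
    Λ.egrp v w ≤ Λ.vgrp w :=
  (Λ.egrp_comm v w).le.trans (Λ.egrp_le h.symm)

/-- The homomorphisms `f v` agree on the edge groups. -/
def Agree {K : Type*} [Group K] (Λ : SubgroupGraph W ι) (f : ∀ v, Λ.vgrp v →* K) : Prop :=
  ∀ v w, Λ.graph.Adj v w → ∀ (x : Λ.vgrp v) (y : Λ.vgrp w), (x : W) = y →
    (x : W) ∈ Λ.egrp v w → f v x = f w y

/-- The universal property of the fundamental group: the map induced on the free product kills the
relators, which normally generate the kernel of `coprodHom`. -/
theorem IsDecompositionOf.exists_lift {K : Type*} [Group K] (h : Λ.IsDecompositionOf H)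
    (f : ∀ v, Λ.vgrp v →* K) (hf : Λ.Agree f) :
    ∃ F : H →* K, ∀ v (x : Λ.vgrp v) (hx : (x : W) ∈ H), F ⟨x, hx⟩ = f v x := by
  obtain ⟨-, rfl, hker⟩ := h
  let φ := Λ.coprodHom.rangeRestrict
  have hφ : Function.Surjective φ := Λ.coprodHom.rangeRestrict_surjective
  have hle : φ.ker ≤ (Monoid.CoprodI.lift f).ker := by
    rw [MonoidHom.ker_rangeRestrict, hker]
    refine Subgroup.normalClosure_le_normal ?_
    rintro _ ⟨v, w, hvw, x, hx, rfl⟩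
    rw [SetLike.mem_coe, MonoidHom.mem_ker, map_mul, map_inv, mul_inv_eq_one,
      Monoid.CoprodI.lift_of, Monoid.CoprodI.lift_of]
    exact hf v w hvw _ _ rfl hx
  refine ⟨φ.liftOfSurjective hφ ⟨Monoid.CoprodI.lift f, hle⟩, fun v x hx => ?_⟩
  have : (⟨x, hx⟩ : Λ.coprodHom.range) = φ (Monoid.CoprodI.of (M := fun v => Λ.vgrp v) x) :=
    Subtype.ext (coprodHom_of v x).symm
  rw [this, MonoidHom.liftOfRightInverse_comp_apply, Monoid.CoprodI.lift_of]

end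

/-- It suffices to lift the canonical maps to the free product modulo the relators: the lift factors
the quotient map through `H`, so the kernel of `coprodHom` is no larger than the normal closure. The
universe of `K` is that of this quotient. -/
theorem IsDecompositionOf.of_exists_lift.{x, y} {W : Type x} [Group W] {ι : Type y}
    {Λ : SubgroupGraph W ι} {H : Subgroup W} (htree : Λ.graph.IsTree)
    (hsup : ⨆ v, Λ.vgrp v = H)
    (hlift : ∀ (K : Type (max x y)) [Group K] (f : ∀ v, Λ.vgrp v →* K), Λ.Agree f →
      ∃ F : H →* K, ∀ v (x : Λ.vgrp v) (hx : (x : W) ∈ H), F ⟨x, hx⟩ = f v x) :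
    Λ.IsDecompositionOf H := by
  have hrange : Λ.coprodHom.range = H := by rw [range_coprodHom, hsup]
  refine ⟨htree, hrange, le_antisymm ?_ ?_⟩
  · let N := Subgroup.normalClosure Λ.relators
    obtain ⟨F, hF⟩ := hlift (Monoid.CoprodI (fun v => Λ.vgrp v) ⧸ N)
      (fun v => (QuotientGroup.mk' N).comp (Monoid.CoprodI.of (M := fun v => Λ.vgrp v))) (by
        intro v w hvw x y hxy hx
        simp only [MonoidHom.comp_apply]
        rw [QuotientGroup.mk'_eq_mk']
        refine ⟨(Monoid.CoprodI.of (M := fun v => Λ.vgrp v) x)⁻¹ * Monoid.CoprodI.of (M := fun v => Λ.vgrp v) y, ?_,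
          by simp⟩
        -- The quotient of the two copies of `x` is literally the relator of the element `x⁻¹`.
        have hx' : (x : W)⁻¹ ∈ Λ.egrp v w := inv_mem hx
        have := Subgroup.subset_normalClosure (s := Λ.relators) ⟨v, w, hvw, _, hx', rfl⟩
        have hy : y = (⟨(x : W)⁻¹, Λ.egrp_le_right hvw hx'⟩ : Λ.vgrp w)⁻¹ :=
          Subtype.ext (by simp [hxy])
        rw [hy, map_inv, ← map_inv]
        exact this)
    have hmem : ∀ z, Λ.coprodHom z ∈ H := fun z => hrange ▸ ⟨z, rfl⟩
    have hcomp : F.comp (Λ.coprodHom.codRestrict H hmem) = QuotientGroup.mk' N := by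
      refine Monoid.CoprodI.ext_hom _ _ fun v => ?_
      ext x
      have := hF v x (by rw [← coprodHom_of v x]; exact hmem _)
      simp only [MonoidHom.comp_apply] at this ⊢
      rw [← this]
      congr 1
    intro z hz
    rw [← QuotientGroup.eq_one_iff (N := N), ← QuotientGroup.mk'_apply, ← hcomp,
      MonoidHom.comp_apply]
    have : Λ.coprodHom.codRestrict H hmem z = 1 := Subtype.ext hz
    rw [this, map_one]
  · refine Subgroup.normalClosure_le_normal ?_
    rintro _ ⟨v, w, hvw, x, hx, rfl⟩
    simp [MonoidHom.mem_ker]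

/-! ### Images and collapses of decompositions -/

section

variable {W : Type*} [Group W] {ι κ : Type*} {Λ : SubgroupGraph W ι} {H : Subgroup W}

/-- The image of a graph of groups under a homomorphism. -/
def map {W' : Type*} [Group W'] (Λ : SubgroupGraph W ι) (f : W →* W') : SubgroupGraph W' ι where
  graph := Λ.graph
  vgrp v := (Λ.vgrp v).map f
  egrp v w := (Λ.egrp v w).map f
  egrp_comm v w := by rw [Λ.egrp_comm]
  egrp_le h := Subgroup.map_mono (Λ.egrp_le h)

theorem IsDecompositionOf.map {W' : Type*} [Group W'] (h : Λ.IsDecompositionOf H) {f : W →* W'}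
    (hf : Function.Injective f) : (Λ.map f).IsDecompositionOf (H.map f) := by
  refine .of_exists_lift h.isTree ?_ fun K _ φ hφ => ?_
  · conv_rhs => rw [← h.iSup_eq]
    exact (Subgroup.map_iSup _ _).symm
  · obtain ⟨F, hF⟩ := h.exists_lift
      (fun v => (φ v).comp ((Λ.vgrp v).equivMapOfInjective f hf).toMonoidHom) (by
        intro v w hvw x y hxy hx
        exact hφ v w hvw _ _ (congrArg f hxy) ⟨x, hx, rfl⟩)
    refine ⟨F.comp (H.equivMapOfInjective f hf).symm.toMonoidHom, ?_⟩
    rintro v ⟨_, x, hx, rfl⟩ hxH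
    have h1 := hF v ⟨x, hx⟩ (h.vgrp_le v hx)
    have h2 : (H.equivMapOfInjective f hf).symm ⟨f x, hxH⟩ = ⟨x, h.vgrp_le v hx⟩ := by
      rw [MulEquiv.symm_apply_eq]
      rfl
    simp only [MonoidHom.comp_apply, MulEquiv.coe_toMonoidHom, h2, h1]
    rfl

/-- A decomposition can be collapsed along a map of trees. -/
theorem IsDecompositionOf.collapse {Λ₁ : SubgroupGraph W κ} (h : Λ.IsDecompositionOf H)
    (p : ι → κ) (htree : Λ₁.graph.IsTree) (hle : ∀ v, Λ.vgrp v ≤ Λ₁.vgrp (p v))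
    (hsup : ∀ a, Λ₁.vgrp a ≤ ⨆ v : {v // p v = a}, Λ.vgrp v)
    (hedge : ∀ v w, Λ.graph.Adj v w → p v ≠ p w →
      Λ₁.graph.Adj (p v) (p w) ∧ Λ.egrp v w ≤ Λ₁.egrp (p v) (p w)) :
    Λ₁.IsDecompositionOf H := by
  have hvle : ∀ a, Λ₁.vgrp a ≤ H := fun a =>
    (hsup a).trans (iSup_le fun v => h.vgrp_le v)
  refine .of_exists_lift htree (le_antisymm (iSup_le hvle) ?_) fun K _ φ hφ => ?_
  · conv_lhs => rw [← h.iSup_eq]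
    exact iSup_le fun v => (hle v).trans (le_iSup _ _)
  · obtain ⟨F, hF⟩ := h.exists_lift
      (fun v => (φ (p v)).comp (Subgroup.inclusion (hle v))) (by
        intro v w hvw x y hxy hx
        simp only [MonoidHom.comp_apply]
        by_cases hp : p v = p w
        · have : ∀ a b (hab : a = b) (x : Λ₁.vgrp a) (y : Λ₁.vgrp b), (x : W) = y →
              φ a x = φ b y := by
            rintro a _ rfl x y hxy
            rw [Subtype.ext hxy]
          exact this _ _ hp _ _ (by simpa using hxy)
        · obtain ⟨h1, h2⟩ := hedge v w hvw hp
          exact hφ _ _ h1 _ _ (by simpa using hxy) (h2 (by simpa using hx)))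
    refine ⟨F, fun a x hx => ?_⟩
    have hmain : Λ₁.vgrp a ≤ ((F.comp (Subgroup.inclusion (hvle a))).eqLocus (φ a)).map
        (Λ₁.vgrp a).subtype := by
      refine (hsup a).trans (iSup_le ?_)
      rintro ⟨v, rfl⟩ y hy
      refine ⟨⟨y, hle v hy⟩, ?_, rfl⟩
      exact hF v ⟨y, hy⟩ (h.vgrp_le v hy)
    obtain ⟨y, hy, hyx⟩ := hmain x.2
    have : y = x := Subtype.ext hyx
    subst this
    exact hy

theorem IsDecompositionOf.of_isCollapseVia {Λ₁ : SubgroupGraph W κ} {p : ι → κ}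
    (h : Λ.IsDecompositionOf H) (hp : Λ.IsCollapseVia Λ₁ p) : Λ₁.IsDecompositionOf H := by
  refine h.collapse p (h.isTree.of_collapse p hp.fiber_connected hp.adj_iff) ?_ ?_ ?_
  · intro v
    obtain ⟨w, hw, he, hmax⟩ := hp.vgrp_eq (p v)
    rw [he]
    exact hmax v rfl
  · intro a
    obtain ⟨w, hw, he, hmax⟩ := hp.vgrp_eq a
    rw [he]
    exact le_iSup (fun v : {v // p v = a} => Λ.vgrp v) ⟨w, hw⟩
  · intro v w hvw hne
    exact ⟨(hp.adj_iff _ _).2 ⟨hne, v, w, rfl, rfl, hvw⟩, (hp.egrp_eq v w hvw hne).ge⟩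

theorem isTree_top_bool : (⊤ : SimpleGraph Bool).IsTree := by
  refine SimpleGraph.Connected.isTree_of_cut SimpleGraph.connected_top fun x y hxy => ?_
  refine ⟨fun z => z = x, rfl, fun h => hxy h.symm, fun z w hzw hne => ?_⟩
  exfalso
  revert x y z w
  decide

/-- An edge of a decomposition of `H` splits `H` as an amalgamated product. -/
theorem IsDecompositionOf.exists_amalgam (h : Λ.IsDecompositionOf H) {a b : ι}
    (hab : Λ.graph.Adj a b) :
    ∃ (P Q : Subgroup W) (hP : Λ.egrp a b ≤ P) (hQ : Λ.egrp a b ≤ Q) (R : ι → Prop),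
      R a ∧ ¬ R b ∧ (∀ z w, Λ.graph.Adj z w → s(z, w) ≠ s(a, b) → (R z ↔ R w)) ∧
      (∀ z, R z → Λ.vgrp z ≤ P) ∧ (∀ z, ¬ R z → Λ.vgrp z ≤ Q) ∧
      (amalgam P Q (Λ.egrp a b) hP hQ).IsDecompositionOf H := by
  classical
  obtain ⟨R, hRa, hRb, hR⟩ := h.isTree.exists_cut hab
  -- The two sides of the edge are collapsed to the two vertices of the amalgam.
  let p : ι → Bool := fun z => !decide (R z)
  let P : Subgroup W := ⨆ v : {v // p v = false}, Λ.vgrp v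
  let Q : Subgroup W := ⨆ v : {v // p v = true}, Λ.vgrp v
  have hpa : p a = false := by simp [p, hRa]
  have hpb : p b = true := by simp [p, hRb]
  have hPa : Λ.vgrp a ≤ P := le_iSup (fun v : {v // p v = false} => Λ.vgrp v) ⟨a, hpa⟩
  have hQb : Λ.vgrp b ≤ Q := le_iSup (fun v : {v // p v = true} => Λ.vgrp v) ⟨b, hpb⟩
  have hle : ∀ z, Λ.vgrp z ≤ if p z then Q else P := by
    intro z
    split_ifs with hz
    · exact le_iSup (fun v : {v // p v = true} => Λ.vgrp v) ⟨z, hz⟩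
    · exact le_iSup (fun v : {v // p v = false} => Λ.vgrp v) ⟨z, by simpa using hz⟩
  refine ⟨P, Q, (Λ.egrp_le hab).trans hPa, (Λ.egrp_le_right hab).trans hQb, R, hRa, hRb, hR,
    fun z hz => ?_, fun z hz => ?_, ?_⟩
  · simpa [p, hz] using hle z
  · simpa [p, hz] using hle z
  · refine h.collapse p isTree_top_bool hle ?_ ?_
    · rintro (_ | _)
      · exact le_rfl
      · exact le_rfl
    · intro v w hvw hne
      refine ⟨hne, ?_⟩
      have hs : s(v, w) = s(a, b) := by
        by_contra hs
        exact hne (by simp [p, hR v w hvw hs])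
      rcases Sym2.eq_iff.1 hs with ⟨rfl, rfl⟩ | ⟨rfl, rfl⟩
      · exact le_rfl
      · exact (Λ.egrp_comm _ _).le

end

end SubgroupGraph

/-! ### The Bass–Serre tree -/

namespace SubgroupGraph

section Chains

open scoped Pointwise

/-- Chains modulo two on the edges of the Bass–Serre tree, where an edge is a coset of an edge
group. -/
abbrev Chain (κ W : Type*) := Sym2 κ × Set W → ZMod 2

/-- The action of `W` on chains by translation. -/
def chainAct (κ : Type*) {W : Type*} [Group W] : W →* Equiv.Perm (Chain κ W) where
  toFun g :=
    { toFun := fun a z => a (z.1, g⁻¹ • z.2)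
      invFun := fun a z => a (z.1, g • z.2)
      left_inv := fun a => by ext z; simp
      right_inv := fun a => by ext z; simp }
  map_one' := by ext a z; simp
  map_mul' g h := by ext a z; simp [mul_smul]

theorem chainAct_apply {κ W : Type*} [Group W] (g : W) (a : Chain κ W) (z : Sym2 κ × Set W) :
    chainAct κ g a z = a (z.1, g⁻¹ • z.2) := rfl

open Classical in
/-- The chain of the edge `g Λ(e)`. -/
noncomputable def edgeChain {κ W : Type*} [Group W] (Λ : SubgroupGraph W κ) (v w : κ) (g : W) :
    Chain κ W :=
  Pi.single (s(v, w), g • (Λ.egrp v w : Set W)) 1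

variable {κ W : Type*} [Group W] {Λ : SubgroupGraph W κ} {H : Subgroup W}

theorem edgeChain_swap (v w : κ) (g : W) : Λ.edgeChain w v g = Λ.edgeChain v w g := by
  rw [edgeChain, edgeChain, Sym2.eq_swap, Λ.egrp_comm]

theorem neg_edgeChain (v w : κ) (g : W) : -Λ.edgeChain v w g = Λ.edgeChain v w g := by
  ext z
  simp [ZMod.neg_eq_self_mod_two]

theorem chainAct_edgeChain (v w : κ) (g h : W) :
    chainAct κ g (Λ.edgeChain v w h) = Λ.edgeChain v w (g * h) := by
  classical
  ext ⟨e, S⟩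
  simp only [chainAct_apply, edgeChain, Pi.single_apply, Prod.mk.injEq, mul_smul,
    inv_smul_eq_iff]

theorem edgeChain_of_mem {v w : κ} {g : W} (hg : g ∈ Λ.egrp v w) :
    Λ.edgeChain v w g = Λ.edgeChain v w 1 := by
  rw [edgeChain, edgeChain, one_smul, smul_coe_set hg]

theorem mem_of_edgeChain_eq {v w v' w' : κ} {g g' : W}
    (h : Λ.edgeChain v w g = Λ.edgeChain v' w' g') :
    s(v, w) = s(v', w') ∧ g'⁻¹ * g ∈ Λ.egrp v' w' := by
  classical
  have h1 := congrFun h (s(v, w), g • (Λ.egrp v w : Set W))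
  rw [edgeChain, edgeChain, Pi.single_eq_same, Pi.single_apply] at h1
  split_ifs at h1 with h2
  · rw [Prod.mk.injEq] at h2
    refine ⟨h2.1, ?_⟩
    have : g ∈ g' • (Λ.egrp v' w' : Set W) := by
      rw [← h2.2]
      exact ⟨1, one_mem _, by simp⟩
    rwa [Set.mem_smul_set_iff_inv_smul_mem] at this
  · exact absurd h1 one_ne_zero

/-- A function on the vertices of the Bass–Serre graph that changes along each edge by exactly the
chain of that edge. It is built before the graph is known to be a tree, and implies that it is one:
each edge is detected by its own coefficient. -/
theorem IsDecompositionOf.exists_chain (h : Λ.IsDecompositionOf H) :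
    ∃ P : Λ.BassSerreVertex H → Chain κ W, ∀ v w (g : H), Λ.graph.Adj v w →
      P ⟨w, g⟩ = P ⟨v, g⟩ + Λ.edgeChain v w g := by
  obtain ⟨σ, hσ⟩ := h.isTree.exists_potential
    (K := Multiplicative (Chain κ W)) (fun v w => Multiplicative.ofAdd (Λ.edgeChain v w 1))
    (fun v w _ => by
      rw [← ofAdd_neg, neg_edgeChain, edgeChain_swap])
  let p : κ → Chain κ W := fun v => (σ v).toAdd
  have hp : ∀ v w, Λ.graph.Adj v w → p w = p v + Λ.edgeChain v w 1 := fun v w hvw => by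
    simp only [p, hσ v w hvw, toAdd_mul, toAdd_ofAdd]
  -- `Λ(v)` acts by the affine maps with translation as linear part that fix `p v`. For adjacent `v`
  -- and `w` the points `p v` and `p w` differ by an edge chain that is invariant under the edge
  -- group, so the actions agree there and combine to an affine action `F` of `H`.
  let f : ∀ v, Λ.vgrp v →* Equiv.Perm (Chain κ W) := fun v =>
    (MulAut.conj (Equiv.addLeft (p v))).toMonoidHom.comp
      ((chainAct κ).comp (Λ.vgrp v).subtype)
  have hfapp : ∀ v x a, f v x a = p v + chainAct κ (x : W) (-p v + a) := fun v x a => rfl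
  have hadd : ∀ (g : W) (a b : Chain κ W), chainAct κ g (a + b) = chainAct κ g a + chainAct κ g b :=
    fun g a b => rfl
  have hneg : ∀ (g : W) (a : Chain κ W), chainAct κ g (-a) = -chainAct κ g a :=
    fun g a => rfl
  obtain ⟨F, hF⟩ := h.exists_lift f (by
    intro v w hvw x y hxy hx
    ext1 a
    rw [hfapp, hfapp, ← hxy, hp v w hvw]
    simp only [hadd, hneg, chainAct_edgeChain, mul_one, neg_add_rev, edgeChain_of_mem hx]
    abel)
  have haff : ∀ (g : H) (a b : Chain κ W), F g (a + b) = F g a + chainAct κ (g : W) b := by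
    have : ∀ (x : W) (hx : x ∈ ⨆ v, Λ.vgrp v), ∀ hxH : x ∈ H, ∀ a b : Chain κ W,
        F ⟨x, hxH⟩ (a + b) = F ⟨x, hxH⟩ a + chainAct κ x b := by
      intro x hx
      refine Subgroup.iSup_induction' (C := fun x _ => ∀ hxH : x ∈ H, ∀ a b : Chain κ W,
        F ⟨x, hxH⟩ (a + b) = F ⟨x, hxH⟩ a + chainAct κ x b) Λ.vgrp ?_ ?_ ?_ hx
      · intro v x hx hxH a b
        rw [hF v ⟨x, hx⟩ hxH, hfapp, hfapp, ← add_assoc, hadd, add_assoc]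
      · intro hxH a b
        have : (⟨1, hxH⟩ : H) = 1 := rfl
        simp [this]
      · intro x y hx hy ihx ihy hxy a b
        have hxH : x ∈ H := h.iSup_eq ▸ hx
        have hyH : y ∈ H := h.iSup_eq ▸ hy
        have : (⟨x * y, hxy⟩ : H) = ⟨x, hxH⟩ * ⟨y, hyH⟩ := rfl
        rw [this, map_mul, Equiv.Perm.mul_apply, ihy, ihx, map_mul]
        rfl
    exact fun g => this g (h.iSup_eq.symm ▸ g.2) g.2
  -- `Λ(v)` fixes `p v`, so the value of the orbit map at `g` depends only on the coset `g Λ(v)`.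
  have hwd : ∀ v (g : H), F (g : H ⧸ (Λ.vgrp v).subgroupOf H).out (p v) = F g (p v) := by
    intro v g
    obtain ⟨⟨k, hk⟩, hk'⟩ := QuotientGroup.mk_out_eq_mul ((Λ.vgrp v).subgroupOf H) g
    rw [hk', map_mul, Equiv.Perm.mul_apply]
    congr 1
    have := hF v ⟨k, hk⟩ k.2
    simp only [Subtype.coe_eta] at this
    rw [this, hfapp, neg_add_cancel]
    exact add_zero _
  refine ⟨fun x => F x.2.out (p x.1), fun v w g hvw => ?_⟩
  simp only [hwd]
  rw [hp v w hvw, haff, chainAct_edgeChain, mul_one]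

/-- For `x` in both vertex groups, the edges given by `1` and by `x` have the same endpoints. The
chain function then has the same jump along both, so they are the same coset of the edge group. -/
theorem IsDecompositionOf.inf_eq_egrp (h : Λ.IsDecompositionOf H) {v w : κ}
    (hvw : Λ.graph.Adj v w) : Λ.vgrp v ⊓ Λ.vgrp w = Λ.egrp v w := by
  refine le_antisymm ?_ (le_inf (Λ.egrp_le hvw) (Λ.egrp_le_right hvw))
  rintro x ⟨hxv, hxw⟩
  obtain ⟨P, hP⟩ := h.exists_chain
  have h1 := hP v w 1 hvw
  have h2 := hP v w ⟨x, h.vgrp_le v hxv⟩ hvw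
  have e1 : ((⟨x, h.vgrp_le v hxv⟩ : H) : H ⧸ (Λ.vgrp v).subgroupOf H) = ((1 : H) : _) := by
    rw [eq_comm, QuotientGroup.eq]
    simpa [Subgroup.mem_subgroupOf] using hxv
  have e2 : ((⟨x, h.vgrp_le v hxv⟩ : H) : H ⧸ (Λ.vgrp w).subgroupOf H) = ((1 : H) : _) := by
    rw [eq_comm, QuotientGroup.eq]
    simpa [Subgroup.mem_subgroupOf] using hxw
  rw [e1, e2, h1] at h2
  simpa using (mem_of_edgeChain_eq (add_left_cancel h2).symm).2

theorem bassSerre_reachable (hΛ : Λ.graph.Connected) (v w : κ) (g : H) :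
    (Λ.bassSerre H).Reachable ⟨v, g⟩ ⟨w, g⟩ :=
  (hΛ.preconnected v w).of_forall_adj
    (f := fun v => (⟨v, g⟩ : Λ.BassSerreVertex H))
    fun a b hab => SimpleGraph.Adj.reachable ⟨a, b, g, hab, rfl, rfl⟩

/-- Connected because the vertex groups generate `H`. For the cut at an edge, use the coefficient of
this edge in the function of `exists_chain`: it changes across this edge and across no other. -/
theorem IsDecompositionOf.bassSerre_isTree (h : Λ.IsDecompositionOf H) :
    (Λ.bassSerre H).IsTree := by
  obtain ⟨v₀⟩ := h.isTree.connected.nonempty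
  have hreach : ∀ x, x ∈ ⨆ v, Λ.vgrp v → ∀ hx : x ∈ H, ∀ g : H,
      (Λ.bassSerre H).Reachable ⟨v₀, (g : H ⧸ _)⟩ ⟨v₀, ((g * ⟨x, hx⟩ : H) : H ⧸ _)⟩ := by
    intro x hx
    refine Subgroup.iSup_induction' (C := fun x _ => ∀ hx : x ∈ H, ∀ g : H,
      (Λ.bassSerre H).Reachable ⟨v₀, (g : H ⧸ _)⟩ ⟨v₀, ((g * ⟨x, hx⟩ : H) : H ⧸ _)⟩)
      Λ.vgrp ?_ ?_ ?_ hx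
    · intro v x hx hxH g
      have : ((g * ⟨x, hxH⟩ : H) : H ⧸ (Λ.vgrp v).subgroupOf H) = g := by
        rw [eq_comm, QuotientGroup.eq]
        simpa [Subgroup.mem_subgroupOf] using hx
      refine (bassSerre_reachable h.isTree.connected v₀ v g).trans ?_
      rw [← this]
      exact bassSerre_reachable h.isTree.connected v v₀ _
    · intro hx g
      have : (⟨1, hx⟩ : H) = 1 := rfl
      rw [this, mul_one]
    · intro x y hx hy ihx ihy hxy g
      have hxH : x ∈ H := h.iSup_eq ▸ hx
      have hyH : y ∈ H := h.iSup_eq ▸ hy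
      have : (⟨x * y, hxy⟩ : H) = ⟨x, hxH⟩ * ⟨y, hyH⟩ := rfl
      rw [this, ← mul_assoc]
      exact (ihx hxH g).trans (ihy hyH _)
  have hbase : ∀ x : Λ.BassSerreVertex H,
      (Λ.bassSerre H).Reachable ⟨v₀, ((1 : H) : H ⧸ _)⟩ x := by
    rintro ⟨v, x⟩
    obtain ⟨g, rfl⟩ := QuotientGroup.mk_surjective x
    have := hreach g (h.iSup_eq.symm ▸ g.2) g.2 1
    rw [one_mul] at this
    exact this.trans (bassSerre_reachable h.isTree.connected v₀ v g)
  have : Nonempty (Λ.BassSerreVertex H) := ⟨⟨v₀, ((1 : H) : H ⧸ _)⟩⟩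
  have hconn : (Λ.bassSerre H).Connected := ⟨fun x y => (hbase x).symm.trans (hbase y)⟩
  obtain ⟨P, hP⟩ := h.exists_chain
  refine hconn.isTree_of_cut ?_
  rintro _ _ ⟨v, w, g, hvw, rfl, rfl⟩
  classical
  let z : Sym2 κ × Set W := (s(v, w), (g : W) • (Λ.egrp v w : Set W))
  refine ⟨fun x => P x z = P ⟨v, g⟩ z, rfl, ?_, ?_⟩
  · beta_reduce
    rw [hP v w g hvw]
    simp [edgeChain, z]
  · rintro _ _ ⟨v', w', g', hvw', rfl, rfl⟩ hne
    beta_reduce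
    rw [hP v' w' g' hvw']
    have hz : Λ.edgeChain v' w' g' z = 0 := by
      rw [edgeChain, Pi.single_apply, if_neg]
      intro hz
      refine hne ?_
      have : Λ.edgeChain v w g = Λ.edgeChain v' w' g' := by
        rw [edgeChain, edgeChain, ← hz]
      obtain ⟨h1, h2⟩ := mem_of_edgeChain_eq this
      have hv : ((g' : H) : H ⧸ (Λ.vgrp v').subgroupOf H) = g := by
        rw [QuotientGroup.eq]
        exact Λ.egrp_le hvw' h2
      have hw : ((g' : H) : H ⧸ (Λ.vgrp w').subgroupOf H) = g := by
        rw [QuotientGroup.eq]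
        exact Λ.egrp_le_right hvw' h2
      rw [hv, hw]
      rcases Sym2.eq_iff.1 h1 with ⟨rfl, rfl⟩ | ⟨rfl, rfl⟩
      · rfl
      · exact Sym2.eq_swap
    rw [Pi.add_apply, hz, add_zero]

end Chains

end SubgroupGraph

/-! ### Groups acting on trees -/

namespace SimpleGraph

variable {L X : Type*} [Group L] [MulAction L X] {T : SimpleGraph X}

/-- The action preserves adjacency. -/
def ActsOn (L : Type*) [Group L] {X : Type*} [MulAction L X] (T : SimpleGraph X) : Prop :=
  ∀ (g : L) (x y : X), T.Adj x y → T.Adj (g • x) (g • y)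

theorem ActsOn.reachable (h : ActsOn L T) (g : L) {x y : X} (hxy : T.Reachable x y) :
    T.Reachable (g • x) (g • y) :=
  hxy.of_forall_adj (f := (g • ·)) fun a b hab => (h g a b hab).reachable

theorem ActsOn.dist_smul (h : ActsOn L T) (hT : T.Connected) (g : L) (x y : X) :
    T.dist (g • x) (g • y) = T.dist x y := by
  have key : ∀ (g : L) (x y : X), T.dist (g • x) (g • y) ≤ T.dist x y := by
    intro g x y
    obtain ⟨p, hp⟩ := hT.exists_walk_length_eq_dist x y
    let φ : T →g T := ⟨(g • ·), fun {a b} => h g a b⟩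
    rw [← hp, ← Walk.length_map φ p]
    exact dist_le _
  refine le_antisymm (key g x y) ?_
  simpa using key g⁻¹ (g • x) (g • y)

theorem ActsOn.toward_smul (h : ActsOn L T) (hT : T.Connected) (g : L) {k x y : X}
    (hk : T.Toward k x y) : T.Toward (g • k) (g • x) (g • y) :=
  ⟨h g x y hk.1, by rw [h.dist_smul hT, h.dist_smul hT, hk.2]⟩

theorem ActsOn.smul_eq_of_toward (h : ActsOn L T) (hT : T.IsTree) {g : L} {k x y : X}
    (hk : T.Toward k x y) (hgk : g • k = k) (hgx : g • x = x) : g • y = y := by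
  have := h.toward_smul hT.connected g hk
  rw [hgk, hgx] at this
  exact hT.toward_unique this hk

/-- A group that acts on a tree without inversions and with a finite orbit fixes a vertex. -/
theorem ActsOn.exists_fixed_of_finite_orbit (h : ActsOn L T) (hT : T.IsTree) {κ : Type*}
    (τ : X → κ) (hτ : ∀ (g : L) (x : X), τ (g • x) = τ x) (hτ' : ∀ x y, T.Adj x y → τ x ≠ τ y)
    {x₀ : X} (hfin : (MulAction.orbit L x₀).Finite) : ∃ z : X, ∀ g : L, g • z = z := by
  let O := hfin.toFinset
  have hO : ∀ (g : L), ∀ o ∈ O, g • o ∈ O := fun g o ho => by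
    simp only [O, Set.Finite.mem_toFinset] at ho ⊢
    obtain ⟨k, rfl⟩ := ho
    exact ⟨g * k, mul_smul g k x₀⟩
  -- The radius of the orbit as seen from `z`. A vertex `z` that minimizes it is fixed: otherwise
  -- one step from `z` toward `g • z` decreases it.
  let R : X → ℕ := fun z => O.sup (T.dist z)
  have hRg : ∀ (g : L) z, R (g • z) = R z := by
    have : ∀ (g : L) z, R (g • z) ≤ R z := by
      intro g z
      refine Finset.sup_le fun o ho => ?_
      rw [← smul_inv_smul g o, h.dist_smul hT.connected]
      exact Finset.le_sup (f := T.dist z) (hO g⁻¹ o ho)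
    intro g z
    refine le_antisymm (this g z) ?_
    simpa using this g⁻¹ (g • z)
  have : Nonempty X := ⟨x₀⟩
  obtain ⟨z, hz⟩ : ∃ z, ∀ z', R z ≤ R z' := ⟨Function.argmin R, fun z' => Function.argmin_le R z'⟩
  refine ⟨z, fun g => ?_⟩
  by_contra hgz
  obtain ⟨y, hy⟩ := hT.connected.exists_toward (k := g • z) (x := z) (fun h => hgz h.symm)
  have hyz : y ≠ g • z := by
    rintro rfl
    exact hτ' _ _ hy.1 (hτ g z).symm
  have hpos := hT.connected.pos_dist_of_ne hyz
  refine (hz y).not_gt ?_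
  have hx₀ : x₀ ∈ O := by simp [O]
  have hRpos : 0 < R z := by
    have h1 : T.dist z x₀ ≤ R z := Finset.le_sup (f := T.dist z) hx₀
    have h2 : T.dist (g • z) x₀ ≤ R z := by
      rw [← hRg g]; exact Finset.le_sup (f := T.dist (g • z)) hx₀
    by_contra h0
    have e1 : z = x₀ := hT.connected.dist_eq_zero_iff.1 (by omega)
    have e2 : g • z = x₀ := hT.connected.dist_eq_zero_iff.1 (by omega)
    exact hgz (e2.trans e1.symm)
  -- Points of the orbit on the side of `y` get closer. For a point `o` on the side of `z`, the path
  -- from `o` to `g • z` runs through `z` and `y` and has length at most `R z`; as `y ≠ g • z`, this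
  -- leaves room for `dist y o < R z`.
  refine (Finset.sup_lt_iff hRpos).2 fun o ho => ?_
  have h1 : T.dist z o ≤ R z := Finset.le_sup (f := T.dist z) ho
  rcases hT.toward_or_toward hy.1 o with h2 | h2
  · have := h2.2
    omega
  · have h3 := hT.dist_eq_of_toward hy h2
    have h4 : T.dist (g • z) o ≤ R z := by
      rw [← hRg g]; exact Finset.le_sup (f := T.dist (g • z)) ho
    rw [dist_comm] at h4
    have h5 := h2.2
    rw [dist_comm (u := o) (v := z)] at h3
    omega

end SimpleGraph

/-! ### Stabilizers in the Bass–Serre tree and elliptic subgroups -/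

namespace SubgroupGraph

variable {κ W : Type*} [Group W] {Λ : SubgroupGraph W κ} {H : Subgroup W}

theorem bassSerre_actsOn : SimpleGraph.ActsOn H (Λ.bassSerre H) := by
  rintro k _ _ ⟨v, w, g, hvw, rfl, rfl⟩
  exact ⟨v, w, k * g, hvw, rfl, rfl⟩

theorem bassSerre_fst_ne {x y : Λ.BassSerreVertex H} (h : (Λ.bassSerre H).Adj x y) :
    x.1 ≠ y.1 := by
  obtain ⟨v, w, g, hvw, rfl, rfl⟩ := h
  exact hvw.ne

theorem bassSerre_smul_eq_iff (k g : H) (v : κ) :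
    k • (⟨v, g⟩ : Λ.BassSerreVertex H) = ⟨v, g⟩ ↔ (k : W) ∈ conjBy (g : W) (Λ.vgrp v) := by
  rw [Sigma.smul_mk, Sigma.mk.injEq, heq_eq_eq, MulAction.Quotient.smul_coe]
  simp only [true_and]
  rw [eq_comm, QuotientGroup.eq, Subgroup.mem_subgroupOf, mem_conjBy]
  simp only [smul_eq_mul, Subgroup.coe_mul, Subgroup.coe_inv]
  rw [mul_assoc]

theorem bassSerre_exists_adj {u : κ} {g : H} {y : Λ.BassSerreVertex H}
    (h : (Λ.bassSerre H).Adj ⟨u, g⟩ y) : ∃ w, ∃ k : H, Λ.graph.Adj u w ∧ (k : W) ∈ Λ.vgrp u ∧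
      y = ⟨w, ((g * k : H) : H ⧸ _)⟩ := by
  obtain ⟨v, w, g', hvw, hu, rfl⟩ := h
  obtain ⟨rfl, h2⟩ := Sigma.mk.inj_iff.1 hu
  rw [heq_eq_eq, QuotientGroup.eq, Subgroup.mem_subgroupOf] at h2
  exact ⟨w, g⁻¹ * g', hvw, h2, by simp⟩

/-- `D` is contained in a conjugate of a vertex group. -/
def Elliptic (Λ : SubgroupGraph W κ) (H D : Subgroup W) : Prop :=
  ∃ g ∈ H, ∃ a, D ≤ conjBy g (Λ.vgrp a)

theorem elliptic_iff {D : Subgroup W} (hD : D ≤ H) : Λ.Elliptic H D ↔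
    ∃ x : Λ.BassSerreVertex H, ∀ d : H, (d : W) ∈ D → d • x = x := by
  constructor
  · rintro ⟨g, hg, a, ha⟩
    exact ⟨⟨a, (⟨g, hg⟩ : H)⟩, fun d hd => (bassSerre_smul_eq_iff d ⟨g, hg⟩ a).2 (ha hd)⟩
  · rintro ⟨⟨a, x⟩, hx⟩
    obtain ⟨g, rfl⟩ := QuotientGroup.mk_surjective x
    exact ⟨g, g.2, a, fun d hd => (bassSerre_smul_eq_iff ⟨d, hD hd⟩ g a).1 (hx _ hd)⟩

theorem Elliptic.mono {D D' : Subgroup W} (h : Λ.Elliptic H D) (hD : D' ≤ D) :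
    Λ.Elliptic H D' := by
  obtain ⟨g, hg, a, ha⟩ := h
  exact ⟨g, hg, a, hD.trans ha⟩

theorem Elliptic.conjBy {D : Subgroup W} (h : Λ.Elliptic H D) {k : W} (hk : k ∈ H) :
    Λ.Elliptic H (conjBy k D) := by
  obtain ⟨g, hg, a, ha⟩ := h
  exact ⟨k * g, mul_mem hk hg, a, by rw [← conjBy_conjBy]; exact conjBy_mono k ha⟩

/-- A group that fixes two vertices of the Bass–Serre tree fixes an edge at the first one. -/
theorem IsDecompositionOf.le_conjBy_egrp (h : Λ.IsDecompositionOf H) {u a : κ} {g : W}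
    (hg : g ∈ H) {D : Subgroup W} (hD : D ≤ Λ.vgrp u) (hD' : D ≤ conjBy g (Λ.vgrp a))
    (hne : ¬ (a = u ∧ g ∈ Λ.vgrp u)) :
    ∃ w, Λ.graph.Adj u w ∧ ∃ k ∈ Λ.vgrp u, D ≤ conjBy k (Λ.egrp u w) := by
  let x : Λ.BassSerreVertex H := ⟨u, ((1 : H) : H ⧸ _)⟩
  let y : Λ.BassSerreVertex H := ⟨a, ((⟨g, hg⟩ : H) : H ⧸ _)⟩
  have hxy : x ≠ y := by
    intro hxy
    obtain ⟨rfl, h2⟩ := Sigma.mk.inj_iff.1 hxy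
    rw [heq_eq_eq, QuotientGroup.eq, Subgroup.mem_subgroupOf] at h2
    exact hne ⟨rfl, by simpa using h2⟩
  obtain ⟨z, hz⟩ := h.bassSerre_isTree.connected.exists_toward hxy
  obtain ⟨w, k, huw, hk, rfl⟩ := bassSerre_exists_adj hz.1
  refine ⟨w, huw, k, hk, fun d hd => ?_⟩
  have hdH : d ∈ H := h.vgrp_le u (hD hd)
  have h1 : (⟨d, hdH⟩ : H) • x = x :=
    (bassSerre_smul_eq_iff _ _ _).2 (by simpa [conjBy_one] using hD hd)
  have h2 : (⟨d, hdH⟩ : H) • y = y := (bassSerre_smul_eq_iff _ _ _).2 (hD' hd)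
  have h3 := bassSerre_actsOn.smul_eq_of_toward h.bassSerre_isTree hz h2 h1
  rw [bassSerre_smul_eq_iff] at h3
  rw [← h.inf_eq_egrp huw, conjBy_inf]
  exact ⟨by rw [conjBy_of_mem hk]; exact hD hd, by simpa using h3⟩

/-- Otherwise `Λ(u)` fixes a second vertex of the tree, hence an edge at its own vertex, and so
equals an edge group, which is excluded in a reduced decomposition. -/
theorem IsDecompositionOf.eq_of_vgrp_le (h : Λ.IsDecompositionOf H) (hr : Λ.IsReduced) {u a : κ}
    {g : W} (hg : g ∈ H) (hle : Λ.vgrp u ≤ conjBy g (Λ.vgrp a)) : a = u ∧ g ∈ Λ.vgrp u := by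
  by_contra hne
  obtain ⟨w, huw, k, hk, h1⟩ := h.le_conjBy_egrp hg le_rfl hle hne
  refine hr u w huw (le_antisymm (Λ.egrp_le huw) ?_)
  have := conjBy_mono k⁻¹ h1
  rwa [conjBy_conjBy, inv_mul_cancel, conjBy_one, conjBy_of_mem (inv_mem hk)] at this

/-- A subgroup with an elliptic subgroup of finite index is elliptic. -/
theorem IsDecompositionOf.elliptic_of_relIndex_ne_zero (h : Λ.IsDecompositionOf H)
    {K A : Subgroup W} (hA : A ≤ H) (hK : Λ.Elliptic H K)
    (hKA : K.relIndex A ≠ 0) : Λ.Elliptic H A := by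
  have hK' := hK.mono (inf_le_left : K ⊓ A ≤ K)
  obtain ⟨x, hx⟩ := (elliptic_iff (inf_le_right.trans hA)).1 hK'
  let _ : MulAction A (Λ.BassSerreVertex H) := MulAction.compHom _ (Subgroup.inclusion hA)
  have hact : SimpleGraph.ActsOn A (Λ.bassSerre H) := fun g x y hxy =>
    bassSerre_actsOn (Subgroup.inclusion hA g) x y hxy
  have hfin : (MulAction.orbit A x).Finite := by
    have hle : K.subgroupOf A ≤ MulAction.stabilizer A x := fun d hd =>
      hx (Subgroup.inclusion hA d) ⟨hd, d.2⟩
    have h1 : (K.subgroupOf A).FiniteIndex := ⟨hKA⟩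
    have h2 := Subgroup.finiteIndex_of_le hle
    have := Finite.of_equiv _ (MulAction.orbitEquivQuotientStabilizer A x).symm
    exact Set.toFinite _
  obtain ⟨z, hz⟩ := hact.exists_fixed_of_finite_orbit h.bassSerre_isTree Sigma.fst
    (fun _ _ => rfl) (fun _ _ => bassSerre_fst_ne) hfin
  exact (elliptic_iff hA).2 ⟨z, fun d hd => hz ⟨d, hd⟩⟩

theorem IsDecompositionOf.elliptic_of_finite (h : Λ.IsDecompositionOf H) {A : Subgroup W}
    (hA : A ≤ H) [Finite A] : Λ.Elliptic H A := by
  obtain ⟨v⟩ := h.isTree.connected.nonempty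
  refine h.elliptic_of_relIndex_ne_zero (K := ⊥) hA ⟨1, one_mem _, v, bot_le⟩ ?_
  rw [Subgroup.relIndex_bot_left]
  exact Nat.card_pos.ne'

/-- Since `P ⊓ Q = C`, either factor being all of `H` would make the other one equal to `C`. -/
theorem nontrivial_left_ne {P Q C : Subgroup W} {hP : C ≤ P} {hQ : C ≤ Q}
    (h : IsNontrivialSplitting H P Q C hP hQ) : P ≠ H ∧ Q ≠ H := by
  have hadj : (amalgam P Q C hP hQ).graph.Adj false true := by simp [amalgam]
  have hinf : P ⊓ Q = C := h.decomp.inf_eq_egrp hadj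
  have hPH : P ≤ H := h.decomp.vgrp_le false
  have hQH : Q ≤ H := h.decomp.vgrp_le true
  constructor
  · rintro rfl
    rw [inf_eq_right.2 hQH] at hinf
    exact h.right_ne hinf
  · rintro rfl
    rw [inf_eq_left.2 hPH] at hinf
    exact h.left_ne hinf

end SubgroupGraph

/-! ### Splittings from actions on trees -/

theorem SubgroupGraph.amalgam_isDecompositionOf.{x} {W : Type x} [Group W] {H P Q C : Subgroup W}
    (hP : C ≤ P) (hQ : C ≤ Q) (hsup : P ⊔ Q = H)
    (hlift : ∀ (K : Type x) [Group K] (fP : P →* K) (fQ : Q →* K),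
      (∀ x (hx : x ∈ C), fP ⟨x, hP hx⟩ = fQ ⟨x, hQ hx⟩) →
      ∃ F : H →* K, (∀ (x : P) (hx : (x : W) ∈ H), F ⟨x, hx⟩ = fP x) ∧
        ∀ (x : Q) (hx : (x : W) ∈ H), F ⟨x, hx⟩ = fQ x) :
    (amalgam P Q C hP hQ).IsDecompositionOf H := by
  refine .of_exists_lift isTree_top_bool ?_ fun K _ f hf => ?_
  · rw [← hsup, iSup_bool_eq, sup_comm]
    rfl
  · obtain ⟨F, h1, h2⟩ := hlift K (f false) (f true) fun x hx =>
      hf false true (by simp [amalgam]) ⟨x, hP hx⟩ ⟨x, hQ hx⟩ rfl hx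
    refine ⟨F, ?_⟩
    rintro (_ | _) x hx
    · exact h1 x hx
    · exact h2 x hx

namespace SimpleGraph

variable {L X : Type*} [Group L] [MulAction L X] {T : SimpleGraph X}

/-- The graph without the edges in the orbit of the edge `x y`. -/
def removeOrbit (L : Type*) [Group L] {X : Type*} [MulAction L X] (T : SimpleGraph X) (x y : X) :
    SimpleGraph X where
  Adj a b := T.Adj a b ∧ (∀ m : L, ¬ (a = m • x ∧ b = m • y)) ∧
    ∀ m : L, ¬ (b = m • x ∧ a = m • y)
  symm := ⟨fun _ _ h => ⟨h.1.symm, h.2.2, h.2.1⟩⟩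
  loopless := ⟨fun _ h => h.1.ne rfl⟩

theorem removeOrbit_ne {x y a b : X} (h : (removeOrbit L T x y).Adj a b) : s(a, b) ≠ s(x, y) := by
  intro hs
  rcases Sym2.eq_iff.1 hs with ⟨rfl, rfl⟩ | ⟨rfl, rfl⟩
  · exact h.2.1 1 ⟨by simp, by simp⟩
  · exact h.2.2 1 ⟨by simp, by simp⟩

theorem ActsOn.on_removeOrbit (h : ActsOn L T) (x y : X) : ActsOn L (removeOrbit L T x y) := by
  rintro g a b ⟨hab, h1, h2⟩
  refine ⟨h g a b hab, fun m hm => h1 (g⁻¹ * m) ?_, fun m hm => h2 (g⁻¹ * m) ?_⟩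
  · simp [mul_smul, ← hm.1, ← hm.2]
  · simp [mul_smul, ← hm.1, ← hm.2]

/-- A finitely generated group acting on a tree without a fixed vertex has an edge such that
no component of the complement of its orbit is invariant. -/
theorem ActsOn.exists_edge_of_not_fixed (h : ActsOn L T) (hT : T.IsTree) {F : Finset L}
    (hF : Subgroup.closure (F : Set L) = ⊤) (hfix : ¬ ∃ z : X, ∀ g : L, g • z = z) :
    ∃ x y, T.Adj x y ∧ ∀ z, ¬ ∀ g : L, (removeOrbit L T x y).Reachable z (g • z) := by
  -- The vertex `z₀` minimizes the total displacement of the generators, and the edge sought is the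
  -- first one on the way from `z₀` to a translate `f₀ • z₀ ≠ z₀`. An invariant component cannot
  -- contain `z₀`, because the path to `f₀ • z₀` uses the removed edge. If it misses `z₀`, a step
  -- toward it decreases the displacement.
  let D : X → ℕ := fun z => ∑ f ∈ F, T.dist z (f • z)
  have : Nonempty X := hT.connected.nonempty
  obtain ⟨z₀, hz₀⟩ : ∃ z, ∀ z', D z ≤ D z' :=
    ⟨Function.argmin D, fun z' => Function.argmin_le D z'⟩
  obtain ⟨f₀, hf₀, hf₀z⟩ : ∃ f ∈ F, f • z₀ ≠ z₀ := by
    by_contra hcon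
    push Not at hcon
    refine hfix ⟨z₀, fun g => ?_⟩
    have : Subgroup.closure (F : Set L) ≤ MulAction.stabilizer L z₀ := by
      rw [Subgroup.closure_le]
      exact fun f hf => hcon f hf
    rw [hF] at this
    exact this (Subgroup.mem_top g)
  obtain ⟨y, hy⟩ := hT.connected.exists_toward (k := f₀ • z₀) (x := z₀) hf₀z.symm
  refine ⟨z₀, y, hy.1, fun z₁ hz₁ => ?_⟩
  set X' := removeOrbit L T z₀ y with hX'
  have hact' : ActsOn L X' := h.on_removeOrbit z₀ y
  have hinv : ∀ (g : L) k, X'.Reachable z₁ k → X'.Reachable z₁ (g • k) := fun g k hk =>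
    (hz₁ g).trans (hact'.reachable g hk)
  by_cases hmem : X'.Reachable z₁ z₀
  · have h1 : X'.Reachable z₀ (f₀ • z₀) := hmem.symm.trans (hinv f₀ z₀ hmem)
    have h2 := h1.iff_of_locally_const (P := fun z => T.Toward z z₀ y) fun a b hab =>
      hT.toward_iff_of_adj hy.1 hab.1 (removeOrbit_ne hab)
    have h3 := (h2.2 hy).2
    simp at h3
  · have hz₀₁ : z₀ ≠ z₁ := by
      rintro rfl
      exact hmem (Reachable.refl _)
    obtain ⟨y', hy'⟩ := hT.connected.exists_toward hz₀₁
    -- The invariant component avoids `z₀`, so it lies entirely behind one neighbour `y'` of `z₀`.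
    have htow : ∀ k, X'.Reachable z₁ k → T.Toward k z₀ y' := by
      intro k hk
      refine ((hk.iff_of_locally_const
        (P := fun k => X'.Reachable z₁ k ∧ T.Toward k z₀ y') ?_).1 ⟨Reachable.refl _, hy'⟩).2
      intro a b hab
      have hr : X'.Reachable z₁ a ↔ X'.Reachable z₁ b :=
        ⟨fun h => h.trans hab.reachable, fun h => h.trans hab.symm.reachable⟩
      rw [hr]
      refine and_congr_right fun hb => hT.toward_iff_of_adj hy'.1 hab.1 fun hs => ?_
      rcases Sym2.eq_iff.1 hs with ⟨rfl, rfl⟩ | ⟨rfl, rfl⟩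
      · exact hmem (hr.2 hb)
      · exact hmem hb
    obtain ⟨k₀, hk₀, hmin⟩ : ∃ k₀, X'.Reachable z₁ k₀ ∧
        ∀ k, X'.Reachable z₁ k → T.dist z₀ k₀ ≤ T.dist z₀ k := by
      have hne : Nonempty {k // X'.Reachable z₁ k} := ⟨⟨z₁, Reachable.refl _⟩⟩
      let d : {k // X'.Reachable z₁ k} → ℕ := fun k => T.dist z₀ k
      exact ⟨(Function.argmin d).1, (Function.argmin d).2,
        fun k hk => Function.argmin_le d ⟨k, hk⟩⟩
    -- With `k₀` a point of the component nearest to `z₀`, invariance makes the path from `z₀` to `f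
    -- • z₀` start with `y'` and end with `f • y'` before `f • z₀`: any other position would make
    -- one of the points `f • k₀`, `f⁻¹ • k₀` of the component closer to `z₀` than `k₀`, or force `f
    -- • z₀ = z₀`.
    have hlt : ∀ f : L, f • z₀ ≠ z₀ → T.dist y' (f • y') < T.dist z₀ (f • z₀) := by
      intro f hf
      have ha : T.Toward (f • z₀) z₀ y' := by
        refine (hT.toward_or_toward hy'.1 _).resolve_right fun hcon => hf ?_
        have h1 := hT.dist_eq_of_toward (htow _ (hinv f _ hk₀)) hcon
        rw [h.dist_smul hT.connected] at h1
        have h2 := (htow _ (hinv f _ hk₀)).2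
        have h3 := hmin _ (hinv f _ hk₀)
        exact hT.connected.dist_eq_zero_iff.1 (by omega)
      have hb : T.Toward y' (f • z₀) (f • y') := by
        refine (hT.toward_or_toward (h f _ _ hy'.1) _).resolve_right fun hcon => ?_
        have h0 := h.toward_smul hT.connected f (htow _ (hinv f⁻¹ _ hk₀))
        rw [smul_inv_smul] at h0
        have h1 := hT.dist_eq_of_toward h0 hcon
        have h2 := (htow _ hk₀).2
        have h3 := hmin _ (hinv f⁻¹ _ hk₀)
        have h4 := h.dist_smul hT.connected f z₀ (f⁻¹ • k₀)
        rw [smul_inv_smul] at h4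
        have h5 := h0.2
        omega
      have h1 := ha.2
      have h2 := hb.2
      rw [dist_comm, dist_comm (u := f • z₀)] at h2
      omega
    have hle : ∀ f : L, T.dist y' (f • y') ≤ T.dist z₀ (f • z₀) := by
      intro f
      by_cases hf : f • z₀ = z₀
      · have h1 := h.toward_smul hT.connected f (htow _ (Reachable.refl _))
        rw [hf] at h1
        have h2 := hT.toward_unique h1 (htow _ (hinv f _ (Reachable.refl _)))
        rw [h2, dist_self]
        exact Nat.zero_le _
      · exact (hlt f hf).le
    exact (hz₀ y').not_gt (Finset.sum_lt_sum (fun f _ => hle f) ⟨f₀, hf₀, hlt f₀ hf₀z⟩)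

/-- A potential with prescribed jumps across the edges in the orbit of `x y`. -/
theorem IsTree.exists_potential_of_orbit (hT : T.IsTree) {x y : X} (h : ActsOn L T)
    (hxy : T.Adj x y) (hinv : ∀ m m' : L, m • x ≠ m' • y) {K : Type*} [Group K] (k : L → K)
    (hk : ∀ m m' : L, m • x = m' • x → m • y = m' • y → k m = k m') :
    ∃ σ : X → K, (∀ m : L, σ (m • y) = σ (m • x) * k m) ∧
      ∀ a b, (removeOrbit L T x y).Reachable a b → σ a = σ b := by
  classical
  -- The increment is `k m` along the edge from `m • x` to `m • y`, its inverse backwards, and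
  -- trivial on edges outside the orbit. By `hinv` the two directions do not clash, and by `hk` the
  -- choice of `m` does not matter.
  let c : X → X → K := fun a b =>
    if h : ∃ m : L, a = m • x ∧ b = m • y then k h.choose
    else if h : ∃ m : L, b = m • x ∧ a = m • y then (k h.choose)⁻¹ else 1
  have hc1 : ∀ m : L, c (m • x) (m • y) = k m := by
    intro m
    have hm : ∃ m' : L, m • x = m' • x ∧ m • y = m' • y := ⟨m, rfl, rfl⟩
    simp only [c, dif_pos hm]
    exact hk _ _ hm.choose_spec.1.symm hm.choose_spec.2.symm
  have hc2 : ∀ m : L, c (m • y) (m • x) = (k m)⁻¹ := by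
    intro m
    have hm : ∃ m' : L, m • x = m' • x ∧ m • y = m' • y := ⟨m, rfl, rfl⟩
    have hm' : ¬ ∃ m' : L, m • y = m' • x ∧ m • x = m' • y := fun ⟨m', h1, h2⟩ => hinv _ _ h2
    simp only [c, dif_pos hm, dif_neg hm']
    rw [hk _ _ hm.choose_spec.1.symm hm.choose_spec.2.symm]
  obtain ⟨σ, hσ⟩ := hT.exists_potential c (by
    intro a b hab
    by_cases h1 : ∃ m : L, a = m • x ∧ b = m • y
    · obtain ⟨m, rfl, rfl⟩ := h1
      rw [hc1, hc2]
    by_cases h2 : ∃ m : L, b = m • x ∧ a = m • y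
    · obtain ⟨m, rfl, rfl⟩ := h2
      rw [hc1, hc2, inv_inv]
    simp only [c, dif_neg h1, dif_neg h2, inv_one])
  refine ⟨σ, fun m => by rw [hσ _ _ (h m x y hxy), hc1], fun a b hab => ?_⟩
  refine (hab.iff_of_locally_const (P := fun z => σ a = σ z) fun z w hzw => ?_).1 rfl
  have h1 : ¬ ∃ m : L, z = m • x ∧ w = m • y := fun ⟨m, hm⟩ => hzw.2.1 m hm
  have h2 : ¬ ∃ m : L, w = m • x ∧ z = m • y := fun ⟨m, hm⟩ => hzw.2.2 m hm
  rw [hσ z w hzw.1]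
  simp only [c, dif_neg h1, dif_neg h2, mul_one]

/-- The stabilizer of the component of `x` in the graph `T'`. -/
def ActsOn.componentStabilizer (h : ActsOn L T) (x : X) : Subgroup L where
  carrier := {l | T.Reachable x (l • x)}
  one_mem' := by simp
  mul_mem' {a b} ha hb := by
    simp only [Set.mem_ofPred_eq] at ha hb ⊢
    rw [mul_smul]
    exact ha.trans (h.reachable a hb)
  inv_mem' {a} ha := by
    simp only [Set.mem_ofPred_eq] at ha ⊢
    simpa using (h.reachable a⁻¹ ha).symm

theorem ActsOn.mem_componentStabilizer {h : ActsOn L T} {x : X} {l : L} :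
    l ∈ h.componentStabilizer x ↔ T.Reachable x (l • x) := Iff.rfl

theorem ActsOn.reachable_smul_iff (h : ActsOn L T) {x : X} {l m : L} :
    T.Reachable (l • x) (m • x) ↔ l⁻¹ * m ∈ h.componentStabilizer x := by
  rw [mem_componentStabilizer, mul_smul]
  exact ⟨fun hr => by simpa using h.reachable l⁻¹ hr, fun hr => by simpa using h.reachable l hr⟩

/-- A walk starting at `x` meets only components of `l • x` and `l • y` with `l` in the join:
crossing a removed edge given by `m` replaces `l` by `m`, and `l⁻¹ * m` stabilizes the component
just left. By `hsep` the two kinds of components are disjoint. So every `l • x` lies in the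
component of some `m • x` with `m` in the join. -/
theorem ActsOn.sup_componentStabilizer (h : ActsOn L T) (hT : T.IsTree) {x y : X}
    (hsep : ∀ l : L, ¬ (removeOrbit L T x y).Reachable x (l • y)) :
    (h.on_removeOrbit x y).componentStabilizer x ⊔ (h.on_removeOrbit x y).componentStabilizer y = ⊤ := by
  set X' := removeOrbit L T x y
  have h' : ActsOn L X' := h.on_removeOrbit x y
  set S := h'.componentStabilizer x ⊔ h'.componentStabilizer y
  have hsep' : ∀ l m : L, ¬ X'.Reachable (l • x) (m • y) := by
    intro l m hr
    refine hsep (l⁻¹ * m) ?_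
    simpa [mul_smul] using h'.reachable l⁻¹ hr
  have key : ∀ z, (∃ l ∈ S, X'.Reachable (l • x) z ∨ X'.Reachable (l • y) z) := by
    intro z
    refine ((hT.connected.preconnected x z).iff_of_locally_const (P := fun z =>
      (∃ l ∈ S, X'.Reachable (l • x) z ∨ X'.Reachable (l • y) z)) ?_).1
      ⟨1, one_mem _, by simp⟩
    have step : ∀ a b, T.Adj a b → (∃ l ∈ S, X'.Reachable (l • x) a ∨ X'.Reachable (l • y) a) →
        ∃ l ∈ S, X'.Reachable (l • x) b ∨ X'.Reachable (l • y) b := by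
      rintro a b hab ⟨l, hl, hr⟩
      by_cases h1 : ∃ m : L, a = m • x ∧ b = m • y
      · obtain ⟨m, rfl, rfl⟩ := h1
        rcases hr with hr | hr
        · have := h'.reachable_smul_iff.1 hr
          refine ⟨m, ?_, .inr (Reachable.refl _)⟩
          rw [← mul_inv_cancel_left l m]
          exact mul_mem hl (le_sup_left (a := h'.componentStabilizer x) this)
        · exact absurd hr.symm (hsep' _ _)
      by_cases h2 : ∃ m : L, b = m • x ∧ a = m • y
      · obtain ⟨m, rfl, rfl⟩ := h2
        rcases hr with hr | hr
        · exact absurd hr (hsep' _ _)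
        · have := h'.reachable_smul_iff.1 hr
          refine ⟨m, ?_, .inl (Reachable.refl _)⟩
          rw [← mul_inv_cancel_left l m]
          exact mul_mem hl (le_sup_right (b := h'.componentStabilizer y) this)
      have hab' : X'.Adj a b := ⟨hab, fun m hm => h1 ⟨m, hm⟩, fun m hm => h2 ⟨m, hm⟩⟩
      exact ⟨l, hl, hr.imp (·.trans hab'.reachable) (·.trans hab'.reachable)⟩
    exact fun a b hab => ⟨step a b hab, step b a hab.symm⟩
  rw [eq_top_iff]
  rintro l -
  obtain ⟨m, hm, hr | hr⟩ := key (l • x)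
  · have := h'.reachable_smul_iff.1 hr
    rw [← mul_inv_cancel_left m l]
    exact mul_mem hm (le_sup_left (a := h'.componentStabilizer x) this)
  · exact absurd hr.symm (hsep' _ _)

theorem ActsOn.stabilizer_le_componentStabilizer (h : ActsOn L T) {x : X} :
    MulAction.stabilizer L x ≤ h.componentStabilizer x := fun l hl => by
  rw [mem_componentStabilizer, MulAction.mem_stabilizer_iff.1 hl]

/-- The universal property of the amalgam is obtained from a function `ψ` on `L` that is right
equivariant for `fP` and for `fQ` at once. Choosing coset representatives gives `gP` and `gQ`, each
equivariant for one factor. The discrepancy `gP m * (gQ m)⁻¹` depends only on the edge given by `m`,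
so it integrates over the tree to a potential `σ` constant on components, and `σ (m • x) * gP m = σ
(m • y) * gQ m` is the desired `ψ`. -/
theorem ActsOn.amalgam_isDecompositionOf_top (h : ActsOn L T) (hT : T.IsTree) {x y : X}
    (hxy : T.Adj x y) (hsep : ∀ l : L, ¬ (removeOrbit L T x y).Reachable x (l • y)) :
    (SubgroupGraph.amalgam ((h.on_removeOrbit x y).componentStabilizer x)
      ((h.on_removeOrbit x y).componentStabilizer y)
      (MulAction.stabilizer L x ⊓ MulAction.stabilizer L y)
      (inf_le_left.trans ((h.on_removeOrbit x y).stabilizer_le_componentStabilizer))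
      (inf_le_right.trans ((h.on_removeOrbit x y).stabilizer_le_componentStabilizer))
      ).IsDecompositionOf ⊤ := by
  classical
  set X' := removeOrbit L T x y
  have h' : ActsOn L X' := h.on_removeOrbit x y
  have hsup := h.sup_componentStabilizer hT hsep
  refine SubgroupGraph.amalgam_isDecompositionOf _ _ hsup ?_
  intro K _ fP fQ hf
  -- One representative for each component that contains a translate of `z`, i.e. for each coset of
  -- the component stabilizer; elsewhere the value is irrelevant.
  have hsec : ∀ z : X, ∃ ℓ : X → L, ∀ m : L, ℓ (m • z) ∈ {l | X'.Reachable (m • z) (l • z)} ∧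
      ∀ a b, X'.Reachable a b → ℓ a = ℓ b := by
    intro z
    have : ∀ c : X'.ConnectedComponent, ∃ l : L, ∀ m : L, X'.connectedComponentMk (m • z) = c →
        X'.Reachable (m • z) (l • z) := by
      intro c
      by_cases hc : ∃ l : L, X'.connectedComponentMk (l • z) = c
      · obtain ⟨l, hl⟩ := hc
        exact ⟨l, fun m hm => ConnectedComponent.eq.1 (hm.trans hl.symm)⟩
      · exact ⟨1, fun m hm => absurd ⟨m, hm⟩ hc⟩
    choose ℓ hℓ using this
    refine ⟨fun a => ℓ (X'.connectedComponentMk a), fun m => ⟨hℓ _ m rfl, fun a b hab => ?_⟩⟩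
    simp only [ConnectedComponent.eq.2 hab]
  obtain ⟨ℓP, hℓP⟩ := hsec x
  obtain ⟨ℓQ, hℓQ⟩ := hsec y
  have hPmem : ∀ m : L, (ℓP (m • x))⁻¹ * m ∈ h'.componentStabilizer x := fun m =>
    h'.reachable_smul_iff.1 (hℓP m).1.symm
  have hQmem : ∀ m : L, (ℓQ (m • y))⁻¹ * m ∈ h'.componentStabilizer y := fun m =>
    h'.reachable_smul_iff.1 (hℓQ m).1.symm
  let gP : L → K := fun m => fP ⟨_, hPmem m⟩
  let gQ : L → K := fun m => fQ ⟨_, hQmem m⟩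
  have hgP : ∀ (m p : L) (hp : p ∈ h'.componentStabilizer x), gP (m * p) = gP m * fP ⟨p, hp⟩ := by
    intro m p hp
    have hr : X'.Reachable ((m * p) • x) (m • x) := by
      rw [h'.reachable_smul_iff]; simpa using inv_mem hp
    simp only [gP]
    rw [← map_mul]
    congr 1
    ext
    simp [(hℓP 1).2 _ _ hr, mul_assoc]
  have hgQ : ∀ (m q : L) (hq : q ∈ h'.componentStabilizer y), gQ (m * q) = gQ m * fQ ⟨q, hq⟩ := by
    intro m p hp
    have hr : X'.Reachable ((m * p) • y) (m • y) := by
      rw [h'.reachable_smul_iff]; simpa using inv_mem hp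
    simp only [gQ]
    rw [← map_mul]
    congr 1
    ext
    simp [(hℓQ 1).2 _ _ hr, mul_assoc]
  obtain ⟨σ, hσ1, hσ2⟩ := hT.exists_potential_of_orbit h hxy (fun m m' hm => by
      refine hsep (m⁻¹ * m') ?_
      rw [mul_smul, ← hm, inv_smul_smul]) (fun m => gP m * (gQ m)⁻¹) (by
      intro m m' h1 h2
      have hmx : m⁻¹ * m' ∈ MulAction.stabilizer L x := by
        rw [MulAction.mem_stabilizer_iff, mul_smul, ← h1, inv_smul_smul]
      have hmy : m⁻¹ * m' ∈ MulAction.stabilizer L y := by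
        rw [MulAction.mem_stabilizer_iff, mul_smul, ← h2, inv_smul_smul]
      have e1 := hgP m _ (h'.stabilizer_le_componentStabilizer hmx)
      have e2 := hgQ m _ (h'.stabilizer_le_componentStabilizer hmy)
      rw [mul_inv_cancel_left] at e1 e2
      have e3 := hf _ ⟨hmx, hmy⟩
      rw [e1, e2, e3]
      group)
  let ψ : L → K := fun m => σ (m • x) * gP m
  have hψ : ∀ m, ψ m = σ (m • y) * gQ m := fun m => by
    simp only [ψ, hσ1]; group
  have hψP : ∀ (m p : L) (hp : p ∈ h'.componentStabilizer x), ψ (m * p) = ψ m * fP ⟨p, hp⟩ := by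
    intro m p hp
    simp only [ψ]
    rw [hgP m p hp, hσ2 ((m * p) • x) (m • x), mul_assoc]
    rw [h'.reachable_smul_iff]; simpa using inv_mem hp
  have hψQ : ∀ (m p : L) (hp : p ∈ h'.componentStabilizer y), ψ (m * p) = ψ m * fQ ⟨p, hp⟩ := by
    intro m p hp
    rw [hψ, hψ, hgQ m p hp, hσ2 ((m * p) • y) (m • y), mul_assoc]
    rw [h'.reachable_smul_iff]; simpa using inv_mem hp
  -- Because the two stabilizers generate `L`, equivariance under both makes the normalized function
  -- `(ψ 1)⁻¹ * ψ` multiplicative.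
  have hmul : ∀ l m : L, ψ (m * l) = ψ m * ((ψ 1)⁻¹ * ψ l) := by
    intro l
    have hl : l ∈ h'.componentStabilizer x ⊔ h'.componentStabilizer y := by
      rw [hsup]; exact Subgroup.mem_top l
    rw [Subgroup.sup_eq_closure] at hl
    refine Subgroup.closure_induction (p := fun l _ => ∀ m, ψ (m * l) = ψ m * ((ψ 1)⁻¹ * ψ l))
      ?_ ?_ ?_ ?_ hl
    · rintro l (hl | hl) m
      · have := hψP 1 l hl
        rw [one_mul] at this
        rw [hψP m l hl, this]; group
      · have := hψQ 1 l hl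
        rw [one_mul] at this
        rw [hψQ m l hl, this]; group
    · intro m; simp
    · intro a b _ _ ha hb m
      rw [← mul_assoc, hb, ha, hb a]; group
    · intro a _ ha m
      have h1 := ha (m * a⁻¹)
      have h2 := ha a⁻¹
      rw [inv_mul_cancel_right] at h1
      rw [inv_mul_cancel] at h2
      have h3 : ψ (m * a⁻¹) = ψ m * ((ψ 1)⁻¹ * ψ a)⁻¹ := by rw [h1]; group
      have h4 : ψ a⁻¹ = ψ 1 * ((ψ 1)⁻¹ * ψ a)⁻¹ := by
        calc ψ a⁻¹ = (ψ a⁻¹ * ((ψ 1)⁻¹ * ψ a)) * ((ψ 1)⁻¹ * ψ a)⁻¹ := by group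
          _ = _ := by rw [← h2]
      rw [h3, h4]; group
  refine ⟨⟨⟨fun l => (ψ 1)⁻¹ * ψ l, by simp⟩, fun a b => ?_⟩, fun p hp => ?_, fun q hq => ?_⟩
  · simp only [Subgroup.coe_mul, hmul b]
    group
  · have := hψP 1 p p.2
    rw [one_mul] at this
    simp [this]
  · have := hψQ 1 q q.2
    rw [one_mul] at this
    simp [this]

/-- A finitely generated group acting on a tree without inversions and without a fixed vertex
splits as an amalgamated product over the stabilizer of an edge, unless it has an infinite cyclic
quotient. -/
theorem ActsOn.exists_splitting (h : ActsOn L T) (hT : T.IsTree) {κ : Type*}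
    (τ : X → κ) (hτ : ∀ (g : L) (x : X), τ (g • x) = τ x) (hτ' : ∀ x y, T.Adj x y → τ x ≠ τ y)
    (hL : Group.FG L) (hfix : ¬ ∃ z : X, ∀ g : L, g • z = z)
    (hZ : ∀ φ : L →* Multiplicative ℤ, (∀ (g : L) (z : X), g • z = z → φ g = 1) → φ = 1) :
    ∃ (x y : X) (P Q : Subgroup L)
      (hP : MulAction.stabilizer L x ⊓ MulAction.stabilizer L y ≤ P)
      (hQ : MulAction.stabilizer L x ⊓ MulAction.stabilizer L y ≤ Q),
      T.Adj x y ∧ SubgroupGraph.IsNontrivialSplitting ⊤ P Q _ hP hQ ∧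
      ∀ z : X, ∃ g : L, MulAction.stabilizer L z ≤ conjBy g P ∨
        MulAction.stabilizer L z ≤ conjBy g Q := by
  obtain ⟨F, hF⟩ := Group.fg_def.1 hL
  obtain ⟨x, y, hxy, hno⟩ := h.exists_edge_of_not_fixed hT hF hfix
  set X' := removeOrbit L T x y with hX'
  have h' : ActsOn L X' := h.on_removeOrbit x y
  have hne : ∀ m m' : L, m • x ≠ m' • y := fun m m' hm =>
    hτ' x y hxy (by rw [← hτ m x, hm, hτ])
  -- Here the missing infinite cyclic quotient enters. The potential `σ` counts orbit edges with
  -- sign, and `g ↦ σ (g • z) / σ z` is a homomorphism to `ℤ` independent of `z`, hence trivial on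
  -- elliptic elements and so trivial by `hZ`. If `x` and `l • y` were in one component, then `σ x =
  -- σ (l • y) = σ y`, although `σ` jumps by 1 from `x` to `y`.
  have hsep : ∀ l : L, ¬ X'.Reachable x (l • y) := by
    intro l hl
    obtain ⟨σ, hσ1, hσ2⟩ := hT.exists_potential_of_orbit h hxy hne
      (fun _ => (Multiplicative.ofAdd (1 : ℤ))) (fun _ _ _ _ => rfl)
    have hconst : ∀ (g : L) (a b : X), σ (g • a) / σ a = σ (g • b) / σ b := by
      intro g a b
      refine ((hT.connected.preconnected a b).iff_of_locally_const
        (P := fun z => σ (g • a) / σ a = σ (g • z) / σ z) fun c d hcd => ?_).1 rfl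
      have : σ (g • c) / σ c = σ (g • d) / σ d := by
        by_cases h1 : ∃ m : L, c = m • x ∧ d = m • y
        · obtain ⟨m, rfl, rfl⟩ := h1
          rw [← mul_smul, ← mul_smul, hσ1, hσ1, mul_div_mul_right_eq_div]
        by_cases h2 : ∃ m : L, d = m • x ∧ c = m • y
        · obtain ⟨m, rfl, rfl⟩ := h2
          rw [← mul_smul, ← mul_smul, hσ1, hσ1, mul_div_mul_right_eq_div]
        have hcd' : X'.Adj c d := ⟨hcd, fun m hm => h1 ⟨m, hm⟩, fun m hm => h2 ⟨m, hm⟩⟩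
        rw [hσ2 c d hcd'.reachable, hσ2 _ _ (h'.reachable g hcd'.reachable)]
      rw [this]
    let φ : L →* Multiplicative ℤ := MonoidHom.mk' (fun g => σ (g • x) / σ x) fun g k => by
      rw [mul_smul, ← div_mul_div_cancel (σ ((g • k • x))) (σ (k • x)) (σ x), hconst g (k • x) x]
    have hφ : φ = 1 := hZ φ fun g z hz => by
      change σ (g • x) / σ x = 1
      rw [hconst g x z, hz, div_self']
    have h1 : φ l = 1 := by rw [hφ]; rfl
    change σ (l • x) / σ x = 1 at h1
    rw [hconst l x y, div_eq_one, ← hσ2 _ _ hl] at h1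
    have h2 := hσ1 1
    rw [one_smul, one_smul, ← h1] at h2
    have h3 := congrArg Multiplicative.toAdd h2
    simp at h3
  have hsup := h.sup_componentStabilizer hT hsep
  refine ⟨x, y, h'.componentStabilizer x, h'.componentStabilizer y, _, _, hxy,
    ⟨h.amalgam_isDecompositionOf_top hT hxy hsep, ?_, ?_⟩, ?_⟩
  -- If `P = C`, then `P ≤ Q`, so `Q` is everything and the component of `y` is invariant, against
  -- the choice of the edge. The other factor is symmetric.
  · intro he
    refine hno y fun g => ?_
    have : h'.componentStabilizer y = ⊤ := by
      rw [← hsup, eq_comm, sup_eq_right]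
      exact he.le.trans (inf_le_right.trans h'.stabilizer_le_componentStabilizer)
    exact ActsOn.mem_componentStabilizer.1 (this ▸ Subgroup.mem_top g)
  · intro he
    refine hno x fun g => ?_
    have : h'.componentStabilizer x = ⊤ := by
      rw [← hsup, eq_comm, sup_eq_left]
      exact he.le.trans (inf_le_left.trans h'.stabilizer_le_componentStabilizer)
    exact ActsOn.mem_componentStabilizer.1 (this ▸ Subgroup.mem_top g)
  · intro z
    have key : ∃ g : L, X'.Reachable (g • x) z ∨ X'.Reachable (g • y) z := by
      refine ((hT.connected.preconnected x z).iff_of_locally_const (P := fun z =>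
        ∃ g : L, X'.Reachable (g • x) z ∨ X'.Reachable (g • y) z) ?_).1 ⟨1, by simp⟩
      have step : ∀ a b, T.Adj a b → (∃ g : L, X'.Reachable (g • x) a ∨ X'.Reachable (g • y) a) →
          ∃ g : L, X'.Reachable (g • x) b ∨ X'.Reachable (g • y) b := by
        rintro a b hab ⟨l, hr⟩
        by_cases h1 : ∃ m : L, a = m • x ∧ b = m • y
        · obtain ⟨m, rfl, rfl⟩ := h1
          exact ⟨m, .inr (Reachable.refl _)⟩
        by_cases h2 : ∃ m : L, b = m • x ∧ a = m • y
        · obtain ⟨m, rfl, rfl⟩ := h2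
          exact ⟨m, .inl (Reachable.refl _)⟩
        have hab' : X'.Adj a b := ⟨hab, fun m hm => h1 ⟨m, hm⟩, fun m hm => h2 ⟨m, hm⟩⟩
        exact ⟨l, hr.imp (·.trans hab'.reachable) (·.trans hab'.reachable)⟩
      exact fun a b hab => ⟨step a b hab, step b a hab.symm⟩
    obtain ⟨g, hg⟩ := key
    have main : ∀ w, X'.Reachable (g • w) z →
        MulAction.stabilizer L z ≤ conjBy g (h'.componentStabilizer w) := by
      intro w hw k hk
      rw [mem_conjBy, mul_assoc, ← h'.reachable_smul_iff, mul_smul]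
      have h1 := h'.reachable k hw
      rw [MulAction.mem_stabilizer_iff.1 hk] at h1
      exact hw.trans h1.symm
    exact ⟨g, hg.imp (main x) (main y)⟩

end SimpleGraph

/-! ### Collapsing edges and splitting vertices -/

namespace SubgroupGraph

variable {W κ : Type*} [Group W] {Λ : SubgroupGraph W κ} {H : Subgroup W}

/-- Connected subgraphs of a tree of groups can be collapsed if their groups have a largest
element. -/
theorem exists_isCollapseVia {κ' : Type*} (hT : Λ.graph.IsTree) (q : κ → κ')
    (hfib : ∀ a, (Λ.graph.induce (q ⁻¹' {a})).Connected)
    (hmax : ∀ a, ∃ v, q v = a ∧ ∀ w, q w = a → Λ.vgrp w ≤ Λ.vgrp v)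
    (hcol : ∀ v w, Λ.graph.Adj v w → q v = q w →
      Λ.egrp v w = Λ.vgrp v ∨ Λ.egrp v w = Λ.vgrp w) :
    ∃ Λ₁ : SubgroupGraph W κ', Λ.IsCollapseVia Λ₁ q := by
  choose r hr hrmax using hmax
  refine ⟨{ graph :=
              { Adj := fun a b => a ≠ b ∧ ∃ v w, q v = a ∧ q w = b ∧ Λ.graph.Adj v w
                symm := ⟨?_⟩
                loopless := ⟨fun a h => h.1 rfl⟩ }
            vgrp := fun a => Λ.vgrp (r a)
            -- Two fibres are joined by at most one edge of the tree, so on an edge this supremum is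
            -- a single edge group.
            egrp := fun a b => ⨆ e : {e : κ × κ // q e.1 = a ∧ q e.2 = b ∧ Λ.graph.Adj e.1 e.2},
              Λ.egrp e.1.1 e.1.2
            egrp_comm := ?_
            egrp_le := ?_ }, hfib, fun a => ⟨r a, hr a, rfl, hrmax a⟩, hcol,
            fun a b => Iff.rfl, ?_⟩
  · rintro a b ⟨hne, v, w, hv, hw, hvw⟩
    exact ⟨hne.symm, w, v, hw, hv, hvw.symm⟩
  · have key : ∀ a b, (⨆ e : {e : κ × κ // q e.1 = a ∧ q e.2 = b ∧ Λ.graph.Adj e.1 e.2},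
        Λ.egrp e.1.1 e.1.2) ≤
        ⨆ e : {e : κ × κ // q e.1 = b ∧ q e.2 = a ∧ Λ.graph.Adj e.1 e.2}, Λ.egrp e.1.1 e.1.2 := by
      intro a b
      refine iSup_le fun e => ?_
      rw [Λ.egrp_comm]
      exact le_iSup (fun e : {e : κ × κ // q e.1 = b ∧ q e.2 = a ∧ Λ.graph.Adj e.1 e.2} =>
        Λ.egrp e.1.1 e.1.2) ⟨(e.1.2, e.1.1), e.2.2.1, e.2.1, e.2.2.2.symm⟩
    exact fun a b => le_antisymm (key a b) (key b a)
  · rintro a b -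
    refine iSup_le fun e => (Λ.egrp_le e.2.2.2).trans (hrmax a _ e.2.1)
  · intro v w hvw hne
    refine le_antisymm (iSup_le ?_) ?_
    · rintro ⟨⟨v', w'⟩, hv, hw, hvw'⟩
      obtain ⟨rfl, rfl⟩ := hT.edge_unique_of_collapse q hfib hvw hvw' hv.symm hw.symm hne
      exact le_rfl
    · exact le_iSup (fun e : {e : κ × κ // q e.1 = q v ∧ q e.2 = q w ∧ Λ.graph.Adj e.1 e.2} =>
        Λ.egrp e.1.1 e.1.2) ⟨(v, w), rfl, rfl, hvw⟩

/-- Vertices can be collapsed into neighbours whose common edge group is the vertex group. -/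
theorem exists_isCollapseVia_of_star (hT : Λ.graph.IsTree) (p : κ → κ) (hp : ∀ v, p (p v) = p v)
    (hadj : ∀ v, p v ≠ v → Λ.graph.Adj v (p v) ∧ Λ.egrp v (p v) = Λ.vgrp v) :
    ∃ Λ₁ : SubgroupGraph W {a // p a = a}, Λ.IsCollapseVia Λ₁ fun v => ⟨p v, hp v⟩ := by
  refine exists_isCollapseVia hT _ ?_ ?_ ?_
  · rintro ⟨a, ha⟩
    have ha' : a ∈ (fun v => (⟨p v, hp v⟩ : {a // p a = a})) ⁻¹' {⟨a, ha⟩} := by simp [ha]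
    have : Nonempty ↑((fun v => (⟨p v, hp v⟩ : {a // p a = a})) ⁻¹' {⟨a, ha⟩}) := ⟨⟨a, ha'⟩⟩
    have key : ∀ z, (Λ.graph.induce ((fun v => (⟨p v, hp v⟩ : {a // p a = a})) ⁻¹'
        {⟨a, ha⟩})).Reachable z ⟨a, ha'⟩ := by
      rintro ⟨z, hz⟩
      have hz' : p z = a := by simpa using hz
      by_cases hza : p z = z
      · have : z = a := hza.symm.trans hz'
        subst this
        exact SimpleGraph.Reachable.refl _
      · refine SimpleGraph.Adj.reachable ?_
        have := (hadj z hza).1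
        rw [hz'] at this
        exact this
    exact ⟨fun z w => (key z).trans (key w).symm⟩
  · rintro ⟨a, ha⟩
    refine ⟨a, by simp [ha], fun w hw => ?_⟩
    have hw' : p w = a := by simpa using hw
    by_cases hwa : p w = w
    · rw [← hw', hwa]
    · have := hadj w hwa
      rw [hw'] at this
      rw [← this.2]
      exact Λ.egrp_le_right this.1
  · intro v w hvw hpq
    have hpq' : p v = p w := by simpa using hpq
    by_cases hv : p v = v
    · have hw : p w ≠ w := fun hw => hvw.ne (hv.symm.trans (hpq'.trans hw))
      have := (hadj w hw).2
      rw [← hpq', hv, Λ.egrp_comm] at this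
      exact .inr this
    · by_cases hw : p w = w
      · have := (hadj v hv).2
        rw [hpq', hw] at this
        exact .inl this
      -- Here `v` and `w` would be adjacent while both are neighbours of `p v`, a triangle in a
      -- tree.
      · have h1 := SimpleGraph.dist_eq_one_iff_adj.2 (hadj v hv).1.symm
        have h2 := SimpleGraph.dist_eq_one_iff_adj.2 (hadj w hw).1.symm
        rw [← hpq'] at h2
        exact absurd (h1.trans h2.symm) (hT.dist_ne_of_adj (p v) hvw)

/-- For `v ≠ u` the vertex `r v` is the neighbour of `u` on the way to `v`; it names the branch at
`u` that contains `v`. The value `r u` carries no meaning. -/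
theorem exists_branch (hT : Λ.graph.IsTree) (u : κ) : ∃ r : κ → κ,
    (∀ w, Λ.graph.Adj u w → r w = w) ∧ (∀ v, v ≠ u → Λ.graph.Adj u (r v)) ∧
      ∀ v w, v ≠ u → w ≠ u → Λ.graph.Adj v w → r v = r w := by
  have : ∀ v, v ≠ u → ∃ w, Λ.graph.Toward v u w := fun v hv =>
    hT.connected.exists_toward hv.symm
  choose! r hr using this
  refine ⟨r, fun w hw => ?_, fun v hv => (hr v hv).1, fun v w hv hw hvw => ?_⟩
  · refine hT.toward_unique (hr w hw.ne') ⟨hw, ?_⟩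
    rw [SimpleGraph.dist_self, SimpleGraph.dist_eq_one_iff_adj.2 hw]
  · refine hT.toward_unique ?_ (hr w hw)
    refine (hT.toward_iff_of_adj (hr v hv).1 hvw fun hs => ?_).1 (hr v hv)
    rcases Sym2.eq_iff.1 hs with ⟨e, -⟩ | ⟨-, e⟩
    · exact hv e
    · exact hw e

/-! ### Replacing a vertex by a splitting of its group -/

section VertexSplitting

/-- The vertex `u` is replaced by `some u` and `none`; edges at `u` are attached according to
`att`. -/
def splitGraph (G : SimpleGraph κ) (u : κ) (att : κ → Option κ) : SimpleGraph (Option κ) where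
  Adj x y := (G.Adj (x.getD u) (y.getD u) ∧ (x.getD u = u → x = att (y.getD u)) ∧
    (y.getD u = u → y = att (x.getD u))) ∨ (x = some u ∧ y = none) ∨ (x = none ∧ y = some u)
  symm := ⟨fun x y h => by
    rcases h with ⟨h1, h2, h3⟩ | h | h
    · exact .inl ⟨h1.symm, h3, h2⟩
    · exact .inr (.inr h.symm)
    · exact .inr (.inl h.symm)⟩
  loopless := ⟨fun x h => by
    rcases h with ⟨h1, -, -⟩ | h | h
    · exact h1.ne rfl
    · exact absurd (h.1.symm.trans h.2) (by simp)
    · exact absurd (h.1.symm.trans h.2) (by simp)⟩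

/-- The map `Option.getD · u` folds the new edge onto `u`. Cuts at old edges are pulled back along
it. The new edge is cut by the predicate that records at which of the two new vertices the branch of
a vertex is attached. -/
theorem splitGraph_isTree (hT : Λ.graph.IsTree) (u : κ) {att : κ → Option κ}
    (hatt : ∀ w, att w = some u ∨ att w = none) : (splitGraph Λ.graph u att).IsTree := by
  classical
  obtain ⟨r, hr, -, hrbr⟩ := exists_branch hT u
  have hgetD : ∀ w, (att w).getD u = u := fun w => by rcases hatt w with h | h <;> simp [h]
  have hnew : (splitGraph Λ.graph u att).Adj (some u) none := .inr (.inl ⟨rfl, rfl⟩)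
  have hattr : ∀ w, (splitGraph Λ.graph u att).Reachable (some u) (att w) := fun w => by
    rcases hatt w with h | h <;> rw [h]
    exact hnew.reachable
  have hattadj : ∀ w, Λ.graph.Adj u w → (splitGraph Λ.graph u att).Adj (att w) (some w) :=
    fun w hw => .inl ⟨by simpa [hgetD] using hw, fun _ => by simp, fun h => absurd h hw.ne'⟩
  have hlift : ∀ v w, Λ.graph.Adj v w →
      (splitGraph Λ.graph u att).Reachable (some v) (some w) := by
    intro v w hvw
    by_cases hv : v = u
    · subst hv
      exact (hattr w).trans (hattadj w hvw).reachable
    by_cases hw : w = u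
    · subst hw
      exact ((hattr v).trans (hattadj v hvw.symm).reachable).symm
    · exact SimpleGraph.Adj.reachable (.inl ⟨hvw, fun h => absurd h hv, fun h => absurd h hw⟩)
  have hbase : ∀ x, (splitGraph Λ.graph u att).Reachable (some u) x := by
    rintro (_ | v)
    · exact hnew.reachable
    · exact (hT.connected.preconnected u v).of_forall_adj (f := some) hlift
  have hconn : (splitGraph Λ.graph u att).Connected :=
    ⟨fun x y => (hbase x).symm.trans (hbase y)⟩
  have hcutnew : ∃ R : Option κ → Prop, R (some u) ∧ ¬ R none ∧
      ∀ z w, (splitGraph Λ.graph u att).Adj z w → s(z, w) ≠ s(some u, none) → (R z ↔ R w) := by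
    refine ⟨fun x => if x.getD u = u then x = some u else att (r (x.getD u)) = some u,
      by simp, by simp, ?_⟩
    rintro z w (⟨h1, h2, h3⟩ | h | h) hne
    · by_cases hz : z.getD u = u
      · have hw : w.getD u ≠ u := fun hw => h1.ne (hz.trans hw.symm)
        simp only [hz, hw, if_true, if_false]
        rw [hz] at h1
        rw [hr _ h1, ← h2 hz]
      · by_cases hw : w.getD u = u
        · simp only [hz, hw, if_true, if_false]
          rw [hw] at h1
          rw [hr _ h1.symm, ← h3 hw]
        · simp only [hz, hw, if_false]
          rw [hrbr _ _ hz hw h1]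
    · rw [h.1, h.2] at hne
      exact absurd rfl hne
    · rw [h.1, h.2] at hne
      exact absurd Sym2.eq_swap hne
  refine hconn.isTree_of_cut ?_
  rintro x y (⟨h1, h2, h3⟩ | ⟨rfl, rfl⟩ | ⟨rfl, rfl⟩)
  · obtain ⟨R, hRx, hRy, hR⟩ := hT.exists_cut h1
    refine ⟨fun z => R (z.getD u), hRx, hRy, ?_⟩
    rintro z w (⟨k1, k2, k3⟩ | ⟨rfl, rfl⟩ | ⟨rfl, rfl⟩) hne
    · refine hR _ _ k1 fun hs => hne ?_
      have inj : ∀ {a b : Option κ}, a.getD u = b.getD u → (a.getD u = u → a = b) → a = b := by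
        rintro (_ | a) (_ | b) hab hu
        · rfl
        · exact hu (by simp)
        · exact hu (by simpa using hab)
        · simpa using hab
      rcases Sym2.eq_iff.1 hs with ⟨e1, e2⟩ | ⟨e1, e2⟩
      · have hzx : z = x := inj e1 fun hu => by rw [k2 hu, h2 (e1 ▸ hu), e2]
        have hwy : w = y := inj e2 fun hu => by rw [k3 hu, h3 (e2 ▸ hu), e1]
        rw [hzx, hwy]
      · have hzx : z = y := inj e1 fun hu => by rw [k2 hu, h3 (e1 ▸ hu), e2]
        have hwy : w = x := inj e2 fun hu => by rw [k3 hu, h2 (e2 ▸ hu), e1]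
        rw [hzx, hwy, Sym2.eq_swap]
    · rfl
    · rfl
  · exact hcutnew
  · obtain ⟨R, h1, h2, h3⟩ := hcutnew
    refine ⟨fun x => ¬ R x, h2, fun h => h h1, fun z w hzw hne => not_congr (h3 z w hzw ?_)⟩
    rwa [Sym2.eq_swap (a := some u)]

theorem IsVertexSplittingVia.vgrp_cases {u : κ} {P Q C : Subgroup W}
    {Λ' : SubgroupGraph W (Option κ)} {k : κ → W} (h : Λ.IsVertexSplittingVia u P Q C Λ' k)
    (x : Option κ) : Λ'.vgrp x = P ∨ Λ'.vgrp x = Q ∨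
      ∃ v, v ≠ u ∧ k v ∈ Λ.vgrp u ∧ Λ'.vgrp x = conjBy (k v) (Λ.vgrp v) := by
  rcases x with _ | v
  · exact .inr (.inl h.vgrp_right)
  · by_cases hv : v = u
    · subst hv; exact .inl h.vgrp_left
    · exact .inr (.inr ⟨v, hv, h.mem v hv, h.vgrp_old v hv⟩)

/-- Compatible maps `f` on the groups of `Λ'` give a map `Fu` on `Λ(u)`, because this group is the
amalgam. On another vertex group of `Λ` one conjugates by `k v`, applies `f`, and conjugates back by
`Fu (k v)`. These maps agree on the edges of `Λ`, since `k` is constant on branches, and the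
resulting map on `H` restricts to `f`. -/
theorem IsVertexSplittingVia.isDecompositionOf {u : κ} {P Q C : Subgroup W} {hP : C ≤ P}
    {hQ : C ≤ Q} {Λ' : SubgroupGraph W (Option κ)} {k : κ → W}
    (h : Λ.IsVertexSplittingVia u P Q C Λ' k) (hT : Λ'.graph.IsTree)
    (hΛ : Λ.IsDecompositionOf H) (hs : (amalgam P Q C hP hQ).IsDecompositionOf (Λ.vgrp u)) :
    Λ'.IsDecompositionOf H := by
  classical
  have hPu : P ≤ Λ.vgrp u := hs.vgrp_le false
  have hQu : Q ≤ Λ.vgrp u := hs.vgrp_le true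
  have hle : ∀ x, Λ'.vgrp x ≤ H := by
    intro x
    rcases h.vgrp_cases x with hx | hx | ⟨v, -, hk, hx⟩ <;> rw [hx]
    · exact hPu.trans (hΛ.vgrp_le u)
    · exact hQu.trans (hΛ.vgrp_le u)
    · exact conjBy_le_of_mem (hΛ.vgrp_le u hk) (hΛ.vgrp_le v)
  have huP : Λ.vgrp u = P ⊔ Q := by
    rw [← hs.iSup_eq, iSup_bool_eq, sup_comm]; rfl
  refine .of_exists_lift hT (le_antisymm (iSup_le hle) ?_) fun K _ f hf => ?_
  · have hu : Λ.vgrp u ≤ ⨆ x, Λ'.vgrp x := by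
      rw [huP, ← h.vgrp_left, ← h.vgrp_right]
      exact sup_le (le_iSup _ _) (le_iSup _ _)
    conv_lhs => rw [← hΛ.iSup_eq]
    refine iSup_le fun v => ?_
    by_cases hv : v = u
    · subst hv; exact hu
    · have h1 := le_iSup Λ'.vgrp (some v)
      rw [h.vgrp_old v hv, conjBy_le_iff] at h1
      exact h1.trans (conjBy_of_mem (inv_mem (hu (h.mem v hv)))).le
  · have hP' : P ≤ Λ'.vgrp (some u) := h.vgrp_left.ge
    have hQ' : Q ≤ Λ'.vgrp none := h.vgrp_right.ge
    obtain ⟨Fu, hFu⟩ := hs.exists_lift (K := K)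
      (fun b => Bool.rec ((f (some u)).comp (Subgroup.inclusion hP'))
        ((f none).comp (Subgroup.inclusion hQ')) b) (by
        rintro (_ | _) (_ | _) hvw x y hxy hx
        · exact absurd rfl hvw.ne
        · exact hf _ _ h.adj_new _ _ hxy (by rw [h.egrp_new]; exact hx)
        · exact hf _ _ h.adj_new.symm _ _ hxy (by rw [Λ'.egrp_comm, h.egrp_new]; exact hx)
        · exact absurd rfl hvw.ne)
    have hFuP : ∀ x (hx : x ∈ P), Fu ⟨x, hPu hx⟩ = f (some u) ⟨x, hP' hx⟩ := fun x hx =>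
      hFu false ⟨x, hx⟩ (hPu hx)
    have hFuQ : ∀ x (hx : x ∈ Q), Fu ⟨x, hQu hx⟩ = f none ⟨x, hQ' hx⟩ := fun x hx =>
      hFu true ⟨x, hx⟩ (hQu hx)
    have hmemc : ∀ v, v ≠ u → ∀ x ∈ Λ.vgrp v, k v * x * (k v)⁻¹ ∈ Λ'.vgrp (some v) := by
      intro v hv x hx
      rw [h.vgrp_old v hv, mem_conjBy]
      simpa [mul_assoc] using hx
    let fo : ∀ v, v ≠ u → (Λ.vgrp v →* K) := fun v hv =>
      (MulAut.conj (Fu ⟨k v, h.mem v hv⟩)⁻¹).toMonoidHom.comp ((f (some v)).comp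
        (((MulAut.conj (k v)).toMonoidHom.comp (Λ.vgrp v).subtype).codRestrict _
          fun x => hmemc v hv x x.2))
    have hfo : ∀ v (hv : v ≠ u) x (hx : x ∈ Λ.vgrp v), fo v hv ⟨x, hx⟩ =
        (Fu ⟨k v, h.mem v hv⟩)⁻¹ * f (some v) ⟨k v * x * (k v)⁻¹, hmemc v hv x hx⟩ *
          Fu ⟨k v, h.mem v hv⟩ := by
      intro v hv x hx
      simp only [fo, MonoidHom.comp_apply, MulEquiv.coe_toMonoidHom, MulAut.conj_apply, inv_inv]
      rfl
    let f' : ∀ v, Λ.vgrp v →* K := fun v =>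
      if hv : v = u then Fu.comp (Subgroup.inclusion (hv ▸ le_rfl)) else fo v hv
    have hf'u : ∀ x (hx : x ∈ Λ.vgrp u), f' u ⟨x, hx⟩ = Fu ⟨x, hx⟩ := by
      intro x hx
      simp only [f', dif_pos]
      rfl
    have hf'o : ∀ v (hv : v ≠ u), f' v = fo v hv := fun v hv => by simp only [f', dif_neg hv]
    have hagu : ∀ w, Λ.graph.Adj u w → ∀ x (hxu : x ∈ Λ.vgrp u) (hxw : x ∈ Λ.vgrp w),
        x ∈ Λ.egrp u w → f' u ⟨x, hxu⟩ = f' w ⟨x, hxw⟩ := by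
      intro w huw x hxu hxw hx
      have hw : w ≠ u := huw.ne'
      rw [hf'u, hf'o w hw, hfo w hw]
      have hc : k w * x * (k w)⁻¹ ∈ conjBy (k w) (Λ.egrp u w) := by
        rw [mem_conjBy]; simpa [mul_assoc] using hx
      have hFuc : Fu ⟨x, hxu⟩ = (Fu ⟨k w, h.mem w hw⟩)⁻¹ *
          Fu ⟨k w * x * (k w)⁻¹, mul_mem (mul_mem (h.mem w hw) hxu) (inv_mem (h.mem w hw))⟩ *
          Fu ⟨k w, h.mem w hw⟩ := by
        rw [← map_inv, ← map_mul, ← map_mul]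
        congr 1
        ext
        simp [mul_assoc]
      rw [hFuc]
      congr 2
      rcases (h.adj_iff w hw).1 huw with ha | ha
      · rw [← h.egrp_left w hw ha] at hc
        have hcP : k w * x * (k w)⁻¹ ∈ P := h.vgrp_left ▸ Λ'.egrp_le ha hc
        rw [hFuP _ hcP]
        exact hf _ _ ha _ _ rfl hc
      · rw [← h.egrp_right w hw ha] at hc
        have hcQ : k w * x * (k w)⁻¹ ∈ Q := h.vgrp_right ▸ Λ'.egrp_le ha hc
        rw [hFuQ _ hcQ]
        exact hf _ _ ha _ _ rfl hc
    obtain ⟨F, hF⟩ := hΛ.exists_lift f' (by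
      rintro v w hvw ⟨x, hxv⟩ ⟨y, hxw⟩ hxy hx
      simp only at hxy hx
      subst hxy
      by_cases hv : v = u
      · subst hv
        exact hagu w hvw x hxv hxw hx
      by_cases hw : w = u
      · subst hw
        exact (hagu v hvw.symm x hxw hxv (Λ.egrp_comm _ _ ▸ hx)).symm
      · rw [hf'o v hv, hf'o w hw, hfo v hv, hfo w hw]
        have hk := h.branch v w hv hw hvw
        have hadj := (h.adj_old v w hv hw).2 hvw
        have := hf _ _ hadj ⟨k v * x * (k v)⁻¹, hmemc v hv x hxv⟩
          ⟨k w * x * (k w)⁻¹, hmemc w hw x hxw⟩ (by simp [hk]) (by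
            rw [h.egrp_old v w hv hw hvw, mem_conjBy]
            simpa [mul_assoc] using hx)
        rw [this]
        simp only [hk])
    refine ⟨F, ?_⟩
    have hFFu : ∀ x (hx : x ∈ Λ.vgrp u), F ⟨x, hΛ.vgrp_le u hx⟩ = Fu ⟨x, hx⟩ := fun x hx => by
      rw [hF u ⟨x, hx⟩, hf'u]
    rintro (_ | v) ⟨x, hx⟩ hxH
    · have hxQ : x ∈ Q := h.vgrp_right ▸ hx
      rw [hFFu x (hQu hxQ), hFuQ x hxQ]
    · by_cases hv : v = u
      · subst hv
        have hxP : x ∈ P := h.vgrp_left ▸ hx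
        rw [hFFu x (hPu hxP), hFuP x hxP]
      · have hxv : (k v)⁻¹ * x * k v ∈ Λ.vgrp v := by
          rw [h.vgrp_old v hv] at hx
          exact mem_conjBy.1 hx
        have h1 := hF v ⟨_, hxv⟩ (hΛ.vgrp_le v hxv)
        rw [hf'o v hv, hfo v hv] at h1
        have h2 := hFFu (k v) (h.mem v hv)
        have h3 : (⟨x, hxH⟩ : H) = ⟨k v, hΛ.vgrp_le u (h.mem v hv)⟩ *
            ⟨_, hΛ.vgrp_le v hxv⟩ * ⟨k v, hΛ.vgrp_le u (h.mem v hv)⟩⁻¹ := by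
          ext; simp [mul_assoc]
        rw [h3, map_mul, map_mul, map_inv, h1, h2]
        have h4 : (⟨k v * ((k v)⁻¹ * x * k v) * (k v)⁻¹, hmemc v hv _ hxv⟩ : Λ'.vgrp (some v)) =
            ⟨x, hx⟩ := by ext; simp [mul_assoc]
        rw [h4]
        group

/-- A compatible splitting of a vertex group refines the decomposition. -/
theorem IsDecompositionOf.exists_vertexSplitting (h : Λ.IsDecompositionOf H) {u : κ}
    {P Q C : Subgroup W} {hP : C ≤ P} {hQ : C ≤ Q}
    (hs : (amalgam P Q C hP hQ).IsDecompositionOf (Λ.vgrp u))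
    (hc : Λ.Compatible u (amalgam P Q C hP hQ)) :
    ∃ (Λ' : SubgroupGraph W (Option κ)) (k : κ → W),
      Λ.IsVertexSplittingVia u P Q C Λ' k ∧ Λ'.IsDecompositionOf H := by
  classical
  obtain ⟨r, hr, hradj, hrbr⟩ := exists_branch h.isTree u
  have hc' : ∀ w, Λ.graph.Adj u w → ∃ g ∈ Λ.vgrp u, ∃ x : Option κ, (x = some u ∨ x = none) ∧
      (x = some u → conjBy g (Λ.egrp u w) ≤ P) ∧ (x = none → conjBy g (Λ.egrp u w) ≤ Q) := by
    intro w hw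
    obtain ⟨g, hg, b, hb⟩ := hc w hw
    rw [← inv_inv g, ← conjBy_le_iff] at hb
    cases b
    · exact ⟨g⁻¹, inv_mem hg, some u, .inl rfl, fun _ => hb, by simp⟩
    · exact ⟨g⁻¹, inv_mem hg, none, .inr rfl, by simp, fun _ => hb⟩
  choose! k₀ hk₀ att₀ hatt₀ hattP hattQ using hc'
  -- Only the neighbours of `u` are attached; the default `none` elsewhere makes `hatt` hold for all
  -- vertices.
  let att : κ → Option κ := fun w => if Λ.graph.Adj u w then att₀ w else none
  have hatt : ∀ w, att w = some u ∨ att w = none := fun w => by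
    simp only [att]
    split_ifs with hw
    · exact hatt₀ w hw
    · exact .inr rfl
  let k : κ → W := fun v => k₀ (r v)
  have hk : ∀ v, v ≠ u → k v ∈ Λ.vgrp u := fun v hv => hk₀ _ (hradj v hv)
  have hkbr : ∀ v w, v ≠ u → w ≠ u → Λ.graph.Adj v w → k v = k w := fun v w hv hw hvw => by
    simp only [k, hrbr v w hv hw hvw]
  have hkP : ∀ w, Λ.graph.Adj u w → att w = some u → conjBy (k w) (Λ.egrp u w) ≤ P := by
    intro w hw ha
    simp only [k, hr w hw]
    exact hattP w hw (by simpa [att, hw] using ha)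
  have hkQ : ∀ w, Λ.graph.Adj u w → att w = none → conjBy (k w) (Λ.egrp u w) ≤ Q := by
    intro w hw ha
    simp only [k, hr w hw]
    exact hattQ w hw (by simpa [att, hw] using ha)
  let vg : Option κ → Subgroup W := fun x =>
    x.elim Q fun v => if v = u then P else conjBy (k v) (Λ.vgrp v)
  -- Between two old vertices the conjugator may be taken at either end, since `k` is constant on
  -- branches; this gives symmetry. The value `⊥` off the edges keeps the definition symmetric where
  -- `k` need not agree.
  let eg : Option κ → Option κ → Subgroup W := fun x y =>
    if x.getD u = u ∧ y.getD u = u then C else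
      if Λ.graph.Adj (x.getD u) (y.getD u) then
        if x.getD u = u then conjBy (k (y.getD u)) (Λ.egrp (x.getD u) (y.getD u))
        else conjBy (k (x.getD u)) (Λ.egrp (x.getD u) (y.getD u))
      else ⊥
  let Λ' : SubgroupGraph W (Option κ) :=
    { graph := splitGraph Λ.graph u att
      vgrp := vg
      egrp := eg
      egrp_comm := by
        intro x y
        simp only [eg]
        by_cases hx : x.getD u = u <;> by_cases hy : y.getD u = u
        · simp [hx, hy]
        · simp [hx, hy, Λ.graph.adj_comm, Λ.egrp_comm]
        · simp [hx, hy, Λ.graph.adj_comm, Λ.egrp_comm]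
        · simp only [hx, hy, and_false, if_false, Λ.graph.adj_comm (y.getD u),
            Λ.egrp_comm (y.getD u)]
          split_ifs with hxy
          · rw [hkbr _ _ hx hy hxy]
          · rfl
      egrp_le := by
        rintro x y (⟨h1, h2, h3⟩ | ⟨rfl, rfl⟩ | ⟨rfl, rfl⟩)
        · by_cases hx : x.getD u = u
          · have hy : y.getD u ≠ u := fun hy => h1.ne (hx.trans hy.symm)
            have hxa := h2 hx
            rw [hx] at h1
            simp only [eg, hx, hy, h1, and_false, if_false, if_true]
            rcases hatt (y.getD u) with ha | ha
            · rw [hxa, ha]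
              simpa [vg] using hkP _ h1 ha
            · rw [hxa, ha]
              simpa [vg] using hkQ _ h1 ha
          · simp only [eg, hx, false_and, if_false, h1, if_true]
            rcases x with _ | x
            · exact absurd rfl hx
            · simp only [Option.getD_some] at hx h1 ⊢
              simp only [vg, Option.elim_some, hx, if_false]
              exact conjBy_mono _ (Λ.egrp_le h1)
        · simpa [eg, vg] using hP
        · simpa [eg, vg] using hQ }
  have hadjold : ∀ v w, v ≠ u → w ≠ u → (Λ'.graph.Adj (some v) (some w) ↔ Λ.graph.Adj v w) := by
    intro v w hv hw
    simp [Λ', splitGraph, hv, hw]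
  have hadju : ∀ w, w ≠ u →
      (Λ'.graph.Adj (some u) (some w) ↔ Λ.graph.Adj u w ∧ att w = some u) := by
    intro w hw
    simp [Λ', splitGraph, hw, @eq_comm _ (some u) (att w)]
  have hadjn : ∀ w, w ≠ u →
      (Λ'.graph.Adj none (some w) ↔ Λ.graph.Adj u w ∧ att w = none) := by
    intro w hw
    simp [Λ', splitGraph, hw, @eq_comm _ none (att w)]
  have hvs : Λ.IsVertexSplittingVia u P Q C Λ' k :=
    { vgrp_left := by simp [Λ', vg]
      vgrp_right := by simp [Λ', vg]
      adj_new := .inr (.inl ⟨rfl, rfl⟩)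
      egrp_new := by simp [Λ', eg]
      mem := hk
      vgrp_old := fun v hv => by simp [Λ', vg, hv]
      adj_old := hadjold
      branch := hkbr
      egrp_old := fun v w hv hw hvw => by simp [Λ', eg, hv, hvw]
      adj_iff := fun w hw => by
        rw [hadju w hw, hadjn w hw, ← and_or_left, and_iff_left (hatt w)]
      not_both := fun w hw => by
        rw [hadju w hw, hadjn w hw]
        rintro ⟨⟨-, h1⟩, -, h2⟩
        rw [h1] at h2
        exact absurd h2 (by simp)
      egrp_left := fun w hw ha => by
        simp [Λ', eg, hw, ((hadju w hw).1 ha).1]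
      egrp_right := fun w hw ha => by
        simp [Λ', eg, hw, ((hadjn w hw).1 ha).1] }
  exact ⟨Λ', k, hvs, hvs.isDecompositionOf (splitGraph_isTree h.isTree u hatt) h hs⟩

end VertexSplitting

end SubgroupGraph

/-! ### Coxeter groups: orders of products of two generators -/

namespace CoxeterMatrix

variable {B : Type*} (M : CoxeterMatrix B)

/-- The linear form `2⟨e_i, ·⟩` of the geometric representation. -/
noncomputable def geomForm (i : B) : Module.Dual ℝ (B →₀ ℝ) :=
  Finsupp.linearCombination ℝ fun j => -2 * Real.cos (Real.pi / M i j)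

theorem geomForm_single (i j : B) :
    M.geomForm i (Finsupp.single j 1) = -2 * Real.cos (Real.pi / M i j) := by
  simp [geomForm]

theorem geomForm_single_self (i : B) : M.geomForm i (Finsupp.single i 1) = 2 := by
  simp [geomForm_single]

/-- The reflections of the geometric representation. -/
noncomputable def geomReflection (i : B) : (B →₀ ℝ) ≃ₗ[ℝ] (B →₀ ℝ) :=
  Module.reflection (M.geomForm_single_self i)

/-- The parameter `2 cos 2θ` at which the Chebyshev polynomials in the formula for powers of a
product of two reflections are evaluated. -/
theorem geomForm_mul (i j : B) :
    2 * Real.cos (2 * (Real.pi / M i j)) = M.geomForm i (Finsupp.single j 1) *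
      M.geomForm j (Finsupp.single i 1) - 2 := by
  rw [geomForm_single, geomForm_single, M.symmetric j i, Real.cos_two_mul]
  ring

theorem sin_two_mul_pi_div_pos {m : ℕ} (hm : 3 ≤ m) : 0 < Real.sin (2 * (Real.pi / m)) := by
  have hm' : (3 : ℝ) ≤ m := by exact_mod_cast hm
  have hpi := Real.pi_pos
  apply Real.sin_pos_of_pos_of_lt_pi
  · positivity
  · rw [← mul_div_assoc, div_lt_iff₀ (by linarith)]
    nlinarith

open Polynomial.Chebyshev in
-- The powers of a product of two reflections have coefficients in the polynomials `S n`, where `S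
-- n` at `2 cos φ` is `sin ((n + 1) φ) / sin φ`. For `φ = 2π/m` with `m ≥ 3` the relevant factor of
-- the coefficients vanishes: `S (k - 1)` if `m = 2k`, and `S k + S (k - 1)` if `m = 2k + 1`. For `m
-- = 2` the denominator is zero, so this case is computed directly.
theorem geomReflection_isLiftable : M.IsLiftable M.geomReflection := by
  intro i j
  by_cases hij : i = j
  · subst hij
    rw [M.diagonal, pow_one]
    ext1 x
    exact Module.involutive_reflection (M.geomForm_single_self i) x
  have h1 : M i j ≠ 1 := M.off_diagonal i j hij
  ext1 z
  rw [geomReflection, geomReflection, Module.reflection_mul_reflection_pow_apply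
    (M.geomForm_single_self i) (M.geomForm_single_self j) _ z _ (M.geomForm_mul i j)]
  set m := M i j with hm
  set θ : ℝ := Real.pi / m with hθ
  obtain h0 | h2 | h3 : m = 0 ∨ m = 2 ∨ 3 ≤ m := by omega
  · simp [h0]
  · have hij0 : M.geomForm i (Finsupp.single j 1) = 0 := by
      rw [geomForm_single, ← hm, h2]; simp
    have hji0 : M.geomForm j (Finsupp.single i 1) = 0 := by
      rw [geomForm_single, M.symmetric, ← hm, h2]; simp
    have ht : 2 * Real.cos (2 * θ) = -2 := by
      rw [hθ, h2]
      have : 2 * (Real.pi / ((2 : ℕ) : ℝ)) = Real.pi := by push_cast; ring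
      rw [this, Real.cos_pi]; ring
    rw [ht, h2, hij0, hji0]
    norm_num
    module
  · have hs := sin_two_mul_pi_div_pos h3
    rw [← hθ] at hs
    have hS : ∀ n : ℤ, (S ℝ n).eval (2 * Real.cos (2 * θ)) =
        Real.sin ((n + 1) * (2 * θ)) / Real.sin (2 * θ) := fun n => by
      rw [eq_div_iff hs.ne', S_two_mul_real_cos]
    have hm0 : (m : ℝ) ≠ 0 := by positivity
    obtain ⟨k, hk | hk⟩ := Nat.even_or_odd' m
    · have e1 : ((m : ℤ) - 2) / 2 = k - 1 := by omega
      have e2 : ((m : ℤ) - 1) / 2 = k - 1 := by omega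
      have hz : (S ℝ ((k : ℤ) - 1)).eval (2 * Real.cos (2 * θ)) = 0 := by
        rw [hS, div_eq_zero_iff]
        left
        have : (((k : ℤ) - 1 : ℤ) + 1 : ℝ) * (2 * θ) = Real.pi := by
          have hk' : (m : ℝ) = 2 * k := by exact_mod_cast hk
          push_cast
          rw [hθ]
          field_simp
          rw [hk']
          ring
        rw [this, Real.sin_pi]
      rw [e1, e2, hz]
      simp
    · have e1 : ((m : ℤ) - 1) / 2 = k := by omega
      have e2 : ((m : ℤ) - 3) / 2 = k - 1 := by omega
      have e3 : (m : ℤ) / 2 = k := by omega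
      have e4 : ((m : ℤ) - 2) / 2 = k - 1 := by omega
      have hz : (S ℝ (k : ℤ)).eval (2 * Real.cos (2 * θ)) +
          (S ℝ ((k : ℤ) - 1)).eval (2 * Real.cos (2 * θ)) = 0 := by
        rw [hS, hS, ← add_div, div_eq_zero_iff]
        left
        have : ((k : ℤ) + 1 : ℝ) * (2 * θ) = 2 * Real.pi - (((k : ℤ) - 1 : ℤ) + 1 : ℝ) * (2 * θ) := by
          have hk' : (m : ℝ) = 2 * k + 1 := by exact_mod_cast hk
          push_cast
          rw [hθ]
          field_simp
          rw [hk']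
          ring
        rw [this, Real.sin_two_pi_sub]
        ring
      rw [e1, e2, e3, e4, hz]
      simp

end CoxeterMatrix

namespace CoxeterSystem

variable {B W : Type*} [Group W] {M : CoxeterMatrix B} (cs : CoxeterSystem M W)

open Polynomial.Chebyshev in
-- Apply the relation to the basis vector `e_i` in the geometric representation and compare
-- coordinates. For `m ≥ 3` they give `sin (2nθ) = 0` and `cos (2nθ) = 1` with `θ = π/m`, so `m ∣
-- n`. For `m = 0` the parameter is 2 and the coordinate at `j` forces `n = 0`; for `m = 2` it is
-- `-2` and the coordinate at `i` is `(-1) ^ n`.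
theorem dvd_of_simple_mul_simple_pow_eq_one {i j : B} {n : ℕ}
    (h : (cs.simple i * cs.simple j) ^ n = 1) : M i j ∣ n := by
  by_cases hij : i = j
  · subst hij; simp
  have h1 : M i j ≠ 1 := M.off_diagonal i j hij
  let ρ := cs.lift ⟨M.geomReflection, M.geomReflection_isLiftable⟩
  have hρ : (M.geomReflection i * M.geomReflection j) ^ n = 1 := by
    have := congrArg ρ h
    simpa only [map_pow, map_mul, map_one, ρ, cs.lift_apply_simple] using this
  have hx : ((M.geomReflection i * M.geomReflection j) ^ n) (Finsupp.single i 1) =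
      Finsupp.single i 1 := by rw [hρ]; rfl
  rw [CoxeterMatrix.geomReflection, CoxeterMatrix.geomReflection,
    Module.reflection_mul_reflection_pow_apply_self
    (M.geomForm_single_self i) (M.geomForm_single_self j) _ _ (M.geomForm_mul i j)] at hx
  have hj := DFunLike.congr_fun hx j
  have hi := DFunLike.congr_fun hx i
  simp only [Finsupp.add_apply, Finsupp.smul_apply, smul_eq_mul, Finsupp.single_eq_same,
    Finsupp.single_eq_of_ne hij, Finsupp.single_eq_of_ne (Ne.symm hij), mul_one, mul_zero,
    zero_add, add_zero] at hi hj
  have e : M.geomForm j (Finsupp.single i 1) = -2 * Real.cos (Real.pi / M i j) := by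
    rw [CoxeterMatrix.geomForm_single, M.symmetric j i]
  rw [e] at hj
  set m := M i j with hm
  set θ : ℝ := Real.pi / m with hθ
  obtain h0 | h2 | h3 : m = 0 ∨ m = 2 ∨ 3 ≤ m := by omega
  · simp only [hθ, h0] at hj
    simp [S_eval_two] at hj
    simp [h0, hj]
  · have ht : 2 * Real.cos (2 * θ) = -2 := by
      rw [hθ, h2]
      have : 2 * (Real.pi / ((2 : ℕ) : ℝ)) = Real.pi := by push_cast; ring
      rw [this, Real.cos_pi]; ring
    rw [ht] at hi
    have hpar : ∀ k : ℕ, (S ℝ (k : ℤ)).eval (-2) + (S ℝ ((k : ℤ) - 1)).eval (-2) = (-1) ^ k := by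
      intro k
      induction k with
      | zero => simp
      | succ k ih =>
        have := S_add_one ℝ k
        push_cast
        rw [this, pow_succ, ← ih]
        simp
        ring
    rw [hpar, neg_one_pow_eq_one_iff_even (by norm_num)] at hi
    rw [h2]
    exact hi.two_dvd
  · have hs := CoxeterMatrix.sin_two_mul_pi_div_pos h3
    rw [← hθ] at hs
    have hS : ∀ n : ℤ, (S ℝ n).eval (2 * Real.cos (2 * θ)) =
        Real.sin ((n + 1) * (2 * θ)) / Real.sin (2 * θ) := fun n => by
      rw [eq_div_iff hs.ne', S_two_mul_real_cos]
    have hm0 : (m : ℝ) ≠ 0 := by positivity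
    have hcos : Real.cos θ ≠ 0 := by
      refine (Real.cos_pos_of_mem_Ioo ⟨?_, ?_⟩).ne'
      · have := Real.pi_pos
        have : 0 < θ := by rw [hθ]; positivity
        linarith
      · rw [hθ]
        have hm' : (3 : ℝ) ≤ m := by exact_mod_cast h3
        have := Real.pi_pos
        rw [div_lt_iff₀ (by linarith)]
        nlinarith
    have hz : (S ℝ ((n : ℤ) - 1)).eval (2 * Real.cos (2 * θ)) = 0 := by
      simpa [hcos] using hj
    rw [hz, add_zero, hS, div_eq_one_iff_eq hs.ne'] at hi
    rw [hS, div_eq_zero_iff, or_iff_left hs.ne'] at hz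
    have hz' : Real.sin (n * (2 * θ)) = 0 := by
      rw [← hz]; congr 1; push_cast; ring
    have hi' : Real.cos (n * (2 * θ)) = 1 := by
      have : ((n : ℤ) + 1 : ℝ) * (2 * θ) = n * (2 * θ) + 2 * θ := by push_cast; ring
      rw [this, Real.sin_add, hz', zero_mul, zero_add] at hi
      exact mul_right_cancel₀ hs.ne' (by rw [hi, one_mul])
    obtain ⟨k, hk⟩ := (Real.cos_eq_one_iff _).1 hi'
    have hkn : (k : ℝ) * m = n := by
      have hpi := Real.pi_pos.ne'
      rw [hθ] at hk
      field_simp at hk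
      linarith
    have hkn' : k * (m : ℤ) = n := by exact_mod_cast hkn
    exact Int.natCast_dvd_natCast.1 ⟨k, by rw [← hkn', mul_comm]⟩

theorem simple_injective' : Function.Injective cs.simple := by
  intro i j hij
  by_contra hne
  refine M.off_diagonal i j hne (Nat.dvd_one.1 (cs.dvd_of_simple_mul_simple_pow_eq_one ?_))
  rw [pow_one, hij, cs.simple_mul_simple_self]

end CoxeterSystem

/-! ### The exchange condition -/

namespace CoxeterSystem

variable {B W : Type*} [Group W] {M : CoxeterMatrix B} (cs : CoxeterSystem M W)

open Classical in
/-- The action of a generator on mod 2 chains of reflections. -/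
noncomputable def parityFun (i : B) (a : W → ZMod 2) : W → ZMod 2 := fun t =>
  (if t = cs.simple i then 1 else 0) + a (cs.simple i * t * cs.simple i)

theorem parityFun_parityFun_self (i : B) (a : W → ZMod 2) :
    cs.parityFun i (cs.parityFun i a) = a := by
  classical
  funext t
  have h : (cs.simple i * t * cs.simple i = cs.simple i) ↔ t = cs.simple i := by
    rw [mul_eq_right, mul_eq_one_iff_inv_eq, cs.inv_simple, eq_comm]
  rw [parityFun, parityFun, if_congr h rfl rfl, ← add_assoc, CharTwo.add_self_eq_zero, zero_add]
  simp [mul_assoc]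

/-- The action of a generator on mod 2 chains of reflections. -/
noncomputable def parityPerm (i : B) : Equiv.Perm (W → ZMod 2) where
  toFun := cs.parityFun i
  invFun := cs.parityFun i
  left_inv := cs.parityFun_parityFun_self i
  right_inv := cs.parityFun_parityFun_self i

open Classical in
-- Each generator adds one reflection to the chain. For a power of `s_i s_j` these are the
-- reflections `(s_i s_j)^n s_i` of the dihedral group, in order.
theorem parityPerm_mul_pow_apply (i j : B) (k : ℕ) (a : W → ZMod 2) (t : W) :
    ((cs.parityPerm i * cs.parityPerm j) ^ k) a t =
      (∑ n ∈ Finset.range (2 * k),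
        if t = (cs.simple i * cs.simple j) ^ n * cs.simple i then 1 else 0) +
      a (((cs.simple i * cs.simple j) ^ k)⁻¹ * t * (cs.simple i * cs.simple j) ^ k) := by
  induction k generalizing a with
  | zero => simp
  | succ k ih =>
    set r := cs.simple i * cs.simple j with hr
    have hri : cs.simple i * r⁻¹ = r * cs.simple i := by simp [hr, mul_assoc]
    have hri' : ∀ n : ℕ, cs.simple i * (r ^ n)⁻¹ = r ^ n * cs.simple i := by
      intro n
      induction n with
      | zero => simp
      | succ n ih => rw [pow_succ', mul_inv_rev, ← mul_assoc, ih, mul_assoc, hri, ← mul_assoc,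
          ← pow_succ, pow_succ']
    rw [pow_succ, Equiv.Perm.mul_apply, ih]
    have e1 : (r ^ k)⁻¹ * t * r ^ k = cs.simple i ↔ t = r ^ (2 * k) * cs.simple i := by
      rw [mul_assoc, inv_mul_eq_iff_eq_mul, ← eq_mul_inv_iff_mul_eq, mul_assoc, hri' k, ← mul_assoc,
        ← pow_add, two_mul]
    have e2 : cs.simple i * ((r ^ k)⁻¹ * t * r ^ k) * cs.simple i = cs.simple j ↔
        t = r ^ (2 * k + 1) * cs.simple i := by
      have : r ^ (2 * k + 1) * cs.simple i = r ^ k * (r * cs.simple i) * (r ^ k)⁻¹ := by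
        rw [mul_assoc, mul_assoc, hri' k]
        simp only [← mul_assoc]
        rw [← pow_succ, ← pow_add]
        congr 2
        omega
      rw [this]
      have key : ∀ y, cs.simple i * y * cs.simple i = cs.simple j ↔ y = r * cs.simple i := by
        intro y
        constructor
        · intro h
          rw [hr, ← h]
          simp [mul_assoc]
        · rintro rfl
          simp [hr, mul_assoc]
      rw [key, mul_assoc _ t, inv_mul_eq_iff_eq_mul, ← eq_mul_inv_iff_mul_eq]
    have e3 : 2 * (k + 1) = 2 * k + 1 + 1 := by ring
    rw [e3, Finset.sum_range_succ, Finset.sum_range_succ, add_assoc, add_assoc]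
    congr 1
    change cs.parityFun i (cs.parityFun j a) _ = _
    rw [parityFun, parityFun, if_congr e1 rfl rfl, if_congr e2 rfl rfl]
    congr 3
    rw [pow_succ, mul_inv_rev]
    simp [hr, mul_assoc]

/-- With exponent `M i j` the list of `2 M i j` reflections runs twice through the same `M i j`
elements, so it cancels modulo 2. -/
theorem parityPerm_isLiftable : M.IsLiftable cs.parityPerm := by
  classical
  intro i j
  ext a t
  rw [cs.parityPerm_mul_pow_apply, two_mul, Finset.sum_range_add]
  simp only [pow_add, cs.simple_mul_simple_pow, one_mul, CharTwo.add_self_eq_zero, zero_add]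
  simp

open Classical in
-- The point is that the right side depends only on the element: the parity of the number of times
-- `t` occurs as an inversion is the same for all words of that element.
theorem count_leftInvSeq_eq (ω : List B) (t : W) :
    ((cs.leftInvSeq ω).count t : ZMod 2) =
      cs.lift ⟨cs.parityPerm, cs.parityPerm_isLiftable⟩ (cs.wordProd ω) 0 t := by
  induction ω generalizing t with
  | nil => simp
  | cons i ω ih =>
    rw [cs.wordProd_cons, map_mul, cs.lift_apply_simple, Equiv.Perm.mul_apply]
    change _ = cs.parityFun i _ _
    rw [parityFun, ← ih, leftInvSeq, List.count_cons, add_comm]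
    push_cast
    congr 1
    · exact if_congr (by rw [beq_iff_eq, eq_comm]) rfl rfl
    · have : t = MulAut.conj (cs.simple i) (cs.simple i * t * cs.simple i) := by
        simp [mul_assoc]
      conv_lhs => rw [this]
      rw [List.count_map_of_injective _ _ (MulAut.conj (cs.simple i)).injective]

/-- The strong form of the exchange condition for simple reflections. -/
theorem simple_mem_leftInvSeq {ω : List B} {i : B} (h : cs.IsLeftDescent (cs.wordProd ω) i) :
    cs.simple i ∈ cs.leftInvSeq ω := by
  classical
  obtain ⟨ω', hω', he⟩ := cs.exists_isReduced (cs.simple i * cs.wordProd ω)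
  have hprod : cs.wordProd (i :: ω') = cs.wordProd ω := by
    rw [cs.wordProd_cons, ← he, cs.simple_mul_simple_cancel_left]
  have hred : cs.IsReduced (i :: ω') := by
    rw [IsReduced, hprod, List.length_cons, ← hω', ← he]
    exact (cs.isLeftDescent_iff.1 h).symm
  -- A reduced word for the same element that begins with `i` has `s_i` exactly once in its
  -- inversion sequence, an odd number; so `s_i` occurs for `ω` too.
  have h1 : (cs.leftInvSeq (i :: ω')).count (cs.simple i) = 1 :=
    List.count_eq_one_of_mem hred.nodup_leftInvSeq (by simp [leftInvSeq])
  have h2 := cs.count_leftInvSeq_eq (i :: ω') (cs.simple i)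
  rw [hprod, ← cs.count_leftInvSeq_eq, h1] at h2
  by_contra hn
  rw [List.count_eq_zero_of_not_mem hn] at h2
  simp at h2

theorem exists_eraseIdx {ω : List B} {i : B} (h : cs.IsLeftDescent (cs.wordProd ω) i) :
    ∃ j < ω.length, cs.simple i = (cs.leftInvSeq ω).getD j 1 ∧
      cs.simple i * cs.wordProd ω = cs.wordProd (ω.eraseIdx j) := by
  obtain ⟨j, hj, he⟩ := List.mem_iff_getElem.1 (cs.simple_mem_leftInvSeq h)
  have he' : (cs.leftInvSeq ω).getD j 1 = cs.simple i := by rw [List.getD_eq_getElem _ 1 hj, he]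
  exact ⟨j, by simpa using hj, he'.symm, by rw [← he', cs.getD_leftInvSeq_mul_wordProd]⟩

/-! ### Special subgroups -/

theorem simple_mem_special {A : Set B} {i : B} (hi : i ∈ A) : cs.simple i ∈ cs.special A :=
  Subgroup.subset_closure ⟨i, hi, rfl⟩

theorem special_mono {A A' : Set B} (h : A ⊆ A') : cs.special A ≤ cs.special A' :=
  Subgroup.closure_mono (Set.image_mono h)

theorem special_le_iff {A : Set B} {K : Subgroup W} :
    cs.special A ≤ K ↔ ∀ i ∈ A, cs.simple i ∈ K := by
  rw [special, Subgroup.closure_le, Set.image_subset_iff]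
  rfl

theorem wordProd_mem_special {A : Set B} {ω : List B} (h : ∀ i ∈ ω, i ∈ A) :
    cs.wordProd ω ∈ cs.special A := by
  apply Subgroup.list_prod_mem
  intro x hx
  obtain ⟨i, hi, rfl⟩ := List.mem_map.1 hx
  exact cs.simple_mem_special (h i hi)

theorem exists_word_of_mem_special {A : Set B} {w : W} (hw : w ∈ cs.special A) :
    ∃ ω : List B, (∀ i ∈ ω, i ∈ A) ∧ cs.wordProd ω = w := by
  induction hw using Subgroup.closure_induction with
  | mem x hx =>
    obtain ⟨i, hi, rfl⟩ := hx
    exact ⟨[i], by simpa using hi, by simp⟩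
  | one => exact ⟨[], by simp, by simp⟩
  | mul x y _ _ hx hy =>
    obtain ⟨ω, h, rfl⟩ := hx
    obtain ⟨ω', h', rfl⟩ := hy
    refine ⟨ω ++ ω', fun i hi => ?_, cs.wordProd_append _ _⟩
    rcases List.mem_append.1 hi with hi | hi
    exacts [h i hi, h' i hi]
  | inv x _ hx =>
    obtain ⟨ω, h, rfl⟩ := hx
    exact ⟨ω.reverse, fun i hi => h i (List.mem_reverse.1 hi), cs.wordProd_reverse ω⟩

/-- The deletion condition, keeping track of the letters. -/
theorem exists_isReduced_of_forall_mem {A : Set B} {ω : List B} (h : ∀ i ∈ ω, i ∈ A) :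
    ∃ ω' : List B, (∀ i ∈ ω', i ∈ A) ∧ cs.IsReduced ω' ∧ cs.wordProd ω' = cs.wordProd ω := by
  induction ω with
  | nil => exact ⟨[], by simp, by simp [IsReduced], rfl⟩
  | cons i ω ih =>
    obtain ⟨ω', h', hr, he⟩ := ih fun j hj => h j (List.mem_cons_of_mem _ hj)
    have hi := h i List.mem_cons_self
    by_cases hd : cs.IsLeftDescent (cs.wordProd ω') i
    · obtain ⟨j, hj, -, hj'⟩ := cs.exists_eraseIdx hd
      have he' : cs.wordProd (ω'.eraseIdx j) = cs.wordProd (i :: ω) := by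
        rw [cs.wordProd_cons, ← he, hj']
      refine ⟨ω'.eraseIdx j, fun x hx => h' x (List.mem_of_mem_eraseIdx hx), ?_, he'⟩
      have h1 := cs.isLeftDescent_iff.1 hd
      have h2 := List.length_eraseIdx_add_one hj
      rw [IsReduced, ← hj']
      rw [hr.eq] at h1
      omega
    · refine ⟨i :: ω', ?_, ?_, by rw [cs.wordProd_cons, cs.wordProd_cons, he]⟩
      · rintro x hx
        rcases List.mem_cons.1 hx with rfl | hx
        exacts [hi, h' x hx]
      · rw [IsReduced, cs.wordProd_cons, cs.not_isLeftDescent_iff.1 hd, hr.eq, List.length_cons]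

theorem exists_isReduced_of_mem_special {A : Set B} {w : W} (hw : w ∈ cs.special A) :
    ∃ ω : List B, (∀ i ∈ ω, i ∈ A) ∧ cs.IsReduced ω ∧ cs.wordProd ω = w := by
  obtain ⟨ω, h, rfl⟩ := cs.exists_word_of_mem_special hw
  exact cs.exists_isReduced_of_forall_mem h

theorem mem_of_simple_mem_special {A : Set B} {i : B} (h : cs.simple i ∈ cs.special A) : i ∈ A := by
  obtain ⟨ω, h', hr, he⟩ := cs.exists_isReduced_of_mem_special h
  have hl := hr.eq
  rw [he, cs.length_simple] at hl
  obtain ⟨j, rfl⟩ := List.length_eq_one_iff.1 hl.symm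
  rw [cs.wordProd_singleton] at he
  rw [← cs.simple_injective' he]
  exact h' j (by simp)

theorem special_le_special_iff {A A' : Set B} : cs.special A ≤ cs.special A' ↔ A ⊆ A' :=
  ⟨fun h _ hi => cs.mem_of_simple_mem_special (h (cs.simple_mem_special hi)), cs.special_mono⟩

theorem special_injective : Function.Injective cs.special := fun _ _ h =>
  (cs.special_le_special_iff.1 h.le).antisymm (cs.special_le_special_iff.1 h.ge)

end CoxeterSystem

/-! ### The presentation of a special subgroup -/

/-- The word `i j i …` with `n` letters. -/
def altList {B : Type*} (i j : B) : ℕ → List B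
  | 0 => []
  | n + 1 => i :: altList j i n

theorem length_altList {B : Type*} (i j : B) (n : ℕ) : (altList i j n).length = n := by
  induction n generalizing i j with
  | zero => rfl
  | succ n ih => simp [altList, ih]

theorem mem_of_mem_altList {B : Type*} {A : Set B} {i j : B} (hi : i ∈ A) (hj : j ∈ A) {n : ℕ}
    {x : B} (hx : x ∈ altList i j n) : x ∈ A := by
  induction n generalizing i j with
  | zero => simp [altList] at hx
  | succ n ih =>
    rcases List.mem_cons.1 hx with rfl | hx
    exacts [hi, ih hj hi hx]

theorem altList_prod_mul_inv {B K : Type*} [Group K] (f : B → K) {i j : B}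
    (hi : f i * f i = 1) (hj : f j * f j = 1) (n : ℕ) :
    ((altList i j n).map f).prod * (((altList j i n).map f).prod)⁻¹ = (f i * f j) ^ n := by
  induction n generalizing i j with
  | zero => simp [altList]
  | succ n ih =>
    simp only [altList, List.map_cons, List.prod_cons, mul_inv_rev]
    rw [mul_assoc, ← mul_assoc _ _ (f j)⁻¹, ih hj hi, inv_eq_of_mul_eq_one_left hj, ← mul_assoc,
      ← mul_pow_mul, mul_assoc, ← pow_succ]

namespace CoxeterSystem

variable {B W : Type*} [Group W] {M : CoxeterMatrix B} (cs : CoxeterSystem M W)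

theorem wordProd_altList (i j : B) :
    cs.wordProd (altList i j (M i j)) = cs.wordProd (altList j i (M i j)) := by
  have := altList_prod_mul_inv cs.simple (cs.simple_mul_simple_self i)
    (cs.simple_mul_simple_self j) (M i j)
  rwa [cs.simple_mul_simple_pow, mul_inv_eq_one] at this

theorem getD_leftInvSeq_altList_append (i j : B) {n k : ℕ} (hk : k < n) (ω : List B) :
    (cs.leftInvSeq (altList i j n ++ ω)).getD k 1 =
      (cs.simple i * cs.simple j) ^ k * cs.simple i := by
  induction n generalizing i j k with
  | zero => omega
  | succ n ih =>
    rw [altList, List.cons_append, leftInvSeq]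
    rcases k with _ | k
    · simp
    · rw [List.getD_cons_succ, show (1 : W) = MulAut.conj (cs.simple i) 1 by simp, List.getD_map,
        ih j i (by omega), MulAut.conj_apply, pow_succ', cs.inv_simple]
      rw [← mul_assoc (cs.simple i), ← mul_pow_mul, mul_assoc _ (cs.simple i) (cs.simple j),
        ← pow_succ, pow_succ']

/-- The alternating prefix grows by one letter at a time through the exchange condition for the
descent `j'`. The deleted letter cannot lie in the prefix, as this would give `(s_i s_j)^(k+1) = 1`
with an exponent too small for the order. -/
theorem exists_altList_append {A : Set B} {w : W} (hw : w ∈ cs.special A) {i j : B} (hi : i ∈ A)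
    (hj : j ∈ A) (hdi : cs.IsLeftDescent w i) (hdj : cs.IsLeftDescent w j) {n : ℕ}
    (hn : M i j = 0 ∨ n ≤ M i j) :
    ∃ i' j' ω, (i' = i ∧ j' = j ∨ i' = j ∧ j' = i) ∧ (∀ x ∈ ω, x ∈ A) ∧
      cs.IsReduced (altList i' j' n ++ ω) ∧ cs.wordProd (altList i' j' n ++ ω) = w := by
  induction n with
  | zero =>
    obtain ⟨ω, h, hr, he⟩ := cs.exists_isReduced_of_mem_special hw
    exact ⟨i, j, ω, Or.inl ⟨rfl, rfl⟩, h, hr, he⟩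
  | succ n ih =>
    obtain ⟨i', j', ω, hij, h, hr, he⟩ := ih (by omega)
    have hd : cs.IsLeftDescent (cs.wordProd (altList i' j' n ++ ω)) j' := by
      rw [he]
      rcases hij with ⟨-, rfl⟩ | ⟨-, rfl⟩ <;> assumption
    have hM : M i' j' = M i j := by
      rcases hij with ⟨rfl, rfl⟩ | ⟨rfl, rfl⟩
      exacts [rfl, M.symmetric _ _]
    obtain ⟨k, hk, hk', hk''⟩ := cs.exists_eraseIdx hd
    have hnk : n ≤ k := by
      by_contra! hlt
      rw [cs.getD_leftInvSeq_altList_append _ _ hlt] at hk'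
      have h1 : (cs.simple i' * cs.simple j') ^ (k + 1) = 1 := by
        rw [pow_succ, ← mul_assoc, ← hk', cs.simple_mul_simple_self]
      have h2 := cs.dvd_of_simple_mul_simple_pow_eq_one h1
      rw [hM] at h2
      rcases hn with hn | hn
      · rw [hn, zero_dvd_iff] at h2
        omega
      · have := Nat.le_of_dvd (by omega) h2
        omega
    have hl := length_altList i' j' n
    rw [List.eraseIdx_append_of_length_le (by omega)] at hk''
    have hprod : cs.wordProd (altList j' i' (n + 1) ++ ω.eraseIdx (k - (altList i' j' n).length)) = w := by
      rw [altList, List.cons_append, cs.wordProd_cons, ← hk'', cs.simple_mul_simple_cancel_left, he]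
    refine ⟨j', i', ω.eraseIdx (k - (altList i' j' n).length), ?_,
      fun x hx => h x (List.mem_of_mem_eraseIdx hx), ?_, hprod⟩
    · tauto
    · rw [IsReduced, hprod, ← he, hr.eq]
      simp only [List.length_append, length_altList] at hk ⊢
      have := List.length_eraseIdx_add_one (l := ω) (i := k - n) (by omega)
      omega

/-- Tits' solution of the word problem, by induction on the length. Words with the same first letter
are compared after removing it. If the first letters are `i ≠ j`, both are descents, so there are
reduced words that begin with the two alternating words of length `M i j` and then agree; each given
word is compared with the one sharing its first letter, and these two differ by a braid relation. -/
theorem map_prod_eq_of_isReduced {K : Type*} [Group K] {A : Set B} (f : B → K)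
    (hf : ∀ i ∈ A, ∀ j ∈ A, (f i * f j) ^ M i j = 1) {n : ℕ} {ω ω' : List B}
    (hn : ω.length = n) (hω : ∀ i ∈ ω, i ∈ A) (hω' : ∀ i ∈ ω', i ∈ A) (hr : cs.IsReduced ω)
    (hr' : cs.IsReduced ω') (he : cs.wordProd ω = cs.wordProd ω') :
    (ω.map f).prod = (ω'.map f).prod := by
  induction n generalizing ω ω' with
  | zero =>
    have h1 := hr.eq
    have h2 := hr'.eq
    rw [he] at h1
    rw [List.length_eq_zero_iff.1 hn, List.length_eq_zero_iff.1 (by omega : ω'.length = 0)]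
  | succ n ih =>
    have hl : ω'.length = n + 1 := by rw [← hn, ← hr.eq, ← hr'.eq, he]
    obtain ⟨i, ω, rfl⟩ := List.exists_cons_of_length_eq_add_one hn
    obtain ⟨j, ω', rfl⟩ := List.exists_cons_of_length_eq_add_one hl
    have hi : i ∈ A := hω i List.mem_cons_self
    have hj : j ∈ A := hω' j List.mem_cons_self
    have hn' : ω.length = n := by simpa using hn
    have hl' : ω'.length = n := by simpa using hl
    have cons : ∀ {i : B} {ω₁ ω₂ : List B}, ω₁.length = n → (∀ x ∈ i :: ω₁, x ∈ A) →
        (∀ x ∈ i :: ω₂, x ∈ A) → cs.IsReduced (i :: ω₁) → cs.IsReduced (i :: ω₂) →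
        cs.wordProd (i :: ω₁) = cs.wordProd (i :: ω₂) →
        ((i :: ω₁).map f).prod = ((i :: ω₂).map f).prod := by
      intro i ω₁ ω₂ h1 h2 h3 h4 h5 h6
      rw [List.map_cons, List.map_cons, List.prod_cons, List.prod_cons]
      congr 1
      refine ih h1 (fun x hx => h2 x (List.mem_cons_of_mem _ hx))
        (fun x hx => h3 x (List.mem_cons_of_mem _ hx)) (by simpa using h4.drop 1)
        (by simpa using h5.drop 1) ?_
      simpa [cs.wordProd_cons] using h6
    by_cases hij : i = j
    · subst hij
      exact cons hn' hω hω' hr hr' he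
    have hdesc : ∀ {i : B} {ω : List B}, cs.IsReduced (i :: ω) →
        cs.IsLeftDescent (cs.wordProd (i :: ω)) i := fun {i ω} h => by
      rw [IsLeftDescent, h.eq, cs.wordProd_cons, cs.simple_mul_simple_cancel_left, List.length_cons]
      exact Nat.lt_succ_of_le (cs.length_wordProd_le ω)
    have hdi := hdesc hr
    have hdj := hdesc hr'
    rw [← he] at hdj
    have hmem := cs.wordProd_mem_special hω
    have hlen : ∀ {ω₁ : List B}, cs.IsReduced ω₁ → cs.wordProd ω₁ = cs.wordProd (i :: ω) →
        ω₁.length = n + 1 := fun {ω₁} h1 h2 => by rw [← h1.eq, h2, hr.eq, hn]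
    -- Otherwise a reduced word could begin with an alternating word of length `n + 2`, longer than
    -- the element itself.
    have hM : M i j ≠ 0 := by
      intro h0
      obtain ⟨i', j', ω₁, -, -, h1, h2⟩ :=
        cs.exists_altList_append hmem hi hj hdi hdj (n := n + 2) (Or.inl h0)
      have := hlen h1 h2
      rw [List.length_append, length_altList] at this
      omega
    obtain ⟨ω₁, h0, h1, h2⟩ : ∃ ω₁, (∀ x ∈ ω₁, x ∈ A) ∧ cs.IsReduced (altList i j (M i j) ++ ω₁) ∧
        cs.wordProd (altList i j (M i j) ++ ω₁) = cs.wordProd (i :: ω) := by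
      obtain ⟨i', j', ω₁, hij', h0, h1, h2⟩ :=
        cs.exists_altList_append hmem hi hj hdi hdj (Or.inr le_rfl)
      refine ⟨ω₁, h0, ?_⟩
      have h3 : cs.wordProd (altList i j (M i j) ++ ω₁) = cs.wordProd (i :: ω) := by
        rw [← h2]
        rcases hij' with ⟨rfl, rfl⟩ | ⟨rfl, rfl⟩
        · rfl
        · rw [cs.wordProd_append, cs.wordProd_append, cs.wordProd_altList]
      refine ⟨?_, h3⟩
      rw [IsReduced, h3, ← h2, h1.eq]
      simp [length_altList]
    have h1' : cs.IsReduced (altList j i (M i j) ++ ω₁) := by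
      rw [IsReduced, cs.wordProd_append, ← cs.wordProd_altList, ← cs.wordProd_append, h1.eq]
      simp [length_altList]
    have hA : ∀ {i j : B}, i ∈ A → j ∈ A → ∀ k, ∀ x ∈ altList i j k ++ ω₁, x ∈ A := by
      intro i j hi hj k x hx
      rcases List.mem_append.1 hx with hx | hx
      exacts [mem_of_mem_altList hi hj hx, h0 x hx]
    have e1 : ((i :: ω).map f).prod = ((altList i j (M i j) ++ ω₁).map f).prod := by
      have hA' := hA hi hj (M i j)
      obtain ⟨m, hm⟩ := Nat.exists_eq_succ_of_ne_zero hM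
      rw [hm, altList, List.cons_append] at h1 h2 ⊢
      rw [hm] at hA'
      exact cons hn' hω hA' hr h1 h2.symm
    have e2 : ((j :: ω').map f).prod = ((altList j i (M i j) ++ ω₁).map f).prod := by
      have hA' := hA hj hi (M i j)
      rw [cs.wordProd_append, cs.wordProd_altList, ← cs.wordProd_append] at h2
      obtain ⟨m, hm⟩ := Nat.exists_eq_succ_of_ne_zero hM
      rw [hm, altList, List.cons_append] at h1' h2 ⊢
      rw [hm] at hA'
      exact cons hl' hω' hA' hr' h1' (by rw [h2, ← he])
    have hsq : ∀ i ∈ A, f i * f i = 1 := fun i hi => by simpa [M.diagonal] using hf i hi i hi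
    rw [e1, e2, List.map_append, List.map_append, List.prod_append, List.prod_append]
    congr 1
    rw [← mul_inv_eq_one, altList_prod_mul_inv f (hsq i hi) (hsq j hj), hf i hi j hj]

/-- A special subgroup has the presentation given by the restricted Coxeter matrix. -/
theorem exists_hom_special {K : Type*} [Group K] {A : Set B} (f : B → K)
    (hf : ∀ i ∈ A, ∀ j ∈ A, (f i * f j) ^ M i j = 1) :
    ∃ F : cs.special A →* K, ∀ i (hi : i ∈ A), F ⟨cs.simple i, cs.simple_mem_special hi⟩ = f i := by
  choose word hword hred hprod using fun w : cs.special A =>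
    cs.exists_isReduced_of_mem_special w.2
  -- The value of `f` on a chosen reduced word; by `map_prod_eq_of_isReduced` any reduced word with
  -- letters in `A` gives the same.
  let F : cs.special A → K := fun w => ((word w).map f).prod
  have hF : ∀ (w : cs.special A) (ω : List B), (∀ i ∈ ω, i ∈ A) → cs.IsReduced ω →
      cs.wordProd ω = w → F w = (ω.map f).prod := fun w ω h1 h2 h3 =>
    cs.map_prod_eq_of_isReduced f hf rfl (hword w) h1 (hred w) h2 (by rw [hprod, h3])
  have hsq : ∀ i ∈ A, f i * f i = 1 := fun i hi => by simpa [M.diagonal] using hf i hi i hi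
  have hone : F 1 = 1 := by rw [hF 1 [] (by simp) (by simp [IsReduced]) (by simp)]; simp
  have hasc : ∀ i (hi : i ∈ A) (w : cs.special A), ¬ cs.IsLeftDescent (w : W) i →
      F (⟨cs.simple i, cs.simple_mem_special hi⟩ * w) = f i * F w := by
    intro i hi w hd
    rw [hF _ (i :: word w)]
    · rfl
    · intro x hx
      rcases List.mem_cons.1 hx with rfl | hx
      exacts [hi, hword w x hx]
    · rw [IsReduced, cs.wordProd_cons, hprod, cs.not_isLeftDescent_iff.1 hd, List.length_cons,
        ← (hred w).eq, hprod]
    · rw [cs.wordProd_cons, hprod]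
      rfl
  have hstep : ∀ i (hi : i ∈ A) (w : cs.special A),
      F (⟨cs.simple i, cs.simple_mem_special hi⟩ * w) = f i * F w := by
    intro i hi w
    by_cases hd : cs.IsLeftDescent (w : W) i
    · have := hasc i hi (⟨cs.simple i, cs.simple_mem_special hi⟩ * w)
        (cs.isLeftDescent_iff_not_isLeftDescent_mul.1 hd)
      rw [← mul_assoc, show (⟨cs.simple i, cs.simple_mem_special hi⟩ : cs.special A) *
        ⟨cs.simple i, cs.simple_mem_special hi⟩ = 1 from
          Subtype.ext (cs.simple_mul_simple_self i), one_mul] at this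
      rw [this, ← mul_assoc, hsq i hi, one_mul]
    · exact hasc i hi w hd
  have hlist : ∀ (ω : List B) (h : ∀ i ∈ ω, i ∈ A) (w : cs.special A),
      F (⟨cs.wordProd ω, cs.wordProd_mem_special h⟩ * w) = (ω.map f).prod * F w := by
    intro ω
    induction ω with
    | nil =>
      intro _ w
      rw [List.map_nil, List.prod_nil, one_mul]
      exact congrArg F (one_mul w)
    | cons i ω ih =>
      intro h w
      have hi := h i List.mem_cons_self
      have h' : ∀ j ∈ ω, j ∈ A := fun j hj => h j (List.mem_cons_of_mem _ hj)
      have : (⟨cs.wordProd (i :: ω), cs.wordProd_mem_special h⟩ : cs.special A) * w =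
          ⟨cs.simple i, cs.simple_mem_special hi⟩ *
            (⟨cs.wordProd ω, cs.wordProd_mem_special h'⟩ * w) := by
        apply Subtype.ext
        simp [cs.wordProd_cons, mul_assoc]
      rw [this, hstep i hi, ih h', List.map_cons, List.prod_cons, mul_assoc]
  refine ⟨⟨⟨F, hone⟩, fun x y => ?_⟩, fun i hi => ?_⟩
  · have := hlist (word x) (hword x) y
    rw [show (⟨cs.wordProd (word x), cs.wordProd_mem_special (hword x)⟩ : cs.special A) = x from
      Subtype.ext (hprod x)] at this
    exact this
  · have := hstep i hi 1
    rw [mul_one, hone, mul_one] at this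
    exact this

end CoxeterSystem

/-! ### Intersections of conjugates of special subgroups -/

namespace CoxeterSystem

variable {B W : Type*} [Group W] {M : CoxeterMatrix B} (cs : CoxeterSystem M W)

/-- Lengths add because `d` is shortest in its coset. If prepending `i` shortened the product, the
exchange condition would delete a letter of `ω`, although `i :: ω` is reduced, or a letter of `d`,
giving a shorter element of the coset. -/
theorem length_wordProd_mul_of_forall_le {X : Set B} {d : W}
    (hd : ∀ x ∈ cs.special X, cs.length d ≤ cs.length (x * d)) {ω : List B} (hω : ∀ i ∈ ω, i ∈ X)
    (hr : cs.IsReduced ω) : cs.length (cs.wordProd ω * d) = ω.length + cs.length d := by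
  induction ω with
  | nil => simp
  | cons i ω ih =>
    have hω' : ∀ j ∈ ω, j ∈ X := fun j hj => hω j (List.mem_cons_of_mem _ hj)
    have ih := ih hω' (by simpa using hr.drop 1)
    obtain ⟨ωd, hrd, rfl⟩ := cs.exists_isReduced d
    rw [cs.wordProd_cons, mul_assoc]
    by_cases h : cs.IsLeftDescent (cs.wordProd ω * cs.wordProd ωd) i
    · exfalso
      rw [← cs.wordProd_append] at h
      obtain ⟨k, hk, -, he⟩ := cs.exists_eraseIdx h
      rcases lt_or_ge k ω.length with hlt | hge
      · rw [List.eraseIdx_append_of_lt_length hlt, cs.wordProd_append, cs.wordProd_append,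
          ← mul_assoc, mul_left_inj, ← cs.wordProd_cons] at he
        have h1 := cs.length_wordProd_le (ω.eraseIdx k)
        have h2 := List.length_eraseIdx_add_one hlt
        rw [← he, hr.eq, List.length_cons] at h1
        omega
      · rw [List.eraseIdx_append_of_length_le hge, cs.wordProd_append, cs.wordProd_append,
          ← mul_assoc, ← cs.wordProd_cons] at he
        have h1 := hd _ (mul_mem (inv_mem (cs.wordProd_mem_special hω'))
          (cs.wordProd_mem_special hω))
        rw [mul_assoc, he, inv_mul_cancel_left, hrd.eq] at h1
        have h2 := cs.length_wordProd_le (ωd.eraseIdx (k - ω.length))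
        rw [List.length_append] at hk
        have h3 := List.length_eraseIdx_add_one (l := ωd) (i := k - ω.length) (by omega)
        omega
    · rw [cs.not_isLeftDescent_iff.1 h, ih, List.length_cons]
      ring

/-- For `w` in the intersection write `w d = d y`. The first letter `i` of a reduced word of `w` is
a descent of `d y`, so exchange deletes a letter from `d` or from `y`. The first would make `s_i d`
shorter than `d`. The second says that `s_i` itself lies in the conjugate, and the rest of the word
follows by induction. -/
theorem special_inf_conjBy_of_minimal {X Y : Set B} {d : W}
    (hd : ∀ x ∈ cs.special X, ∀ y ∈ cs.special Y, cs.length d ≤ cs.length (x * d * y)) :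
    cs.special X ⊓ conjBy d (cs.special Y) =
      cs.special {i | i ∈ X ∧ cs.simple i ∈ conjBy d (cs.special Y)} := by
  apply le_antisymm
  · intro w hw
    obtain ⟨ω, hω, hr, rfl⟩ := cs.exists_isReduced_of_mem_special hw.1
    induction ω with
    | nil => simp
    | cons i ω ih =>
      have hi : i ∈ X := hω i List.mem_cons_self
      have hω' : ∀ j ∈ ω, j ∈ X := fun j hj => hω j (List.mem_cons_of_mem _ hj)
      obtain ⟨y, hy, he⟩ : ∃ y ∈ cs.special Y, cs.wordProd (i :: ω) * d = d * y := by
        obtain ⟨y, hy, he⟩ := hw.2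
        refine ⟨y, hy, ?_⟩
        rw [← he]
        simp
      have hd' : ∀ x ∈ cs.special X, cs.length d ≤ cs.length (x * d) := fun x hx => by
        simpa using hd x hx 1 (one_mem _)
      obtain ⟨ωd, hrd, rfl⟩ := cs.exists_isReduced d
      obtain ⟨ωy, hωy, rfl⟩ := cs.exists_word_of_mem_special hy
      have hdesc : cs.IsLeftDescent (cs.wordProd (ωd ++ ωy)) i := by
        rw [cs.wordProd_append, ← he, IsLeftDescent,
          cs.length_wordProd_mul_of_forall_le hd' hω hr, cs.wordProd_cons, mul_assoc,
          cs.simple_mul_simple_cancel_left,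
          cs.length_wordProd_mul_of_forall_le hd' hω' (by simpa using hr.drop 1)]
        simp
      obtain ⟨k, hk, -, hke⟩ := cs.exists_eraseIdx hdesc
      have hs : cs.simple i ∈ conjBy (cs.wordProd ωd) (cs.special Y) := by
        rcases lt_or_ge k ωd.length with hlt | hge
        · exfalso
          rw [List.eraseIdx_append_of_lt_length hlt, cs.wordProd_append, cs.wordProd_append,
            ← mul_assoc, mul_left_inj] at hke
          have h1 := hd' _ (cs.simple_mem_special hi)
          have h2 := cs.length_wordProd_le (ωd.eraseIdx k)
          have h3 := List.length_eraseIdx_add_one hlt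
          rw [hke, hrd.eq] at h1
          omega
        · rw [List.eraseIdx_append_of_length_le hge, cs.wordProd_append, cs.wordProd_append] at hke
          refine ⟨cs.wordProd (ωy.eraseIdx (k - ωd.length)) * (cs.wordProd ωy)⁻¹,
            mul_mem (cs.wordProd_mem_special fun x hx => hωy x (List.mem_of_mem_eraseIdx hx))
              (inv_mem hy), ?_⟩
          simp only [MulEquiv.toMonoidHom_eq_coe, MonoidHom.coe_coe, MulAut.conj_apply]
          rw [← mul_assoc, ← hke]
          simp [mul_assoc]
      rw [cs.wordProd_cons] at hw ⊢
      refine mul_mem (cs.simple_mem_special ⟨hi, hs⟩)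
        (ih hω' (by simpa using hr.drop 1) ⟨cs.wordProd_mem_special hω', ?_⟩)
      exact (Subgroup.mul_mem_cancel_left _ hs).1 hw.2
  · rw [special_le_iff]
    exact fun i hi => ⟨cs.simple_mem_special hi.1, hi.2⟩

/-- The intersection of a special subgroup with a conjugate of another one is conjugate to a
special subgroup. -/
theorem exists_special_eq_inf_conjBy (X Y : Set B) (d : W) :
    ∃ Z ⊆ X, ∃ g ∈ cs.special X,
      conjBy g (cs.special X ⊓ conjBy d (cs.special Y)) = cs.special Z := by
  classical
  -- Pass to a shortest element `x d y` of the double coset. Here `y` normalizes `⟨Y⟩` and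
  -- disappears, while `x` becomes the conjugating element.
  have hex : ∃ n, ∃ x ∈ cs.special X, ∃ y ∈ cs.special Y, cs.length (x * d * y) = n :=
    ⟨_, 1, one_mem _, 1, one_mem _, rfl⟩
  obtain ⟨x, hx, y, hy, hn⟩ := Nat.find_spec hex
  have hmin : ∀ x' ∈ cs.special X, ∀ y' ∈ cs.special Y,
      cs.length (x * d * y) ≤ cs.length (x' * (x * d * y) * y') := fun x' hx' y' hy' => by
    rw [hn]
    exact Nat.find_min' hex ⟨x' * x, mul_mem hx' hx, y * y', mul_mem hy hy', by simp [mul_assoc]⟩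
  refine ⟨_, fun i hi => hi.1, x, hx, Eq.trans ?_ (cs.special_inf_conjBy_of_minimal hmin)⟩
  rw [conjBy_inf, conjBy_of_mem hx, conjBy_conjBy, mul_assoc, ← mul_assoc, ← conjBy_conjBy (x * d),
    conjBy_of_mem hy]

end CoxeterSystem

/-! ### Visual graphs over a tree in which every generator occupies a subtree -/

namespace VisualGraph

/-- A visual graph over a tree in which every generator occupies a subtree. -/
structure IsConvex {B X : Type*} (Ψ : VisualGraph B X) : Prop where
  isTree : Ψ.graph.IsTree
  eset_eq : ∀ x y, Ψ.graph.Adj x y → Ψ.eset x y = Ψ.vset x ∩ Ψ.vset y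
  mem_of_toward : ∀ {k x y s}, Ψ.graph.Toward k x y → s ∈ Ψ.vset x → s ∈ Ψ.vset k → s ∈ Ψ.vset y

section

variable {B X : Type*} {Ψ : VisualGraph B X}

/-- A property of vertices that is inherited along the edges whose group contains `s` is inherited
along the subtree that is occupied by `s`. -/
theorem IsConvex.induction (h : Ψ.IsConvex) {s : B} {P : X → Prop}
    (hP : ∀ x y, Ψ.graph.Adj x y → s ∈ Ψ.vset x → s ∈ Ψ.vset y → P y → P x) {x k : X}
    (hx : s ∈ Ψ.vset x) (hk : s ∈ Ψ.vset k) (hPk : P k) : P x := by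
  induction hn : Ψ.graph.dist x k generalizing x with
  | zero =>
    rw [h.isTree.connected.dist_eq_zero_iff] at hn
    rwa [hn]
  | succ n ih =>
    have hne : x ≠ k := by
      rintro rfl
      simp at hn
    obtain ⟨y, hy⟩ := h.isTree.connected.exists_toward hne
    have hsy := h.mem_of_toward hy hx hk
    exact hP x y hy.1 hx hsy (ih hsy (by have := hy.2; omega))

/-- By the universal property: maps that agree on edges give a generator the same value at all
vertices containing it, as these form a subtree. Each Coxeter relation of finite order takes place
in one vertex group by `hpair`, so `exists_hom_special` assembles the maps. -/
theorem IsConvex.groups_isDecompositionOf {W : Type*} [Group W] {M : CoxeterMatrix B}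
    (h : Ψ.IsConvex) (cs : CoxeterSystem M W) {V : Set B} (hV : ∀ x, Ψ.vset x ⊆ V)
    (hpair : ∀ s ∈ V, ∀ t ∈ V, M s t ≠ 0 → ∃ x, s ∈ Ψ.vset x ∧ t ∈ Ψ.vset x) :
    (Ψ.groups cs).IsDecompositionOf (cs.special V) := by
  have hone : ∀ s ∈ V, ∃ x, s ∈ Ψ.vset x := fun s hs => by
    obtain ⟨x, hx, -⟩ := hpair s hs s hs (by simp)
    exact ⟨x, hx⟩
  have hle : ∀ x, (Ψ.groups cs).vgrp x ≤ cs.special V := fun x => cs.special_mono (hV x)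
  refine .of_exists_lift h.isTree ?_ ?_
  · refine le_antisymm (iSup_le hle) (cs.special_le_iff.2 fun s hs => ?_)
    obtain ⟨x, hx⟩ := hone s hs
    exact le_iSup (Ψ.groups cs).vgrp x (cs.simple_mem_special hx)
  · intro K _ φ hφ
    have := h.isTree.connected.nonempty
    choose! c hc using hone
    have hc' : ∀ s (hs : s ∈ V) x (hx : s ∈ Ψ.vset x),
        φ x ⟨cs.simple s, cs.simple_mem_special hx⟩ =
          φ (c s) ⟨cs.simple s, cs.simple_mem_special (hc s hs)⟩ := by
      intro s hs x hx
      refine h.induction (P := fun x => ∀ hx : s ∈ Ψ.vset x,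
        φ x ⟨cs.simple s, cs.simple_mem_special hx⟩ = _) (k := c s) ?_ hx (hc s hs)
          (fun _ => rfl) hx
      intro x y hxy hx hy ih hx'
      rw [← ih hy]
      refine hφ x y hxy _ _ rfl ?_
      change cs.simple s ∈ cs.special (Ψ.eset x y)
      rw [h.eset_eq x y hxy]
      exact cs.simple_mem_special ⟨hx, hy⟩
    classical
    let f : B → K := fun s => if hs : s ∈ V then
      φ (c s) ⟨cs.simple s, cs.simple_mem_special (hc s hs)⟩ else 1
    have hf : ∀ s (hs : s ∈ V) x (hx : s ∈ Ψ.vset x),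
        f s = φ x ⟨cs.simple s, cs.simple_mem_special hx⟩ := fun s hs x hx => by
      rw [hc' s hs x hx]
      exact dif_pos hs
    obtain ⟨F, hF⟩ := cs.exists_hom_special (A := V) f (by
      intro s hs t ht
      by_cases hM : M s t = 0
      · rw [hM, pow_zero]
      obtain ⟨x, hsx, htx⟩ := hpair s hs t ht hM
      rw [hf s hs x hsx, hf t ht x htx, ← map_mul, ← map_pow]
      convert map_one (φ x)
      exact Subtype.ext (cs.simple_mul_simple_pow s t))
    refine ⟨F, ?_⟩
    rintro x ⟨w, hw⟩ hwV
    have hw' : w ∈ ((F.comp (Subgroup.inclusion (hle x))).eqLocus (φ x)).map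
        ((Ψ.groups cs).vgrp x).subtype := by
      refine (cs.special_le_iff (K := ((F.comp (Subgroup.inclusion (hle x))).eqLocus (φ x)).map
        ((Ψ.groups cs).vgrp x).subtype)).2 (fun s hs => ?_) hw
      refine ⟨⟨cs.simple s, cs.simple_mem_special hs⟩, ?_, rfl⟩
      exact (hF s (hV x hs)).trans (hf s (hV x hs) x hs)
    obtain ⟨⟨y, hy⟩, hy', hyw⟩ := hw'
    obtain rfl : y = w := hyw
    exact hy'

/-- Every vertex can be assigned, along edges between comparable sets, a maximal set. -/
theorem IsConvex.exists_assignment [Finite B] (h : Ψ.IsConvex) :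
    ∃ p : X → Set B, (∀ x, Ψ.vset x ⊆ p x) ∧ (∀ x, ∃ k, Ψ.vset k = p x ∧ p k = p x) ∧
      (∀ x y, p x ⊆ Ψ.vset y → Ψ.vset y = p x) ∧
      (∀ x y, p x = p y → Relation.ReflTransGen (fun u v => Ψ.graph.Adj u v ∧ p u = p v ∧
        (Ψ.vset u ⊆ Ψ.vset v ∨ Ψ.vset v ⊆ Ψ.vset u)) x y) := by
  classical
  -- The target of `x` is a nearest vertex with a strictly larger set; the well-ordering breaks
  -- ties, so it is unique.
  let N : X → X → Prop := fun x k => Ψ.vset x ⊂ Ψ.vset k ∧ ∀ k', Ψ.vset x ⊂ Ψ.vset k' →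
    Ψ.graph.dist x k < Ψ.graph.dist x k' ∨
      (Ψ.graph.dist x k = Ψ.graph.dist x k' ∧ ¬ WellOrderingRel k' k)
  have hNex : ∀ x, (∃ k, Ψ.vset x ⊂ Ψ.vset k) → ∃ k, N x k := by
    rintro x ⟨k₀, hk₀⟩
    have hwf : WellFounded (Prod.Lex (fun a b : ℕ => a < b) (WellOrderingRel (α := X))) :=
      WellFounded.prod_lex wellFounded_lt WellOrderingRel.isWellOrder.wf
    obtain ⟨k, hk, hmin⟩ := (InvImage.wf (fun k => (Ψ.graph.dist x k, k)) hwf).has_min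
      {k | Ψ.vset x ⊂ Ψ.vset k} ⟨k₀, hk₀⟩
    refine ⟨k, hk, fun k' hk' => ?_⟩
    have := hmin k' hk'
    simp only [InvImage, Prod.lex_def] at this
    push Not at this
    rcases lt_trichotomy (Ψ.graph.dist x k) (Ψ.graph.dist x k') with h1 | h1 | h1
    · exact Or.inl h1
    · exact Or.inr ⟨h1, this.2 h1.symm⟩
    · omega
  have hNun : ∀ x k k', N x k → N x k' → k = k' := by
    intro x k k' hk hk'
    have h1 := hk.2 k' hk'.1
    have h2 := hk'.2 k hk.1
    rcases trichotomous_of WellOrderingRel k k' with h3 | h3 | h3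
    · rcases h2 with h2 | ⟨-, h2⟩
      · omega
      · exact absurd h3 h2
    · exact h3
    · rcases h1 with h1 | ⟨-, h1⟩
      · omega
      · exact absurd h3 h1
  -- Convexity keeps the set of `x` inside all sets on the way to its target. Before the target none
  -- can be larger, as it would be nearer; so the set is constant there and the target stays the
  -- same.
  have hNstep : ∀ x k y, N x k → Ψ.graph.Toward k x y → Ψ.vset x ⊆ Ψ.vset y ∧
      (y = k ∨ (Ψ.vset y = Ψ.vset x ∧ N y k)) := by
    intro x k y hk hy
    have hsub : Ψ.vset x ⊆ Ψ.vset y := fun s hs => h.mem_of_toward hy hs (hk.1.1 hs)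
    refine ⟨hsub, or_iff_not_imp_left.2 fun hne => ?_⟩
    have hd := hy.2
    have heq : Ψ.vset y = Ψ.vset x := by
      by_contra hne'
      have h1 := hk.2 y (hsub.ssubset_of_ne (Ne.symm hne'))
      have h2 : 0 < Ψ.graph.dist y k := h.isTree.connected.pos_dist_of_ne hne
      have h3 := SimpleGraph.dist_eq_one_iff_adj.2 hy.1
      omega
    refine ⟨heq, heq ▸ hk.1, fun k' hk' => ?_⟩
    have h1 := hk.2 k' (heq ▸ hk')
    have h2 := h.isTree.connected.dist_triangle (u := x) (v := y) (w := k')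
    have h3 := SimpleGraph.dist_eq_one_iff_adj.2 hy.1
    rcases h1 with h1 | ⟨h1, h4⟩
    · left; omega
    · rcases lt_or_eq_of_le (by omega : Ψ.graph.dist y k ≤ Ψ.graph.dist y k') with h5 | h5
      · exact Or.inl h5
      · exact Or.inr ⟨h5, h4⟩
  have hwf : WellFounded fun y x => Ψ.vset x ⊂ Ψ.vset y :=
    InvImage.wf Ψ.vset (wellFounded_gt (α := Set B))
  -- Follow the targets until the set is maximal; this stops because `B` is finite.
  let p : X → Set B := hwf.fix fun x ih =>
    if hx : ∃ k, N x k then ih hx.choose hx.choose_spec.1 else Ψ.vset x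
  have hpN : ∀ x k, N x k → p x = p k := by
    intro x k hk
    have hx : ∃ k, N x k := ⟨k, hk⟩
    have : p x = p hx.choose := by
      change hwf.fix _ x = _
      rw [hwf.fix_eq, dif_pos hx]
    rw [this, hNun x _ k hx.choose_spec hk]
  have hpmax : ∀ x, (¬ ∃ k, Ψ.vset x ⊂ Ψ.vset k) → p x = Ψ.vset x := by
    intro x hx
    change hwf.fix _ x = _
    rw [hwf.fix_eq, dif_neg]
    rintro ⟨k, hk⟩
    exact hx ⟨k, hk.1⟩
  have hbase : ∀ x, Ψ.vset x ⊆ p x ∧ (∃ k, Ψ.vset k = p x ∧ p k = p x) ∧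
      ∀ y, p x ⊆ Ψ.vset y → Ψ.vset y = p x := by
    intro x
    induction x using hwf.induction with
    | _ x ih =>
      by_cases hx : ∃ k, Ψ.vset x ⊂ Ψ.vset k
      · obtain ⟨k, hk⟩ := hNex x hx
        obtain ⟨h1, h2⟩ := ih k hk.1
        rw [hpN x k hk]
        exact ⟨hk.1.1.trans h1, h2⟩
      · rw [hpmax x hx]
        refine ⟨le_rfl, ⟨x, rfl, hpmax x hx⟩, fun y hy => ?_⟩
        by_contra hne
        exact hx ⟨y, hy.ssubset_of_ne (Ne.symm hne)⟩
  refine ⟨p, fun x => (hbase x).1, fun x => (hbase x).2.1, fun x => (hbase x).2.2, ?_⟩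
  let R : X → X → Prop := fun u v => Ψ.graph.Adj u v ∧ p u = p v ∧
        (Ψ.vset u ⊆ Ψ.vset v ∨ Ψ.vset v ⊆ Ψ.vset u)
  have hsymm : ∀ u v, Relation.ReflTransGen R u v → Relation.ReflTransGen R v u := by
    intro u v huv
    induction huv with
    | refl => rfl
    | tail _ hab ih =>
      exact Relation.ReflTransGen.head ⟨hab.1.symm, hab.2.1.symm, hab.2.2.symm⟩ ih
  have htop : ∀ x, ∃ k, Ψ.vset k = p x ∧ Relation.ReflTransGen R x k := by
    intro x
    induction x using hwf.induction with
    | _ x ih =>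
      by_cases hx : ∃ k, Ψ.vset x ⊂ Ψ.vset k
      · obtain ⟨k, hk⟩ := hNex x hx
        obtain ⟨m, hm, hkm⟩ := ih k hk.1
        refine ⟨m, by rw [hm, hpN x k hk], Relation.ReflTransGen.trans ?_ hkm⟩
        have : ∀ n z, Ψ.graph.dist z k = n → (z = k ∨ N z k) → Relation.ReflTransGen R z k := by
          intro n
          induction n with
          | zero =>
            intro z hz _
            rw [h.isTree.connected.dist_eq_zero_iff] at hz
            rw [hz]
          | succ n ihn =>
            rintro z hz (rfl | hzk)
            · rfl
            obtain ⟨y, hy⟩ := h.isTree.connected.exists_toward (x := z) (k := k) (by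
              rintro rfl
              exact hzk.1.ne rfl)
            obtain ⟨h1, h2⟩ := hNstep z k y hzk hy
            have h3 : p z = p y := by
              rw [hpN z k hzk]
              rcases h2 with rfl | h2
              · rfl
              · rw [hpN y k h2.2]
            exact Relation.ReflTransGen.head ⟨hy.1, h3, Or.inl h1⟩
              (ihn y (by have := hy.2; omega) (h2.imp_right And.right))
        exact this _ x rfl (Or.inr hk)
      · exact ⟨x, (hpmax x hx).symm, .refl⟩
  -- Vertices carrying the same maximal set are joined by vertices carrying it, by convexity and
  -- maximality.
  have hfib : ∀ A, (∀ y, A ⊆ Ψ.vset y → Ψ.vset y = A) → ∀ n z k, Ψ.graph.dist z k = n →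
      Ψ.vset z = A → Ψ.vset k = A → Relation.ReflTransGen R z k := by
    intro A hA n
    have hpA : ∀ y, Ψ.vset y = A → p y = A := fun y hy => by
      rw [hpmax y, hy]
      rintro ⟨k, hk⟩
      rw [hy] at hk
      exact hk.ne (hA k hk.1).symm
    induction n with
    | zero =>
      intro z k hz _ _
      rw [h.isTree.connected.dist_eq_zero_iff] at hz
      rw [hz]
    | succ n ihn =>
      intro z k hz hzA hkA
      obtain ⟨y, hy⟩ := h.isTree.connected.exists_toward (x := z) (k := k) (by
        rintro rfl
        simp at hz)
      have hyA : Ψ.vset y = A :=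
        hA y fun s hs => h.mem_of_toward hy (by rwa [hzA]) (by rwa [hkA])
      exact Relation.ReflTransGen.head ⟨hy.1, by rw [hpA z hzA, hpA y hyA],
        Or.inl (by rw [hzA, hyA])⟩ (ihn y k (by have := hy.2; omega) hyA hkA)
  intro x y hxy
  obtain ⟨k, hk, hxk⟩ := htop x
  obtain ⟨k', hk', hyk'⟩ := htop y
  exact hxk.trans ((hfib (p x) (hbase x).2.2 _ k k' rfl hk (by rw [hk', hxy])).trans
    (hsymm _ _ hyk'))

/-- A visual graph over a tree with subtrees for the generators reduces to a finite graph. -/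
theorem IsConvex.exists_isReduction [Finite B] (h : Ψ.IsConvex) {W : Type*} [Group W]
    {M : CoxeterMatrix B} (cs : CoxeterSystem M W) :
    ∃ (n : ℕ) (Ψ₁ : VisualGraph B (Fin n)), (Ψ.groups cs).IsReduction (Ψ₁.groups cs) := by
  classical
  obtain ⟨p, hle, hex, hmax, hconn⟩ := h.exists_assignment
  -- The vertices of the reduced graph are the maximal sets that occur, so they are finite in
  -- number.
  obtain ⟨n, ⟨e⟩⟩ := Finite.exists_equiv_fin (Set.range p)
  let q : X → Fin n := fun x => e ⟨p x, x, rfl⟩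
  have hq : ∀ x y, q x = q y ↔ p x = p y := fun x y =>
    e.injective.eq_iff.trans Subtype.ext_iff
  have hqs : ∀ a, ∃ x, q x = a := fun a => by
    obtain ⟨x, hx⟩ := (e.symm a).2
    exact ⟨x, by simp [q, hx]⟩
  have hsub : ∀ a x, q x = a → (e.symm a : Set B) = p x := by
    rintro _ x rfl
    simp [q]
  have hfib : ∀ a, (Ψ.graph.induce (q ⁻¹' {a})).Connected := by
    intro a
    obtain ⟨x₀, hx₀⟩ := hqs a
    have : Nonempty (q ⁻¹' {a}) := ⟨⟨x₀, hx₀⟩⟩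
    refine ⟨?_⟩
    rintro ⟨x, hx⟩ ⟨y, hy⟩
    have hxy : p x = p y := (hq x y).1 (hx.trans hy.symm)
    have := hconn x y hxy
    clear hxy
    induction this using Relation.ReflTransGen.head_induction_on with
    | refl => rfl
    | head hab _ ih =>
      have hb := ((hq _ _).2 hab.2.1).symm.trans hx
      exact (SimpleGraph.Adj.reachable (v := ⟨_, hb⟩) hab.1).trans (ih hb)
  let Ψ₁ : VisualGraph B (Fin n) :=
    { graph := SimpleGraph.mk (fun a b => a ≠ b ∧ ∃ v w, q v = a ∧ q w = b ∧ Ψ.graph.Adj v w)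
        ⟨fun a b ⟨h1, v, w, hv, hw, hvw⟩ => ⟨h1.symm, w, v, hw, hv, hvw.symm⟩⟩
        ⟨fun a ha => ha.1 rfl⟩
      vset := fun a => (e.symm a : Set B)
      eset := fun a b => {s | ∃ v w, q v = a ∧ q w = b ∧ Ψ.graph.Adj v w ∧ s ∈ Ψ.vset v ∧
        s ∈ Ψ.vset w}
      eset_comm := fun a b => by
        ext s
        constructor
        · rintro ⟨v, w, hv, hw, hvw, h1, h2⟩
          exact ⟨w, v, hw, hv, hvw.symm, h2, h1⟩
        · rintro ⟨v, w, hv, hw, hvw, h1, h2⟩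
          exact ⟨w, v, hw, hv, hvw.symm, h2, h1⟩
      eset_subset := by
        rintro a b - s ⟨v, w, hv, hw, hvw, h1, h2⟩
        rw [hsub a v hv]
        exact hle v h1 }
  refine ⟨n, Ψ₁, ?_, q, hfib, ?_, ?_, fun a b => Iff.rfl, ?_⟩
  -- An edge set equal to the set at `a` would put this maximal set inside the one at `b`, making
  -- the two vertices equal.
  · rintro a b ⟨hab, -⟩ heq
    have heq : Ψ₁.eset a b = e.symm a := cs.special_injective heq
    obtain ⟨x, hx⟩ := hqs a
    obtain ⟨y, hy⟩ := hqs b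
    obtain ⟨k, hk, -⟩ := hex y
    apply hab
    rw [← hx, ← hy, hq, ← hk]
    refine (hmax x k ?_).symm
    rw [hk, ← hsub a x hx, ← heq]
    rintro s ⟨v, w, hv, hw, hvw, h1, h2⟩
    rw [← hsub b y hy, hsub b w hw]
    exact hle w h2
  · intro a
    obtain ⟨x, hx⟩ := hqs a
    obtain ⟨k, hk, hpk⟩ := hex x
    refine ⟨k, by rw [← hx, hq, hpk], ?_, fun w hw => ?_⟩
    · change cs.special (e.symm a : Set B) = cs.special (Ψ.vset k)
      rw [hsub a x hx, hk]
    · refine cs.special_mono ?_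
      rw [hk, ← hsub a x hx, hsub a w hw]
      exact hle w
  · intro v w hvw hqvw
    -- The ends of a collapsed edge are joined by a walk through edges with comparable sets. In a
    -- tree this walk must cross the edge itself.
    have hcomp : Ψ.vset v ⊆ Ψ.vset w ∨ Ψ.vset w ⊆ Ψ.vset v := by
      by_contra hno
      obtain ⟨R, hRv, hRw, hR⟩ := h.isTree.exists_cut hvw
      have key : ∀ z, Relation.ReflTransGen (fun u v => Ψ.graph.Adj u v ∧ p u = p v ∧
          (Ψ.vset u ⊆ Ψ.vset v ∨ Ψ.vset v ⊆ Ψ.vset u)) v z → R z := by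
        intro z hz
        induction hz with
        | refl => exact hRv
        | tail _ hab ih =>
          refine (hR _ _ hab.1 fun hs => hno ?_).1 ih
          rcases Sym2.eq_iff.1 hs with ⟨rfl, rfl⟩ | ⟨rfl, rfl⟩
          exacts [hab.2.2, hab.2.2.symm]
      exact hRw (key w (hconn v w ((hq v w).1 hqvw)))
    change cs.special (Ψ.eset v w) = cs.special (Ψ.vset v) ∨
      cs.special (Ψ.eset v w) = cs.special (Ψ.vset w)
    rw [h.eset_eq v w hvw]
    exact hcomp.imp (fun h => by rw [Set.inter_eq_left.2 h]) (fun h => by rw [Set.inter_eq_right.2 h])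
  · intro v w hvw hqvw
    change cs.special (Ψ₁.eset (q v) (q w)) = cs.special (Ψ.eset v w)
    rw [h.eset_eq v w hvw]
    congr 1
    ext s
    constructor
    · rintro ⟨v', w', hv, hw, hvw', h1, h2⟩
      obtain ⟨rfl, rfl⟩ := h.isTree.edge_unique_of_collapse q hfib hvw hvw' hv.symm hw.symm hqvw
      exact ⟨h1, h2⟩
    · rintro ⟨h1, h2⟩
      exact ⟨v, w, rfl, rfl, hvw, h1, h2⟩

end

end VisualGraph

/-! ### The visual graph of groups on the Bass–Serre tree -/

/-- A dihedral group: every element is a power of `r = a * b` or such a power times `a`. -/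
theorem Subgroup.finite_closure_pair {W : Type*} [Group W] {a b : W} (ha : a * a = 1)
    (hb : b * b = 1) (hab : IsOfFinOrder (a * b)) : Finite (Subgroup.closure {a, b}) := by
  set r := a * b with hr
  have hfin : (Subgroup.zpowers r : Set W).Finite := hab.finite_zpowers
  have hainv : a⁻¹ = a := inv_eq_of_mul_eq_one_left ha
  have hbinv : b⁻¹ = b := inv_eq_of_mul_eq_one_left hb
  have hconj : ∀ k : ℤ, a * r ^ k = r ^ (-k) * a := by
    intro k
    have h1 : MulAut.conj a r = r⁻¹ := by
      rw [MulAut.conj_apply, hainv, hr, mul_inv_rev, hainv, hbinv, ← mul_assoc, ha, one_mul]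
    have h2 : MulAut.conj a (r ^ k) = r ^ (-k) := by rw [map_zpow, h1, inv_zpow, zpow_neg]
    rw [← h2, MulAut.conj_apply, inv_mul_cancel_right]
  have hbr : b = r⁻¹ * a := by rw [hr, mul_inv_rev, hainv, hbinv, mul_assoc, ha, mul_one]
  have hstep : ∀ x, (x ∈ Subgroup.zpowers r ∨ x * a ∈ Subgroup.zpowers r) →
      (a * x ∈ Subgroup.zpowers r ∨ a * x * a ∈ Subgroup.zpowers r) := by
    rintro x (⟨k, rfl⟩ | ⟨k, hk⟩)
    · right
      exact ⟨-k, by simp only [hconj]; rw [mul_assoc, ha, mul_one]⟩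
    · left
      refine ⟨-k, ?_⟩
      have : x = r ^ k * a := by
        simp only at hk
        rw [hk, mul_assoc, ha, mul_one]
      simp only
      rw [this, ← mul_assoc, hconj, mul_assoc, ha, mul_one]
  have hstep' : ∀ x, (x ∈ Subgroup.zpowers r ∨ x * a ∈ Subgroup.zpowers r) →
      (b * x ∈ Subgroup.zpowers r ∨ b * x * a ∈ Subgroup.zpowers r) := by
    intro x hx
    rw [hbr]
    refine (hstep x hx).imp (fun h => ?_) (fun h => ?_)
    · rw [mul_assoc]
      exact mul_mem (inv_mem (Subgroup.mem_zpowers r)) h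
    · rw [mul_assoc, mul_assoc, ← mul_assoc a]
      exact mul_mem (inv_mem (Subgroup.mem_zpowers r)) h
  have hsub : (Subgroup.closure {a, b} : Set W) ⊆
      (Subgroup.zpowers r : Set W) ∪ (· * a) '' (Subgroup.zpowers r : Set W) := by
    intro x hx
    have : x ∈ Subgroup.zpowers r ∨ x * a ∈ Subgroup.zpowers r := by
      induction hx using Subgroup.closure_induction_left with
      | one => exact Or.inl (one_mem _)
      | mul_left y hy x _ ih =>
        rcases hy with rfl | rfl
        exacts [hstep x ih, hstep' x ih]
      | inv_mul_cancel y hy x _ ih =>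
        rcases hy with rfl | rfl
        · rw [hainv]; exact hstep x ih
        · rw [hbinv]; exact hstep' x ih
    refine this.imp id fun h => ⟨x * a, h, ?_⟩
    simp only
    rw [mul_assoc, ha, mul_one]
  exact ((hfin.union (hfin.image _)).subset hsub).to_subtype

namespace CoxeterSystem

variable {B W : Type*} [Group W] {M : CoxeterMatrix B} (cs : CoxeterSystem M W)

theorem finite_special_pair {i j : B} (h : M i j ≠ 0) : Finite (cs.special {i, j}) := by
  rw [special, Set.image_pair]
  exact Subgroup.finite_closure_pair (cs.simple_mul_simple_self i) (cs.simple_mul_simple_self j)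
    (isOfFinOrder_iff_pow_eq_one.2 ⟨M i j, Nat.pos_of_ne_zero h, cs.simple_mul_simple_pow i j⟩)

variable {κ : Type*} {V : Set B} {Λ : SubgroupGraph W κ}

theorem mem_visualBassSerre_vset {s : B} {x : Λ.BassSerreVertex (cs.special V)} (hs : s ∈ V) :
    s ∈ (cs.visualBassSerre V Λ).vset x ↔
      (⟨cs.simple s, cs.simple_mem_special hs⟩ : cs.special V) • x = x := by
  have key : ∀ k : cs.special V, k • x = x ↔ k • x.2 = x.2 := by
    obtain ⟨v, y⟩ := x
    intro k
    rw [Sigma.smul_mk, Sigma.mk.inj_iff]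
    simp
  rw [key]
  constructor
  · rintro ⟨-, h, h1, h2⟩
    rwa [show h = ⟨cs.simple s, cs.simple_mem_special hs⟩ from Subtype.ext h1] at h2
  · exact fun h => ⟨hs, _, rfl, h⟩

theorem visualBassSerre_vset_subset (x : Λ.BassSerreVertex (cs.special V)) :
    (cs.visualBassSerre V Λ).vset x ⊆ V := fun _ hs => hs.1

/-- An element that fixes two vertices of a tree fixes the first step of the path between them. -/
theorem visualBassSerre_isConvex (h : Λ.IsDecompositionOf (cs.special V)) :
    (cs.visualBassSerre V Λ).IsConvex where
  isTree := h.bassSerre_isTree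
  eset_eq x y _ := by
    ext s
    constructor
    · rintro ⟨hs, k, h1, h2, h3⟩
      exact ⟨⟨hs, k, h1, h2⟩, ⟨hs, k, h1, h3⟩⟩
    · rintro ⟨⟨hs, k, h1, h2⟩, ⟨-, k', h1', h3⟩⟩
      obtain rfl : k = k' := Subtype.ext (h1.trans h1'.symm)
      exact ⟨hs, k, h1, h2, h3⟩
  mem_of_toward := by
    intro k x y s hy hx hk
    have hs := hx.1
    rw [cs.mem_visualBassSerre_vset hs] at hx hk ⊢
    exact SubgroupGraph.bassSerre_actsOn.smul_eq_of_toward h.bassSerre_isTree hy hk hx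

theorem subset_visualBassSerre_vset {A : Set B} (hA : A ⊆ V) {x : Λ.BassSerreVertex (cs.special V)}
    (hx : ∀ d : cs.special V, (d : W) ∈ cs.special A → d • x = x) :
    A ⊆ (cs.visualBassSerre V Λ).vset x := fun _ hs =>
  (cs.mem_visualBassSerre_vset (hA hs)).2 (hx _ (cs.simple_mem_special hs))

theorem smul_eq_of_mem_special_vset {x : Λ.BassSerreVertex (cs.special V)} {d : cs.special V}
    (hd : (d : W) ∈ cs.special ((cs.visualBassSerre V Λ).vset x)) : d • x = x := by
  have : cs.special ((cs.visualBassSerre V Λ).vset x) ≤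
      (MulAction.stabilizer (cs.special V) x).map (cs.special V).subtype :=
    cs.special_le_iff.2 fun s hs => ⟨⟨cs.simple s, cs.simple_mem_special hs.1⟩,
      (cs.mem_visualBassSerre_vset hs.1).1 hs, rfl⟩
  obtain ⟨d', h1, h2⟩ := this hd
  obtain rfl : d' = d := Subtype.ext h2
  exact h1

/-- Two generators whose product has finite order generate a finite group. This fixes a vertex of
the tree, as required by `groups_isDecompositionOf`. -/
theorem visualBassSerre_isDecompositionOf (h : Λ.IsDecompositionOf (cs.special V)) :
    ((cs.visualBassSerre V Λ).groups cs).IsDecompositionOf (cs.special V) := by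
  refine (cs.visualBassSerre_isConvex h).groups_isDecompositionOf cs
    cs.visualBassSerre_vset_subset fun s hs t ht hM => ?_
  have hsub : ({s, t} : Set B) ⊆ V := by
    rintro _ (rfl | rfl) <;> assumption
  have := cs.finite_special_pair hM
  obtain ⟨x, hx⟩ := (SubgroupGraph.elliptic_iff (cs.special_mono hsub)).1
    (h.elliptic_of_finite (cs.special_mono hsub))
  have := cs.subset_visualBassSerre_vset hsub hx
  exact ⟨x, this (by simp), this (by simp)⟩

end CoxeterSystem

/-! ### Vertex and edge groups of derived visual graphs -/

namespace VisualGraph.IsDerivedFrom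

variable {B W κ ρ : Type*} [Group W] {M : CoxeterMatrix B} {cs : CoxeterSystem M W} {V : Set B}
  {Λ : SubgroupGraph W κ} {Ψ₁ : VisualGraph B ρ}

theorem isDecompositionOf (h : Ψ₁.IsDerivedFrom cs V Λ) (hΛ : Λ.IsDecompositionOf (cs.special V)) :
    (Ψ₁.groups cs).IsDecompositionOf (cs.special V) := by
  obtain ⟨-, p, hp⟩ := h
  exact (cs.visualBassSerre_isDecompositionOf hΛ).of_isCollapseVia hp

theorem vset_subset (h : Ψ₁.IsDerivedFrom cs V Λ) (a : ρ) : Ψ₁.vset a ⊆ V := by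
  obtain ⟨-, p, hp⟩ := h
  obtain ⟨x, -, he, -⟩ := hp.vgrp_eq a
  rw [cs.special_injective he]
  exact cs.visualBassSerre_vset_subset x

theorem elliptic_vset (h : Ψ₁.IsDerivedFrom cs V Λ) (a : ρ) :
    Λ.Elliptic (cs.special V) (cs.special (Ψ₁.vset a)) := by
  rw [SubgroupGraph.elliptic_iff (cs.special_mono (h.vset_subset a))]
  obtain ⟨-, p, hp⟩ := h
  obtain ⟨x, -, he, -⟩ := hp.vgrp_eq a
  rw [cs.special_injective he]
  exact ⟨x, fun d hd => cs.smul_eq_of_mem_special_vset hd⟩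

theorem exists_subset_vset (h : Ψ₁.IsDerivedFrom cs V Λ) {A : Set B} (hA : A ⊆ V)
    (hell : Λ.Elliptic (cs.special V) (cs.special A)) : ∃ a, A ⊆ Ψ₁.vset a := by
  rw [SubgroupGraph.elliptic_iff (cs.special_mono hA)] at hell
  obtain ⟨x, hx⟩ := hell
  obtain ⟨-, p, hp⟩ := h
  obtain ⟨y, -, he, hmax⟩ := hp.vgrp_eq (p x)
  refine ⟨p x, (cs.subset_visualBassSerre_vset hA hx).trans ?_⟩
  rw [cs.special_injective he]
  exact cs.special_le_special_iff.1 (hmax x rfl)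

/-- An edge that survives the reduction is an edge of the Bass–Serre tree, and the stabilizer of the
latter is a conjugate of an edge group of `Λ`. -/
theorem exists_eset_le (h : Ψ₁.IsDerivedFrom cs V Λ) (hΛ : Λ.IsDecompositionOf (cs.special V))
    {a b : ρ} (hab : Ψ₁.graph.Adj a b) : ∃ u w, Λ.graph.Adj u w ∧ ∃ g ∈ cs.special V,
      cs.special (Ψ₁.eset a b) ≤ conjBy g (Λ.egrp u w) := by
  obtain ⟨-, p, hp⟩ := h
  obtain ⟨hne, x, y, rfl, rfl, hxy⟩ := (hp.adj_iff a b).1 hab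
  have he := hp.egrp_eq x y hxy hne
  have hx := fun d => cs.smul_eq_of_mem_special_vset (Λ := Λ) (V := V) (x := x) (d := d)
  have hy := fun d => cs.smul_eq_of_mem_special_vset (Λ := Λ) (V := V) (x := y) (d := d)
  have h1 := ((cs.visualBassSerre V Λ).groups cs).egrp_le hxy
  have h2 := ((cs.visualBassSerre V Λ).groups cs).egrp_le_right hxy
  obtain ⟨u, w, g, huw, rfl, rfl⟩ := hxy
  refine ⟨u, w, huw, g, g.2, he.le.trans fun d hd => ?_⟩
  have hdV : d ∈ cs.special V := cs.special_mono (cs.visualBassSerre_vset_subset _) (h1 hd)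
  rw [← hΛ.inf_eq_egrp huw, conjBy_inf]
  exact ⟨(SubgroupGraph.bassSerre_smul_eq_iff ⟨d, hdV⟩ g u).1 (hx ⟨d, hdV⟩ (h1 hd)),
    (SubgroupGraph.bassSerre_smul_eq_iff ⟨d, hdV⟩ g w).1 (hy ⟨d, hdV⟩ (h2 hd))⟩

end VisualGraph.IsDerivedFrom

/-! ### Minimal splitters -/

theorem relIndex_conjBy {W : Type*} [Group W] (g : W) (K K' : Subgroup W) :
    (conjBy g K).relIndex (conjBy g K') = K.relIndex K' :=
  Subgroup.relIndex_map_map_of_injective _ _ (MulAut.conj g).injective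

theorem conjBy_inv_conjBy {W : Type*} [Group W] (g : W) (K : Subgroup W) :
    conjBy g⁻¹ (conjBy g K) = K := by
  rw [conjBy_conjBy, inv_mul_cancel, conjBy_one]

theorem conjBy_conjBy_inv {W : Type*} [Group W] (g : W) (K : Subgroup W) :
    conjBy g (conjBy g⁻¹ K) = K := by
  rw [conjBy_conjBy, mul_inv_cancel, conjBy_one]

theorem IsVirtuallyAbelian.conjBy {W : Type*} [Group W] {A : Subgroup W}
    (h : IsVirtuallyAbelian A) (g : W) : IsVirtuallyAbelian (conjBy g A) := by
  obtain ⟨K, hK, hc, hi⟩ := h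
  refine ⟨_root_.conjBy g K, conjBy_mono g hK, ?_, by rwa [relIndex_conjBy]⟩
  exact Subgroup.map_isMulCommutative K _

theorem IsVirtuallyAbelian.mono {W : Type*} [Group W] {A A' : Subgroup W}
    (h : IsVirtuallyAbelian A) (hle : A' ≤ A) : IsVirtuallyAbelian A' := by
  obtain ⟨K, hK, hc, hi⟩ := h
  refine ⟨K ⊓ A', inf_le_right, ?_, ?_⟩
  · refine ⟨⟨fun x y => Subtype.ext ?_⟩⟩
    have := hc.is_comm.comm ⟨x, x.2.1⟩ ⟨y, y.2.1⟩
    exact congrArg (Subtype.val : K → W) this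
  · rw [Subgroup.inf_relIndex_right]
    exact fun h0 => hi (Subgroup.relIndex_eq_zero_of_le_right hle h0)

theorem Subgroup.FG.of_relIndex_ne_zero {W : Type*} [Group W] {K A : Subgroup W} (hK : K.FG)
    (hle : K ≤ A) (hi : K.relIndex A ≠ 0) : A.FG := by
  have : Finite (A ⧸ K.subgroupOf A) := (Subgroup.fintypeOfIndexNeZero hi).finite
  let S : Set W := Set.range fun q : A ⧸ K.subgroupOf A => (q.out : W)
  have hS : S.Finite := Set.finite_range _
  have hA : A = K ⊔ Subgroup.closure S := by
    apply le_antisymm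
    · intro a ha
      have h1 : ((⟨a, ha⟩ : A) : A ⧸ K.subgroupOf A).out⁻¹ * (⟨a, ha⟩ : A) ∈ K.subgroupOf A := by
        rw [← QuotientGroup.eq, QuotientGroup.out_eq']
      have h2 := mul_mem (Subgroup.mem_sup_right (S := K) (Subgroup.subset_closure (k := S)
        ⟨((⟨a, ha⟩ : A) : A ⧸ K.subgroupOf A), rfl⟩)) (Subgroup.mem_sup_left h1)
      simpa using h2
    · refine sup_le hle ((Subgroup.closure_le A).2 ?_)
      rintro _ ⟨q, rfl⟩
      exact q.out.2
  rw [hA]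
  exact hK.sup ⟨hS.toFinset, by simp⟩

/-! ### Conjugates and subgroups of minimal splitters -/

namespace SubgroupGraph

variable {W ι κ : Type*} [Group W] {Φ : SubgroupGraph W ι} {v : ι} {Λ : SubgroupGraph W κ}

theorem IsNontrivialSplitting.map {W' : Type*} [Group W'] {H P Q C : Subgroup W} {hP : C ≤ P}
    {hQ : C ≤ Q} (h : IsNontrivialSplitting H P Q C hP hQ) {f : W →* W'}
    (hf : Function.Injective f) :
    IsNontrivialSplitting (H.map f) (P.map f) (Q.map f) (C.map f)
      (Subgroup.map_mono hP) (Subgroup.map_mono hQ) := by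
  refine ⟨?_, (Subgroup.map_injective hf).ne h.left_ne, (Subgroup.map_injective hf).ne h.right_ne⟩
  have h1 := h.decomp.map hf
  have h2 : (amalgam P Q C hP hQ).map f =
      amalgam (P.map f) (Q.map f) (C.map f) (Subgroup.map_mono hP) (Subgroup.map_mono hQ) := by
    unfold amalgam SubgroupGraph.map
    congr 1
    funext b
    cases b <;> rfl
  rwa [h2] at h1

theorem IsNontrivialSplitting.conjBy {H P Q C : Subgroup W} {hP : C ≤ P} {hQ : C ≤ Q}
    (h : IsNontrivialSplitting H P Q C hP hQ) (g : W) :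
    IsNontrivialSplitting (conjBy g H) (conjBy g P) (conjBy g Q) (conjBy g C)
      (conjBy_mono g hP) (conjBy_mono g hQ) :=
  h.map (MulAut.conj g).injective

theorem SplitsCompatibly.le {C : Subgroup W} (h : Φ.SplitsCompatibly v C) : C ≤ Φ.vgrp v := by
  obtain ⟨P, Q, hP, hQ, hs, -⟩ := h
  exact hP.trans (hs.decomp.vgrp_le false)

theorem SplitsCompatibly.conjBy {C : Subgroup W} (h : Φ.SplitsCompatibly v C) {g : W}
    (hg : g ∈ Φ.vgrp v) : Φ.SplitsCompatibly v (conjBy g C) := by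
  obtain ⟨P, Q, hP, hQ, hs, hc⟩ := h
  refine ⟨_root_.conjBy g P, _root_.conjBy g Q, conjBy_mono g hP, conjBy_mono g hQ, ?_,
    fun w hw => ?_⟩
  · have := hs.conjBy g
    rwa [conjBy_of_mem hg] at this
  · obtain ⟨k, hk, b, hb⟩ := hc w hw
    refine ⟨k * g⁻¹, mul_mem hk (inv_mem hg), b, hb.trans ?_⟩
    cases b
    · change _ ≤ _root_.conjBy _ (_root_.conjBy g P)
      rw [conjBy_conjBy, inv_mul_cancel_right]
      rfl
    · change _ ≤ _root_.conjBy _ (_root_.conjBy g Q)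
      rw [conjBy_conjBy, inv_mul_cancel_right]
      rfl

theorem conjBy_mem_minimalSplitters {A : Subgroup W} (h : A ∈ Φ.minimalSplitters v) {g : W}
    (hg : g ∈ Φ.vgrp v) : conjBy g A ∈ Φ.minimalSplitters v := by
  obtain ⟨h1, h2, h3⟩ := h
  refine ⟨h1.conjBy g, h2.conjBy hg, ?_⟩
  rintro ⟨C, hC1, hC2, hC3, hC4⟩
  refine h3 ⟨conjBy g⁻¹ C, hC1.conjBy _, hC2.conjBy (inv_mem hg), ?_, ?_⟩
  · rwa [← relIndex_conjBy g, conjBy_inf, conjBy_conjBy_inv]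
  · rwa [← relIndex_conjBy g, conjBy_inf, conjBy_conjBy_inv]

/-- If `C` had infinite index in `D`, it would itself show that `D` is not minimal. Any `C'` that
shows that `C` is not minimal shows the same for `D`. -/
theorem mem_minimalSplitters_of_le {C D : Subgroup W} (hD : D ∈ Φ.minimalSplitters v)
    (hC : Φ.SplitsCompatibly v C) (hle : C ≤ D) :
    C ∈ Φ.minimalSplitters v ∧ C.relIndex D ≠ 0 := by
  obtain ⟨h1, h2, h3⟩ := hD
  have hCD : C.relIndex D ≠ 0 := fun h0 => h3 ⟨C, h1.mono hle, hC, by rwa [inf_of_le_left hle],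
    by rw [inf_of_le_left hle, Subgroup.relIndex_self]; exact one_ne_zero⟩
  refine ⟨⟨h1.mono hle, hC, ?_⟩, hCD⟩
  rintro ⟨C', hC1, hC2, hC3, hC4⟩
  refine h3 ⟨C', hC1, hC2, ?_, ?_⟩
  · rw [Subgroup.inf_relIndex_right] at hC3 ⊢
    exact Subgroup.relIndex_eq_zero_of_le_right hle hC3
  · exact fun h0 => hC4 (Subgroup.relIndex_eq_zero_of_le_left (inf_le_inf_left C' hle) h0)

/-- An edge of a compatible decomposition whose group differs from the groups of its endpoints
gives a nontrivial compatible splitting. -/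
theorem IsDecompositionOf.splitsCompatibly (h : Λ.IsDecompositionOf (Φ.vgrp v))
    (hc : Φ.Compatible v Λ) {a b : κ} (hab : Λ.graph.Adj a b) (ha : Λ.egrp a b ≠ Λ.vgrp a)
    (hb : Λ.egrp a b ≠ Λ.vgrp b) : Φ.SplitsCompatibly v (Λ.egrp a b) := by
  obtain ⟨P, Q, hP, hQ, R, hRa, hRb, -, hRP, hRQ, hs⟩ := h.exists_amalgam hab
  refine ⟨P, Q, hP, hQ, ⟨hs, ?_, ?_⟩, fun w hw => ?_⟩
  · rintro rfl
    exact ha (le_antisymm (Λ.egrp_le hab) (hRP a hRa))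
  · rintro rfl
    exact hb (le_antisymm (Λ.egrp_le_right hab) (hRQ b hRb))
  · obtain ⟨g, hg, x, hx⟩ := hc w hw
    refine ⟨g, hg, ?_⟩
    by_cases hRx : R x
    · exact ⟨false, hx.trans (conjBy_mono g (hRP x hRx))⟩
    · exact ⟨true, hx.trans (conjBy_mono g (hRQ x hRx))⟩

theorem IsReduced.ne_right (h : Λ.IsReduced) {a b : κ} (hab : Λ.graph.Adj a b) :
    Λ.egrp a b ≠ Λ.vgrp b := by
  rw [Λ.egrp_comm]
  exact h b a hab.symm

/-! ### Finite generation -/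

/-- A set of subgroups that generates a finitely generated group has a finite generating
subfamily. -/
theorem exists_finset_iSup_eq {H : Subgroup W} (hfg : H.FG) {K : κ → Subgroup W}
    (hK : ⨆ a, K a = H) : ∃ F : Finset κ, ∀ L : Subgroup W, (∀ a ∈ F, K a ≤ L) → H ≤ L := by
  classical
  obtain ⟨S, rfl⟩ := hfg
  have hmem : ∀ s ∈ S, ∃ F : Finset κ, s ∈ ⨆ a ∈ F, K a := by
    intro s hs
    have : s ∈ ⨆ a, K a := hK ▸ Subgroup.subset_closure hs
    rw [iSup_eq_iSup_finset, Subgroup.mem_iSup_of_directed] at this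
    · exact this
    · exact Monotone.directed_le fun F F' h => iSup₂_mono' fun a ha => ⟨a, Finset.mem_of_subset h ha, le_rfl⟩
  choose! F hF using hmem
  refine ⟨S.biUnion F, fun L hL => (Subgroup.closure_le L).2 fun s hs => ?_⟩
  have : ⨆ a ∈ F s, K a ≤ L := iSup₂_le fun a ha => hL a (Finset.mem_biUnion.2 ⟨s, hs, ha⟩)
  exact this (hF s hs)

/-- Finitely many vertices `F` have groups that generate `H`. Both sides of every edge meet `F`,
since otherwise one factor of the corresponding nontrivial amalgam would be all of `H`. So the tree
is covered by `v₀` and the finitely many walks from `F` to `v₀`. -/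
theorem IsDecompositionOf.finite_of_fg {H : Subgroup W} (h : Λ.IsDecompositionOf H)
    (hr : Λ.IsReduced) (hfg : H.FG) : Finite κ := by
  classical
  obtain ⟨F, hF⟩ := exists_finset_iSup_eq hfg h.iSup_eq
  have hsep : ∀ a b (hab : Λ.graph.Adj a b) (R : κ → Prop), R a → ¬ R b →
      (∀ z w, Λ.graph.Adj z w → s(z, w) ≠ s(a, b) → (R z ↔ R w)) → ∃ f ∈ F, R f := by
    intro a b hab R hRa hRb hR
    by_contra! hno
    obtain ⟨P, Q, hP, hQ, R', hRa', hRb', hR', hRP, hRQ, hs⟩ := h.exists_amalgam hab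
    have hRR : ∀ z, R z ↔ R' z := by
      intro z
      have : (R z ↔ R' z) ↔ (R a ↔ R' a) :=
        (h.isTree.connected.preconnected z a).iff_of_locally_const
          (P := fun z => (R z ↔ R' z)) fun z w hzw => by
            by_cases hs : s(z, w) = s(a, b)
            · rcases Sym2.eq_iff.1 hs with ⟨rfl, rfl⟩ | ⟨rfl, rfl⟩ <;> tauto
            · rw [hR z w hzw hs, hR' z w hzw hs]
      exact this.2 (by tauto)
    have hns : IsNontrivialSplitting H P Q _ hP hQ := by
      refine ⟨hs, ?_, ?_⟩
      · intro he
        exact hr a b hab (le_antisymm (Λ.egrp_le hab) (he ▸ hRP a hRa'))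
      · intro he
        exact hr.ne_right hab (le_antisymm (Λ.egrp_le_right hab) (he ▸ hRQ b hRb'))
    refine (nontrivial_left_ne hns).2 (le_antisymm (hs.vgrp_le true) (hF Q fun f hf => ?_))
    exact hRQ f fun h' => hno f hf ((hRR f).2 h')
  obtain ⟨v₀⟩ := h.isTree.connected.nonempty
  have hwalk : ∀ f, ∃ q : Λ.graph.Walk f v₀, True := fun f =>
    ⟨(h.isTree.connected.preconnected f v₀).some, trivial⟩
  choose q _ using hwalk
  have hcover : ∀ z, z = v₀ ∨ ∃ f ∈ F, z ∈ (q f).support := by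
    intro z
    refine or_iff_not_imp_left.2 fun hz => ?_
    obtain ⟨y, hy⟩ := h.isTree.connected.exists_toward hz
    have hzy := hy.1
    -- Take `f ∈ F` on the side of `z` away from `v₀`; a walk from `f` to `v₀` has to pass through
    -- `z`.
    obtain ⟨f, hf, hRf⟩ := hsep z y hzy (fun w => ¬ Λ.graph.Toward w z y)
      (by rintro ⟨-, h0⟩; simp at h0) (by
        rw [not_not]
        exact ⟨hzy, by simp [SimpleGraph.dist_eq_one_iff_adj.2 hzy]⟩)
      (fun a b hab hne => not_congr (h.isTree.toward_iff_of_adj hzy hab hne))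
    refine ⟨f, hf, ?_⟩
    by_contra hns
    have key : ∀ {f k : κ} (q : Λ.graph.Walk f k), z ∉ q.support → Λ.graph.Toward k z y →
        Λ.graph.Toward f z y := by
      intro f k q
      induction q with
      | nil => exact fun _ hy => hy
      | cons hab q ih =>
        intro hns hy
        rw [SimpleGraph.Walk.support_cons, List.mem_cons, not_or] at hns
        refine (h.isTree.toward_iff_of_adj hzy hab ?_).2 (ih hns.2 hy)
        intro hs
        rcases Sym2.eq_iff.1 hs with ⟨h1, -⟩ | ⟨-, h1⟩
        · exact hns.1 h1.symm
        · exact hns.2 (h1 ▸ q.start_mem_support)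
    exact hRf (key (q f) hns hy)
  refine Set.finite_univ_iff.1 (Set.Finite.subset
    (Set.Finite.union (Set.finite_singleton v₀)
      (Set.Finite.biUnion F.finite_toSet fun f _ => List.finite_toSet (q f).support)) ?_)
  intro z _
  rcases hcover z with hz | ⟨f, hf, hz⟩
  · exact Or.inl hz
  · exact Or.inr (Set.mem_biUnion hf hz)

end SubgroupGraph

namespace SubgroupGraph

section

variable {W κ : Type*} [Group W] {Λ : SubgroupGraph W κ} {H : Subgroup W}

/-- If `H` is generated by a subgroup `K` of a vertex group that contains the edge groups and by
the other vertex groups, then `K` is the whole vertex group. -/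
theorem IsDecompositionOf.vgrp_le_of_le_sup (h : Λ.IsDecompositionOf H) {u : κ} {K : Subgroup W}
    (he : ∀ w, Λ.graph.Adj u w → Λ.egrp u w ≤ K) (hKH : K ≤ Λ.vgrp u)
    (hH : H ≤ K ⊔ ⨆ w : {w // w ≠ u}, Λ.vgrp w) : Λ.vgrp u ≤ K := by
  classical
  -- The cosets of `K` with an extra point `none`, and `τ` exchanges `none` with the coset `K`.
  -- Elements of `K` commute with `τ`, so letting `Λ(u)` act through the conjugate by `τ` and the
  -- other vertex groups directly defines an action of `H`. The given generators fix `none`, hence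
  -- so does `H`; for `g ∈ Λ(u)` this says that `g` fixes the coset `K`.
  let X := Option (W ⧸ K)
  let l : W →* Equiv.Perm X := MulAction.toPermHom W X
  let e : X := some ((1 : W) : W ⧸ K)
  let τ : Equiv.Perm X := Equiv.swap none e
  have hl0 : ∀ g, l g none = none := fun g => rfl
  have hle : ∀ g, l g e = e ↔ g ∈ K := fun g => by
    change some (((g * 1 : W) : W ⧸ K)) = some ((1 : W) : W ⧸ K) ↔ _
    rw [Option.some_inj, mul_one, eq_comm, QuotientGroup.eq, inv_one, one_mul]
  have hτ : ∀ g ∈ K, τ * l g * τ⁻¹ = l g := fun g hg => by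
    rw [mul_inv_eq_iff_eq_mul, Equiv.mul_swap_eq_swap_mul, hl0, (hle g).2 hg]
  let ψ : κ → (W →* Equiv.Perm X) := fun w =>
    if w = u then (MulAut.conj τ).toMonoidHom.comp l else l
  have hψ : ∀ w, ∀ g ∈ K, ψ w g = l g := fun w g hg => by
    by_cases hw : w = u
    · simp only [ψ, hw, if_true]
      exact hτ g hg
    · simp only [ψ, hw, if_false]
  obtain ⟨F, hF⟩ := h.exists_lift (fun w => (ψ w).comp (Λ.vgrp w).subtype) (by
    intro v w hvw x y hxy hx
    simp only [MonoidHom.comp_apply, Subgroup.subtype_apply, ← hxy]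
    by_cases hv : v = u
    · subst hv
      have := he w hvw hx
      rw [hψ _ _ this, hψ _ _ this]
    · by_cases hw : w = u
      · subst hw
        have := he v hvw.symm (Λ.egrp_comm v w ▸ hx)
        rw [hψ _ _ this, hψ _ _ this]
      · simp only [ψ, hv, hw, if_false])
  have hfix : H ≤ ((MulAction.stabilizer (Equiv.Perm X) (none : X)).comap F).map H.subtype := by
    refine hH.trans (sup_le (fun g hg => ?_) (iSup_le ?_))
    · have hgu := hKH hg
      refine ⟨⟨g, h.vgrp_le u hgu⟩, ?_, rfl⟩
      change F _ none = none
      rw [hF u ⟨g, hgu⟩, MonoidHom.comp_apply, Subgroup.subtype_apply, hψ u g hg, hl0]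
    · rintro ⟨w, hw⟩ g hg
      refine ⟨⟨g, h.vgrp_le w hg⟩, ?_, rfl⟩
      change F _ none = none
      rw [hF w ⟨g, hg⟩]
      simp only [MonoidHom.comp_apply, Subgroup.subtype_apply, ψ, hw, if_false]
      rfl
  intro g hg
  obtain ⟨⟨g', hg'⟩, h1, rfl⟩ := hfix (h.vgrp_le u hg)
  have h2 : F ⟨g', hg'⟩ none = none := h1
  rw [hF u ⟨g', hg⟩] at h2
  simp only [MonoidHom.comp_apply, Subgroup.subtype_apply, ψ, if_true] at h2
  have h3 : τ (l g' (τ⁻¹ none)) = none := h2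
  have h4 : τ⁻¹ none = e := by simp [τ]
  rw [h4, ← Equiv.Perm.eq_inv_iff_eq, h4, hle] at h3
  exact h3

/-- Finitely many elements of `Λ(u)` generate `H` together with the other vertex groups. With the
finitely generated edge groups at `u` added, they generate all of `Λ(u)` by `vgrp_le_of_le_sup`. -/
theorem IsDecompositionOf.vgrp_fg [Finite κ] (h : Λ.IsDecompositionOf H) (hfg : H.FG) {u : κ}
    (he : ∀ w, Λ.graph.Adj u w → (Λ.egrp u w).FG) : (Λ.vgrp u).FG := by
  classical
  have := Fintype.ofFinite κ
  let D : Λ.vgrp u ⊕ {w // w ≠ u} → Subgroup W :=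
    Sum.elim (fun x => Subgroup.zpowers (x : W)) fun w => Λ.vgrp w
  have hD : ⨆ a, D a = H := by
    apply le_antisymm
    · refine iSup_le ?_
      rintro (x | w)
      · exact (Subgroup.zpowers_le).2 (h.vgrp_le u x.2)
      · exact h.vgrp_le w
    · conv_lhs => rw [← h.iSup_eq]
      refine iSup_le fun w => ?_
      by_cases hw : w = u
      · subst hw
        exact fun x hx => le_iSup D (Sum.inl ⟨x, hx⟩) (Subgroup.mem_zpowers x)
      · exact le_iSup D (Sum.inr ⟨w, hw⟩)
  obtain ⟨F, hF⟩ := exists_finset_iSup_eq hfg hD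
  choose! S hS using he
  let S₀ : Set W := {x | ∃ hx : x ∈ Λ.vgrp u, Sum.inl ⟨x, hx⟩ ∈ F}
  have hS₀ : S₀.Finite := by
    refine (F.finite_toSet.image (Sum.elim (Subtype.val : Λ.vgrp u → W) fun _ => 1)).subset ?_
    rintro x ⟨hx, hxF⟩
    exact ⟨_, hxF, rfl⟩
  let S₁ : Set W := ⋃ w ∈ {w | Λ.graph.Adj u w}, (S w : Set W)
  have hS₁ : S₁.Finite := Set.Finite.biUnion (Set.toFinite _) fun w _ => (S w).finite_toSet
  let K := Subgroup.closure (S₀ ∪ S₁)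
  have hKu : K ≤ Λ.vgrp u := by
    refine (Subgroup.closure_le _).2 (Set.union_subset ?_ (Set.iUnion₂_subset fun w hw => ?_))
    · rintro x ⟨hx, -⟩
      exact hx
    · exact (Subgroup.subset_closure.trans (hS w hw).le).trans (Λ.egrp_le hw)
  have hK : K = Λ.vgrp u := by
    refine le_antisymm hKu (h.vgrp_le_of_le_sup (fun w hw => ?_) hKu (hF _ ?_))
    · rw [← hS w hw]
      exact Subgroup.closure_mono ((Set.subset_biUnion_of_mem (u := fun w => (S w : Set W))
        (show w ∈ {w | Λ.graph.Adj u w} from hw)).trans Set.subset_union_right)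
    · rintro (x | w) hx
      · exact (Subgroup.zpowers_le).2 (Subgroup.mem_sup_left
          (Subgroup.subset_closure (Or.inl ⟨x.2, hx⟩)))
      · exact le_sup_of_le_right (le_iSup (fun w : {w // w ≠ u} => Λ.vgrp w) w)
  rw [← hK]
  exact ⟨(hS₀.union hS₁).toFinset, by simp [K]⟩

/-- Going from `Λ(u)` into a conjugate of some `Λ₁(a)` and from there into a conjugate of some
`Λ(u')` leads back to `Λ(u)` itself by `eq_of_vgrp_le`, so both inclusions are equalities. -/
theorem IsDecompositionOf.exists_conjBy_eq {ρ : Type*} {Λ₁ : SubgroupGraph W ρ}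
    (h : Λ.IsDecompositionOf H) (hr : Λ.IsReduced) (hell : ∀ u, Λ₁.Elliptic H (Λ.vgrp u))
    (hell₁ : ∀ a, Λ.Elliptic H (Λ₁.vgrp a)) (u : κ) :
    ∃ a, ∃ g ∈ H, conjBy g (Λ.vgrp u) = Λ₁.vgrp a := by
  obtain ⟨g, hg, a, ha⟩ := hell u
  obtain ⟨g', hg', u', hu'⟩ := hell₁ a
  have h2 : Λ.vgrp u ≤ conjBy (g * g') (Λ.vgrp u') := by
    rw [← conjBy_conjBy]
    exact ha.trans (conjBy_mono g hu')
  obtain ⟨rfl, h3⟩ := h.eq_of_vgrp_le hr (mul_mem hg hg') h2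
  refine ⟨a, g⁻¹, inv_mem hg, le_antisymm (by rwa [conjBy_le_iff, inv_inv]) (hu'.trans ?_)⟩
  conv_rhs => rw [← conjBy_of_mem h3, conjBy_conjBy, inv_mul_cancel_left]

theorem IsDecompositionOf.eq_of_conjBy_eq (h : Λ.IsDecompositionOf H) (hr : Λ.IsReduced)
    {K : Subgroup W} {a b : κ} {g g' : W} (hg : g ∈ H) (hg' : g' ∈ H)
    (ha : conjBy g K = Λ.vgrp a) (hb : conjBy g' K = Λ.vgrp b) : a = b := by
  refine ((h.eq_of_vgrp_le hr (u := a) (a := b) (mul_mem hg (inv_mem hg')) ?_).1).symm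
  rw [← ha, ← hb, conjBy_conjBy, inv_mul_cancel_right]

/-- Two reduced decompositions whose vertex groups are elliptic in each other have the same vertex
groups up to conjugation. -/
theorem IsDecompositionOf.existsUnique_equiv {ρ : Type*} {Λ₁ : SubgroupGraph W ρ}
    (h : Λ.IsDecompositionOf H) (hr : Λ.IsReduced) (h₁ : Λ₁.IsDecompositionOf H)
    (hr₁ : Λ₁.IsReduced) (hell : ∀ u, Λ₁.Elliptic H (Λ.vgrp u))
    (hell₁ : ∀ a, Λ.Elliptic H (Λ₁.vgrp a)) :
    ∃! α : κ ≃ ρ, ∀ u, ∃ g ∈ H, conjBy g (Λ.vgrp u) = Λ₁.vgrp (α u) := by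
  have inv : ∀ {K K' : Subgroup W} {g : W}, conjBy g K = K' → conjBy g⁻¹ K' = K := by
    rintro K _ g rfl
    exact conjBy_inv_conjBy g K
  choose α gα hgα hα using h.exists_conjBy_eq hr hell hell₁
  choose β gβ hgβ hβ using h₁.exists_conjBy_eq hr₁ hell₁ hell
  refine ⟨⟨α, β, fun u => ?_, fun a => ?_⟩, fun u => ⟨gα u, hgα u, hα u⟩, fun α' hα' => ?_⟩
  · exact h.eq_of_conjBy_eq hr (hgβ _) (inv_mem (hgα u)) (hβ (α u)) (inv (hα u))
  · exact h₁.eq_of_conjBy_eq hr₁ (hgα _) (inv_mem (hgβ a)) (hα (β a)) (inv (hβ a))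
  · ext u
    obtain ⟨g, hg, he⟩ := hα' u
    exact h₁.eq_of_conjBy_eq hr₁ hg (hgα u) he (hα u)

end

end SubgroupGraph

/-! ### Refining JSJ decompositions -/

namespace SubgroupGraph

variable {W ι κ : Type*} [Group W] {Φ : SubgroupGraph W ι} {v : ι} {Λ : SubgroupGraph W κ}

/-- The subgroups that are elliptic in every weakly JSJ decomposition by definition: the members of
`M(Φ, Φ(v))` and the conjugates of the edge groups at `v`. -/
def IsPeripheral (Φ : SubgroupGraph W ι) (v : ι) (D : Subgroup W) : Prop :=
  D ∈ Φ.minimalSplitters v ∨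
    ∃ w, Φ.graph.Adj v w ∧ ∃ g ∈ Φ.vgrp v, D = conjBy g (Φ.egrp v w)

theorem IsPeripheral.conjBy {D : Subgroup W} (h : Φ.IsPeripheral v D) {g : W}
    (hg : g ∈ Φ.vgrp v) : Φ.IsPeripheral v (conjBy g D) := by
  rcases h with h | ⟨w, hw, k, hk, rfl⟩
  · exact Or.inl (conjBy_mem_minimalSplitters h hg)
  · exact Or.inr ⟨w, hw, g * k, mul_mem hg hk, conjBy_conjBy g k _⟩

theorem IsWeaklyJSJ.elliptic_of_isPeripheral (h : Φ.IsWeaklyJSJ v Λ) {D : Subgroup W}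
    (hD : Φ.IsPeripheral v D) : Λ.Elliptic (Φ.vgrp v) D := by
  rcases hD with hD | ⟨w, hw, k, hk, rfl⟩
  · exact h.elliptic D hD
  · exact Elliptic.conjBy (h.compatible w hw) hk

/-- In the decomposition obtained by splitting the vertex `u`, every subgroup is elliptic that is
elliptic in the given one and whose conjugates in `Λ(u)` are elliptic in the splitting. -/
theorem IsVertexSplittingVia.elliptic {u : κ} {P Q C : Subgroup W}
    {Λ' : SubgroupGraph W (Option κ)} {k : κ → W} (h : Λ.IsVertexSplittingVia u P Q C Λ' k)
    {H : Subgroup W} (hu : Λ.vgrp u ≤ H) {D : Subgroup W} (hD : Λ.Elliptic H D)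
    (hDu : ∀ g ∈ H, conjBy g D ≤ Λ.vgrp u →
      ∃ l ∈ Λ.vgrp u, conjBy g D ≤ conjBy l P ∨ conjBy g D ≤ conjBy l Q) :
    Λ'.Elliptic H D := by
  obtain ⟨g, hg, a, ha⟩ := hD
  by_cases hau : a = u
  · subst hau
    rw [← inv_inv g, ← conjBy_le_iff] at ha
    obtain ⟨l, hl, hl'⟩ := hDu g⁻¹ (inv_mem hg) ha
    simp only [conjBy_le_iff, inv_inv, conjBy_conjBy] at hl'
    refine ⟨g * l, mul_mem hg (hu hl), ?_⟩
    rcases hl' with hl' | hl'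
    · exact ⟨some a, by rwa [h.vgrp_left]⟩
    · exact ⟨none, by rwa [h.vgrp_right]⟩
  · refine ⟨g * (k a)⁻¹, mul_mem hg (inv_mem (hu (h.mem a hau))), some a, ?_⟩
    rwa [h.vgrp_old a hau, conjBy_conjBy, inv_mul_cancel_right]

theorem IsVertexSplittingVia.egrp_cases {u : κ} {P Q C : Subgroup W}
    {Λ' : SubgroupGraph W (Option κ)} {k : κ → W} (h : Λ.IsVertexSplittingVia u P Q C Λ' k)
    {x y : Option κ} (hxy : Λ'.graph.Adj x y) : Λ'.egrp x y = C ∨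
      ∃ a b, Λ.graph.Adj a b ∧ ∃ l ∈ Λ.vgrp u, Λ'.egrp x y = conjBy l (Λ.egrp a b) := by
  have key : ∀ {x : Option κ} {w : κ}, (x = some u ∨ x = none) → w ≠ u → Λ'.graph.Adj x (some w) →
      Λ.graph.Adj u w ∧ Λ'.egrp x (some w) = conjBy (k w) (Λ.egrp u w) := by
    rintro x w (rfl | rfl) hw hxw
    · exact ⟨(h.adj_iff w hw).2 (.inl hxw), h.egrp_left w hw hxw⟩
    · exact ⟨(h.adj_iff w hw).2 (.inr hxw), h.egrp_right w hw hxw⟩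
  have hcase : ∀ x : Option κ, (x = some u ∨ x = none) ∨ ∃ w, w ≠ u ∧ x = some w := by
    rintro (_ | w)
    · exact .inl (.inr rfl)
    · by_cases hw : w = u
      · exact .inl (.inl (by rw [hw]))
      · exact .inr ⟨w, hw, rfl⟩
  rcases hcase x with hx | ⟨a, ha, rfl⟩ <;> rcases hcase y with hy | ⟨b, hb, rfl⟩
  · left
    rcases hx with rfl | rfl <;> rcases hy with rfl | rfl
    · exact absurd rfl hxy.ne
    · exact h.egrp_new
    · rw [Λ'.egrp_comm, h.egrp_new]
    · exact absurd rfl hxy.ne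
  · obtain ⟨h1, h2⟩ := key hx hb hxy
    exact .inr ⟨u, b, h1, k b, h.mem b hb, h2⟩
  · obtain ⟨h1, h2⟩ := key hy ha hxy.symm
    exact .inr ⟨u, a, h1, k a, h.mem a ha, by rw [Λ'.egrp_comm, h2]⟩
  · have h1 := (h.adj_old a b ha hb).1 hxy
    exact .inr ⟨a, b, h1, k a, h.mem a ha, h.egrp_old a b ha hb h1⟩

/-- At the old vertices the decomposition obtained by splitting a vertex is reduced. -/
theorem IsVertexSplittingVia.egrp_ne {u : κ} {P Q C : Subgroup W}
    {Λ' : SubgroupGraph W (Option κ)} {k : κ → W} (h : Λ.IsVertexSplittingVia u P Q C Λ' k)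
    (hr : Λ.IsReduced) {w : κ} (hw : w ≠ u) {y : Option κ} (hy : Λ'.graph.Adj (some w) y) :
    Λ'.egrp (some w) y ≠ Λ'.vgrp (some w) := by
  have hcase : (y = some u ∨ y = none) ∨ ∃ b, b ≠ u ∧ y = some b := by
    rcases y with _ | b
    · exact .inl (.inr rfl)
    · by_cases hb : b = u
      · exact .inl (.inl (by rw [hb]))
      · exact .inr ⟨b, hb, rfl⟩
  rw [h.vgrp_old w hw]
  rcases hcase with (rfl | rfl) | ⟨b, hb, rfl⟩
  · rw [Λ'.egrp_comm, h.egrp_left w hw hy.symm]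
    exact (conjBy_injective _).ne (hr.ne_right ((h.adj_iff w hw).2 (.inl hy.symm)))
  · rw [Λ'.egrp_comm, h.egrp_right w hw hy.symm]
    exact (conjBy_injective _).ne (hr.ne_right ((h.adj_iff w hw).2 (.inr hy.symm)))
  · have h1 := (h.adj_old w b hw hb).1 hy
    rw [h.egrp_old w b hw hb h1]
    exact (conjBy_injective _).ne (hr w b h1)

/-- A nontrivial splitting of a vertex of a reduced graph of groups can be reduced by collapsing at
most two edges. -/
theorem IsVertexSplittingVia.exists_isReduction {u : κ} {P Q C : Subgroup W}
    {Λ' : SubgroupGraph W (Option κ)} {k : κ → W} (h : Λ.IsVertexSplittingVia u P Q C Λ' k)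
    (hT : Λ'.graph.IsTree) (hr : Λ.IsReduced) (hP : P ≠ C) (hQ : Q ≠ C) :
    ∃ (p : Option κ → Option κ) (hp : ∀ x, p (p x) = p x)
      (Λ'' : SubgroupGraph W {a // p a = a}), Λ''.IsReduced ∧
        Λ'.IsCollapseVia Λ'' fun x => ⟨p x, hp x⟩ := by
  classical
  -- Old vertices satisfy the condition already, so only the two new ones can fail. A new vertex
  -- whose group equals the group of an edge to an old vertex `w` is collapsed into `w`.
  have hchoose : ∀ x : Option κ, ∃ x' : Option κ,
      (x' = x ∧ ((x = some u ∨ x = none) → ∀ w, w ≠ u → Λ'.graph.Adj x (some w) →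
        Λ'.egrp x (some w) ≠ Λ'.vgrp x)) ∨
      ((x = some u ∨ x = none) ∧ ∃ w, w ≠ u ∧ x' = some w ∧ Λ'.graph.Adj x (some w) ∧
        Λ'.egrp x (some w) = Λ'.vgrp x) := by
    intro x
    by_cases hx : (x = some u ∨ x = none) ∧ ∃ w, w ≠ u ∧ Λ'.graph.Adj x (some w) ∧
        Λ'.egrp x (some w) = Λ'.vgrp x
    · obtain ⟨hx, w, hw, h1, h2⟩ := hx
      exact ⟨some w, .inr ⟨hx, w, hw, rfl, h1, h2⟩⟩
    · refine ⟨x, .inl ⟨rfl, fun hx' w hw h1 h2 => hx ⟨hx', w, hw, h1, h2⟩⟩⟩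
  choose p hpx using hchoose
  have hold : ∀ w, w ≠ u → p (some w) = some w := by
    intro w hw
    rcases hpx (some w) with h1 | ⟨h1 | h1, -⟩
    · exact h1.1
    · exact absurd (Option.some_inj.1 h1) hw
    · simp at h1
  have hp : ∀ x, p (p x) = p x := by
    intro x
    rcases hpx x with h1 | ⟨-, w, hw, h1, -⟩
    · rw [h1.1, h1.1]
    · rw [h1, hold w hw]
  obtain ⟨Λ'', hΛ''⟩ := exists_isCollapseVia_of_star hT p hp (by
    intro x hx
    rcases hpx x with h1 | ⟨-, w, hw, h1, h2, h3⟩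
    · exact absurd h1.1 hx
    · rw [h1]
      exact ⟨h2, h3⟩)
  refine ⟨p, hp, Λ'', ?_, hΛ''⟩
  rintro a b hab
  obtain ⟨hne, x, y, rfl, rfl, hxy⟩ := (hΛ''.adj_iff a b).1 hab
  rw [hΛ''.egrp_eq x y hxy hne]
  have hle : Λ'.vgrp (p x) ≤ Λ''.vgrp ⟨p x, hp x⟩ := by
    obtain ⟨z, -, h1, h2⟩ := hΛ''.vgrp_eq ⟨p x, hp x⟩
    rw [h1]
    exact h2 _ (Subtype.ext (hp x))
  intro heq
  have hle' : Λ'.vgrp (p x) ≤ Λ'.egrp x y := heq ▸ hle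
  rcases hpx x with ⟨h1, h2⟩ | ⟨-, w, hw, h1, h2, h3⟩
  · rw [h1] at hle'
    have he := le_antisymm (Λ'.egrp_le hxy) hle'
    rcases x with _ | w
    · rcases y with _ | w
      · exact hxy.ne rfl
      · by_cases hw : w = u
        · subst hw
          rw [Λ'.egrp_comm, h.egrp_new, h.vgrp_right] at he
          exact hQ he.symm
        · exact h2 (.inr rfl) w hw hxy he
    · by_cases hw : w = u
      · subst hw
        rcases y with _ | w'
        · rw [h.egrp_new, h.vgrp_left] at he
          exact hP he.symm
        · exact h2 (.inl rfl) w' (fun h' => hxy.ne (by rw [h'])) hxy he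
      · exact h.egrp_ne hr hw hxy he
  · rw [h1] at hle'
    refine h.egrp_ne hr hw h2.symm (le_antisymm (Λ'.egrp_le h2.symm) (hle'.trans ?_))
    rw [Λ'.egrp_comm (some w), h3]
    exact Λ'.egrp_le hxy

/-- No vertex group of a JSJ decomposition splits nontrivially over a subgroup of a minimal splitter
such that the peripheral subgroups are elliptic. -/
theorem IsJSJ.false_of_splitting (hΛ : Φ.IsJSJ v Λ) {u : κ} {P Q C : Subgroup W} {hP : C ≤ P}
    {hQ : C ≤ Q} (hs : IsNontrivialSplitting (Λ.vgrp u) P Q C hP hQ)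
    (hC : ∃ D ∈ Φ.minimalSplitters v, C ≤ D)
    (hD : ∀ D ≤ Λ.vgrp u, Φ.IsPeripheral v D →
      ∃ l ∈ Λ.vgrp u, D ≤ conjBy l P ∨ D ≤ conjBy l Q) : False := by
  obtain ⟨hw, hmax⟩ := hΛ
  have hu := hw.decomp.vgrp_le u
  have hcomp : Λ.Compatible u (amalgam P Q C hP hQ) := by
    intro w huw
    obtain ⟨l, hl, h1 | h1⟩ := hD _ (Λ.egrp_le huw) (.inl (hw.egrp_mem u w huw))
    · exact ⟨l, hl, false, h1⟩
    · exact ⟨l, hl, true, h1⟩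
  obtain ⟨Λ', k, hk, hΛ'⟩ := hw.decomp.exists_vertexSplitting hs.decomp hcomp
  have hell : ∀ D, Φ.IsPeripheral v D → Λ'.Elliptic (Φ.vgrp v) D := fun D hDp =>
    hk.elliptic hu (hw.elliptic_of_isPeripheral hDp) fun g hg hle => hD _ hle (hDp.conjBy hg)
  have hcomp' : Φ.Compatible v Λ' := fun w hvw =>
    hell _ (.inr ⟨w, hvw, 1, one_mem _, (conjBy_one _).symm⟩)
  -- The new edge of `Λ'` shows that the whole vertex group `Φ(v)` splits compatibly over `C`, which
  -- lies in a minimal splitter.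
  have hCM : C ∈ Φ.minimalSplitters v := by
    obtain ⟨D, hDM, hCD⟩ := hC
    refine (mem_minimalSplitters_of_le hDM ?_ hCD).1
    rw [← hk.egrp_new]
    refine hΛ'.splitsCompatibly hcomp' hk.adj_new ?_ ?_
    · rw [hk.egrp_new, hk.vgrp_left]
      exact hs.left_ne.symm
    · rw [hk.egrp_new, hk.vgrp_right]
      exact hs.right_ne.symm
  obtain ⟨p, hp, Λ'', hr'', hΛ''⟩ := hk.exists_isReduction hΛ'.isTree hw.reduced hs.left_ne hs.right_ne
  have hell'' : ∀ D, Φ.IsPeripheral v D → Λ''.Elliptic (Φ.vgrp v) D := by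
    intro D hDp
    obtain ⟨g, hg, x, hx⟩ := hell D hDp
    obtain ⟨y, -, h1, h2⟩ := hΛ''.vgrp_eq ⟨p x, hp x⟩
    exact ⟨g, hg, ⟨p x, hp x⟩, hx.trans (conjBy_mono g (h1 ▸ h2 x rfl))⟩
  refine hmax u P Q C hP hQ hCM hs hcomp Λ' k hk _ Λ'' ⟨hr'', _, hΛ''⟩ ?_
  refine ⟨hΛ'.of_isCollapseVia hΛ'', hr'', fun w hvw => ?_, fun a b hab => ?_, fun A hA => ?_⟩
  · exact hell'' _ (.inr ⟨w, hvw, 1, one_mem _, (conjBy_one _).symm⟩)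
  · obtain ⟨hne, x, y, rfl, rfl, hxy⟩ := (hΛ''.adj_iff a b).1 hab
    rw [hΛ''.egrp_eq x y hxy hne]
    rcases hk.egrp_cases hxy with h1 | ⟨a, b, hab', l, hl, h1⟩
    · rwa [h1]
    · rw [h1]
      exact conjBy_mem_minimalSplitters (hw.egrp_mem a b hab') (hu hl)
  · exact hell'' A (.inl hA)

/-- If the result of splitting a vertex group is weakly JSJ after reduction, then peripheral
subgroups of this vertex group are elliptic in the splitting. -/
theorem IsVertexSplittingVia.exists_le_of_isWeaklyJSJ {u : κ} {P Q C : Subgroup W} {hP : C ≤ P}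
    {hQ : C ≤ Q} {Λ' : SubgroupGraph W (Option κ)} {k : κ → W}
    (h : Λ.IsVertexSplittingVia u P Q C Λ' k) (hΛ : Λ.IsDecompositionOf (Φ.vgrp v))
    (hs : (amalgam P Q C hP hQ).IsDecompositionOf (Λ.vgrp u))
    (hc : Λ.Compatible u (amalgam P Q C hP hQ)) {ρ : Type*} {Λ'' : SubgroupGraph W ρ}
    (hred : Λ'.IsReduction Λ'') (hw : Φ.IsWeaklyJSJ v Λ'') {D : Subgroup W} (hDu : D ≤ Λ.vgrp u)
    (hD : Φ.IsPeripheral v D) : ∃ l ∈ Λ.vgrp u, D ≤ conjBy l P ∨ D ≤ conjBy l Q := by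
  obtain ⟨-, p, hp⟩ := hred
  obtain ⟨g, hg, c, hc'⟩ := hw.elliptic_of_isPeripheral hD
  obtain ⟨x, -, hx, -⟩ := hp.vgrp_eq c
  rw [hx] at hc'
  -- If `D` fixes a vertex of the tree of `Λ` other than the base vertex of `u`, it lies in a
  -- conjugate of an edge group at `u`, and compatibility puts this into a conjugate of `P` or `Q`.
  have hedge : ∀ a g, g ∈ Φ.vgrp v → D ≤ conjBy g (Λ.vgrp a) → ¬ (a = u ∧ g ∈ Λ.vgrp u) →
      ∃ l ∈ Λ.vgrp u, D ≤ conjBy l P ∨ D ≤ conjBy l Q := by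
    intro a g hg hle hne
    obtain ⟨w, huw, l, hl, h1⟩ := hΛ.le_conjBy_egrp hg hDu hle hne
    obtain ⟨l', hl', b, hb⟩ := hc w huw
    have h2 := h1.trans (conjBy_mono l hb)
    rw [conjBy_conjBy] at h2
    refine ⟨l * l', mul_mem hl hl', ?_⟩
    cases b
    · exact .inl h2
    · exact .inr h2
  have hPu : P ≤ Λ.vgrp u := hs.vgrp_le false
  have hQu : Q ≤ Λ.vgrp u := hs.vgrp_le true
  rcases h.vgrp_cases x with h1 | h1 | ⟨a, ha, hka, h1⟩ <;> rw [h1] at hc'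
  · by_cases hgu : g ∈ Λ.vgrp u
    · exact ⟨g, hgu, .inl hc'⟩
    · exact hedge u g hg (hc'.trans (conjBy_mono g hPu)) fun h => hgu h.2
  · by_cases hgu : g ∈ Λ.vgrp u
    · exact ⟨g, hgu, .inr hc'⟩
    · exact hedge u g hg (hc'.trans (conjBy_mono g hQu)) fun h => hgu h.2
  · rw [conjBy_conjBy] at hc'
    exact hedge a _ (mul_mem hg (hΛ.vgrp_le u hka)) hc' fun h => ha h.1

end SubgroupGraph

/-! ### JSJ decompositions of special subgroups -/

namespace CoxeterSystem

variable {B W : Type*} [Group W] {M : CoxeterMatrix B} (cs : CoxeterSystem M W)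

theorem special_fg [Finite B] (A : Set B) : (cs.special A).FG :=
  ⟨((Set.toFinite A).image cs.simple).toFinset, by simp [special]⟩

/-- The generators are involutions and `ℤ` has no torsion. -/
theorem hom_special_eq_one {V : Set B} (F : cs.special V →* Multiplicative ℤ) : F = 1 := by
  have hle : cs.special V ≤ F.ker.map (cs.special V).subtype := by
    refine cs.special_le_iff.2 fun s hs => ⟨⟨cs.simple s, cs.simple_mem_special hs⟩, ?_, rfl⟩
    have h1 : F ⟨cs.simple s, cs.simple_mem_special hs⟩ ^ 2 = 1 := by
      rw [← map_pow, show (⟨cs.simple s, cs.simple_mem_special hs⟩ : cs.special V) ^ 2 = 1 from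
        Subtype.ext (cs.simple_sq s), map_one]
    exact (pow_eq_one_iff_left two_ne_zero).1 h1
  ext ⟨x, hx⟩
  obtain ⟨⟨y, hy⟩, h1, rfl⟩ := hle hx
  exact congrArg _ h1

end CoxeterSystem

/-! ### Derived visual graphs of JSJ decompositions -/

namespace VisualGraph

variable {B W ι κ ρ : Type*} [Group W] {M : CoxeterMatrix B} {cs : CoxeterSystem M W}
  {Ψ : VisualGraph B ι} {v : ι} {Λ : SubgroupGraph W κ} {Ψ₁ : VisualGraph B ρ}

theorem IsDerivedFrom.elliptic_special (h : Ψ₁.IsDerivedFrom cs (Ψ.vset v) Λ) {A : Set B}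
    (hA : A ⊆ Ψ.vset v) (hell : Λ.Elliptic (cs.special (Ψ.vset v)) (cs.special A)) :
    (Ψ₁.groups cs).Elliptic (cs.special (Ψ.vset v)) (cs.special A) := by
  obtain ⟨a, ha⟩ := h.exists_subset_vset hA hell
  exact ⟨1, one_mem _, a, (cs.special_mono ha).trans (conjBy_one _).ge⟩

theorem IsDerivedFrom.compatible (h : Ψ₁.IsDerivedFrom cs (Ψ.vset v) Λ)
    (hc : (Ψ.groups cs).Compatible v Λ) : (Ψ.groups cs).Compatible v (Ψ₁.groups cs) :=
  fun w hw => h.elliptic_special (Ψ.eset_subset hw) (hc w hw)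

/-- Make the splitting over `A` visual. The group of any edge of the result is special, lies in a
conjugate of `A`, and is a group over which `⟨V⟩` splits compatibly; minimality of `A` does the
rest. -/
theorem exists_special_mem_minimalSplitters [Finite B] {A : Subgroup W}
    (hA : A ∈ (Ψ.groups cs).minimalSplitters v) : ∃ A' ⊆ Ψ.vset v, ∃ g ∈ cs.special (Ψ.vset v),
      cs.special A' ∈ (Ψ.groups cs).minimalSplitters v ∧ cs.special A' ≤ conjBy g A ∧
      (cs.special A').relIndex (conjBy g A) ≠ 0 := by
  obtain ⟨P, Q, hP, hQ, hs, hc⟩ := hA.2.1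
  obtain ⟨n, Ψ₀, hΨ₀⟩ := (cs.visualBassSerre_isConvex hs.decomp).exists_isReduction cs
  have hder : Ψ₀.IsDerivedFrom cs (Ψ.vset v) (SubgroupGraph.amalgam P Q A hP hQ) := hΨ₀
  have hdec := hder.isDecompositionOf hs.decomp
  have hred : (Ψ₀.groups cs).IsReduced := hder.1
  -- Without an edge, `⟨V⟩` would be a single visual vertex group, hence elliptic in the splitting
  -- over `A`, and so equal to one of its factors.
  obtain ⟨a, b, hab⟩ : ∃ a b, Ψ₀.graph.Adj a b := by
    by_contra! hno
    obtain ⟨a⟩ := hdec.isTree.connected.nonempty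
    have hall : ∀ b, b = a := fun b => by
      by_contra hne
      obtain ⟨c, hc⟩ := hdec.isTree.connected.exists_toward hne
      exact hno _ _ hc.1
    have hV : cs.special (Ψ.vset v) ≤ cs.special (Ψ₀.vset a) := by
      rw [← hdec.iSup_eq]
      refine iSup_le fun b => ?_
      rw [hall b]
      rfl
    obtain ⟨g, hg, c, hgc⟩ := (hder.elliptic_vset a).mono hV
    have hle : cs.special (Ψ.vset v) ≤ (SubgroupGraph.amalgam P Q A hP hQ).vgrp c := by
      rw [← inv_inv g, ← conjBy_le_iff] at hgc
      rwa [conjBy_of_mem (inv_mem hg)] at hgc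
    have heq := le_antisymm (hs.decomp.vgrp_le c) hle
    cases c
    · exact (SubgroupGraph.nontrivial_left_ne hs).1 heq
    · exact (SubgroupGraph.nontrivial_left_ne hs).2 heq
  obtain ⟨c, d, hcd, g, hg, hle⟩ := hder.exists_eset_le hs.decomp hab
  have hsub := Ψ₀.eset_subset hab
  have hsplit : (Ψ.groups cs).SplitsCompatibly v (cs.special (Ψ₀.eset a b)) :=
    hdec.splitsCompatibly (Φ := Ψ.groups cs) (hder.compatible hc) hab (hred a b hab)
      (hred.ne_right hab)
  have hle' : cs.special (Ψ₀.eset a b) ≤ conjBy g A := hle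
  obtain ⟨h1, h2⟩ := SubgroupGraph.mem_minimalSplitters_of_le
    (SubgroupGraph.conjBy_mem_minimalSplitters hA hg) hsplit hle'
  exact ⟨_, hsub.trans (hder.vset_subset a), g, hg, h1, hle', h2⟩

theorem fg_of_mem_minimalSplitters [Finite B] {A : Subgroup W}
    (hA : A ∈ (Ψ.groups cs).minimalSplitters v) : A.FG := by
  obtain ⟨A', -, g, -, -, h1, h2⟩ := exists_special_mem_minimalSplitters hA
  have h3 := (cs.special_fg A').of_relIndex_ne_zero h1 h2
  obtain ⟨S, hS⟩ := h3
  classical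
  refine ⟨S.image (MulAut.conj g⁻¹), ?_⟩
  rw [Finset.coe_image, ← conjBy_inv_conjBy g A, ← hS, conjBy, MonoidHom.map_closure]
  rfl

/-- Edge groups of `Ψ₁` are subgroups of conjugates of edge groups of `Λ`, so they are minimal
splitters. A minimal splitter contains, up to conjugacy, a special one with finite index; the latter
is elliptic in `Λ`, hence in `Ψ₁`, and ellipticity extends over finite index. -/
theorem IsDerivedFrom.isWeaklyJSJ [Finite B] (h : Ψ₁.IsDerivedFrom cs (Ψ.vset v) Λ)
    (hΛ : (Ψ.groups cs).IsWeaklyJSJ v Λ) : (Ψ.groups cs).IsWeaklyJSJ v (Ψ₁.groups cs) := by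
  have hdec := h.isDecompositionOf hΛ.decomp
  have hred : (Ψ₁.groups cs).IsReduced := h.1
  refine ⟨hdec, hred, h.compatible hΛ.compatible, fun a b hab => ?_, fun A hA => ?_⟩
  · obtain ⟨c, d, hcd, g, hg, hle⟩ := h.exists_eset_le hΛ.decomp hab
    exact (SubgroupGraph.mem_minimalSplitters_of_le
      (SubgroupGraph.conjBy_mem_minimalSplitters (hΛ.egrp_mem c d hcd) hg)
      (hdec.splitsCompatibly (Φ := Ψ.groups cs) (h.compatible hΛ.compatible) hab (hred a b hab)
        (hred.ne_right hab)) hle).1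
  · obtain ⟨A', hA', g, hg, h1, h2, h3⟩ := exists_special_mem_minimalSplitters hA
    have h4 := h.elliptic_special hA' (hΛ.elliptic _ h1)
    have h5 := hdec.elliptic_of_relIndex_ne_zero (A := conjBy g A)
      (conjBy_le_of_mem hg hA.2.1.le) h4 h3
    have h6 := h5.conjBy (inv_mem hg)
    rwa [conjBy_inv_conjBy] at h6

/-- The vertex groups of a JSJ decomposition are elliptic in every derived visual graph. -/
theorem IsDerivedFrom.elliptic_vgrp [Finite B] (h : Ψ₁.IsDerivedFrom cs (Ψ.vset v) Λ)
    (hΛ : (Ψ.groups cs).IsJSJ v Λ) (u : κ) :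
    (Ψ₁.groups cs).Elliptic (cs.special (Ψ.vset v)) (Λ.vgrp u) := by
  have hw := hΛ.1
  have hw₁ := h.isWeaklyJSJ hw
  have hdec : Λ.IsDecompositionOf (cs.special (Ψ.vset v)) := hw.decomp
  have hdec₁ : (Ψ₁.groups cs).IsDecompositionOf (cs.special (Ψ.vset v)) := hw₁.decomp
  have hfin : Finite κ := hdec.finite_of_fg hw.reduced (cs.special_fg _)
  have hu := hdec.vgrp_le u
  have hfg : (Λ.vgrp u).FG := hdec.vgrp_fg (cs.special_fg _) fun w huw =>
    fg_of_mem_minimalSplitters (hw.egrp_mem u w huw)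
  set H := cs.special (Ψ.vset v) with hH
  let X := (Ψ₁.groups cs).BassSerreVertex H
  let T : SimpleGraph X := (Ψ₁.groups cs).bassSerre H
  let _ : MulAction (Λ.vgrp u) X := MulAction.compHom _ (Subgroup.inclusion hu)
  have hsmul : ∀ (g : Λ.vgrp u) (x : X), g • x = (⟨g, hu g.2⟩ : H) • x := fun _ _ => rfl
  have hact : SimpleGraph.ActsOn (Λ.vgrp u) T := fun g x y hxy =>
    SubgroupGraph.bassSerre_actsOn (Subgroup.inclusion hu g) x y hxy
  by_contra hell
  rw [SubgroupGraph.elliptic_iff hu] at hell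
  obtain ⟨x, y, P, Q, hP, hQ, hxy, hs, hstab⟩ := hact.exists_splitting hdec₁.bassSerre_isTree
    (τ := fun x : X => x.1) (fun _ _ => rfl) (fun x y hxy => SubgroupGraph.bassSerre_fst_ne hxy)
    ((Group.fg_iff_subgroup_fg _).2 hfg)
    (by
      rintro ⟨z, hz⟩
      exact hell ⟨z, fun d hd => hz ⟨d, hd⟩⟩)
    (by
      intro φ hφ
      -- Edge groups of `Λ` at `u` are minimal splitters, hence elliptic in `Ψ₁`, so `φ` kills them.
      -- Then `φ` extends by 1 on the other vertex groups to the group `⟨V⟩`, which has no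
      -- nontrivial homomorphism to `ℤ`.
      have hedge : ∀ w (x : Λ.vgrp u), Λ.graph.Adj u w → (x : W) ∈ Λ.egrp u w → φ x = 1 := by
        intro w x huw hx
        obtain ⟨z, hz⟩ := (SubgroupGraph.elliptic_iff ((Λ.egrp_le huw).trans hu)).1
          (hw₁.elliptic _ (hw.egrp_mem u w huw))
        exact hφ x z (hz ⟨x, hu x.2⟩ hx)
      classical
      obtain ⟨F, hF⟩ := hdec.exists_lift (fun w => if hw : w = u then
          φ.comp (Subgroup.inclusion (hw ▸ le_rfl : Λ.vgrp w ≤ Λ.vgrp u)) else 1) (by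
        intro a b hab x y hxy hx
        by_cases ha : a = u
        · subst ha
          have hb : b ≠ a := hab.ne'
          simp only [dif_pos, dif_neg hb, MonoidHom.comp_apply, MonoidHom.one_apply]
          exact hedge b _ hab hx
        · by_cases hb : b = u
          · subst hb
            simp only [dif_pos, dif_neg ha, MonoidHom.comp_apply, MonoidHom.one_apply]
            refine (hedge a _ hab.symm ?_).symm
            rw [Λ.egrp_comm]
            exact hxy ▸ hx
          · simp only [dif_neg ha, dif_neg hb, MonoidHom.one_apply])
      ext x
      have h1 := hF u x (hu x.2)
      rw [cs.hom_special_eq_one F] at h1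
      simp only [dif_pos, MonoidHom.comp_apply, MonoidHom.one_apply] at h1
      exact congrArg _ h1.symm)
  have hs' := hs.map (f := (Λ.vgrp u).subtype) (Subgroup.subtype_injective _)
  rw [← MonoidHom.range_eq_map, Subgroup.range_subtype] at hs'
  refine hΛ.false_of_splitting hs' ?_ fun D hDu hDp => ?_
  -- The splitting is over the stabilizer in `Λ(u)` of an edge of the tree of `Ψ₁`, hence over a
  -- subgroup of a conjugate of an edge group of `Ψ₁`, which is a minimal splitter.
  · obtain ⟨a, b, g, hab, rfl, rfl⟩ := hxy
    refine ⟨_, SubgroupGraph.conjBy_mem_minimalSplitters (hw₁.egrp_mem a b hab) g.2, ?_⟩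
    rintro _ ⟨d, ⟨h1, h2⟩, rfl⟩
    rw [← hdec₁.inf_eq_egrp hab, conjBy_inf]
    have h1' : (⟨d, hu d.2⟩ : H) • (⟨a, g⟩ : X) = ⟨a, g⟩ := h1
    have h2' : (⟨d, hu d.2⟩ : H) • (⟨b, g⟩ : X) = ⟨b, g⟩ := h2
    exact ⟨(SubgroupGraph.bassSerre_smul_eq_iff _ g a).1 h1',
      (SubgroupGraph.bassSerre_smul_eq_iff _ g b).1 h2'⟩
  · obtain ⟨z, hz⟩ := (SubgroupGraph.elliptic_iff (hDu.trans hu)).1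
      (hw₁.elliptic_of_isPeripheral hDp)
    have hmem : ∀ d (hd : d ∈ D), (⟨d, hDu hd⟩ : Λ.vgrp u) ∈ MulAction.stabilizer (Λ.vgrp u) z :=
      fun d hd => hz ⟨d, hu (hDu hd)⟩ hd
    obtain ⟨g, hg⟩ := hstab z
    refine ⟨g, g.2, hg.imp (fun hg d hd => ?_) fun hg d hd => ?_⟩
    · obtain ⟨p, hp, he⟩ := hg (hmem d hd)
      exact ⟨p, ⟨p, hp, rfl⟩, congrArg Subtype.val he⟩
    · obtain ⟨p, hp, he⟩ := hg (hmem d hd)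
      exact ⟨p, ⟨p, hp, rfl⟩, congrArg Subtype.val he⟩

/-- A vertex group of `Ψ₁` is conjugate to one of `Λ`, so a splitting of it can be moved to `Λ`. If
the refinement of `Ψ₁` were weakly JSJ after reduction, peripheral subgroups would be elliptic in
this splitting, and `false_of_splitting` would apply to `Λ`. -/
theorem IsDerivedFrom.isJSJ [Finite B] (h : Ψ₁.IsDerivedFrom cs (Ψ.vset v) Λ)
    (hΛ : (Ψ.groups cs).IsJSJ v Λ) : (Ψ.groups cs).IsJSJ v (Ψ₁.groups cs) := by
  have hw₁ := h.isWeaklyJSJ hΛ.1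
  refine ⟨hw₁, ?_⟩
  intro a P Q C hP hQ hC hs hc Λ' k hk τ Λ'' hred hw''
  obtain ⟨u, g, hg, hgu⟩ := hw₁.decomp.exists_conjBy_eq hw₁.reduced h.elliptic_vset
    (h.elliptic_vgrp hΛ) a
  have hs' := hs.conjBy g
  rw [hgu] at hs'
  refine hΛ.false_of_splitting hs'
    ⟨_, SubgroupGraph.conjBy_mem_minimalSplitters hC hg, le_rfl⟩ fun D hDu hDp => ?_
  have hDa : conjBy g⁻¹ D ≤ (Ψ₁.groups cs).vgrp a := by
    rw [conjBy_le_iff, inv_inv, hgu]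
    exact hDu
  obtain ⟨l, hl, h1⟩ := hk.exists_le_of_isWeaklyJSJ hw₁.decomp hs.decomp hc hred hw'' hDa
    (hDp.conjBy (inv_mem hg))
  refine ⟨g * l * g⁻¹, hgu ▸ ⟨l, hl, rfl⟩, ?_⟩
  simpa only [conjBy_le_iff, inv_inv, conjBy_conjBy, inv_mul_cancel_right] using h1

end VisualGraph

/-- The proof does not use that `Ψ` is amenable, only that it is visual: the compatibility conditions in
the definition of `M(Ψ, G)`-JSJ decompositions suffice. -/
theorem mainTheorem4 {B W : Type*} [Finite B] [Group W] {M : CoxeterMatrix B}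
    (cs : CoxeterSystem M W) {ι : Type*} (Ψ : VisualGraph B ι) (hΨ : Ψ.IsJSJAmenable cs) (v : ι)
    {κ : Type*} (Λ : SubgroupGraph W κ) (hΛ : (Ψ.groups cs).IsJSJ v Λ) :
    (∃ (n : ℕ) (Ψ₁ : VisualGraph B (Fin n)), Ψ₁.IsDerivedFrom cs (Ψ.vset v) Λ) ∧
    (∀ (ρ : Type*) (Ψ₁ : VisualGraph B ρ), Ψ₁.IsDerivedFrom cs (Ψ.vset v) Λ →
      (Ψ.groups cs).IsJSJ v (Ψ₁.groups cs) ∧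
      ∃! α : κ ≃ ρ, ∀ u, ∃ g ∈ cs.special (Ψ.vset v),
        conjBy g (Λ.vgrp u) = cs.special (Ψ₁.vset (α u))) ∧
    (∀ u w, Λ.graph.Adj u w → ∃ A ⊆ Ψ.vset v, ∃ g ∈ cs.special (Ψ.vset v),
      conjBy g (Λ.egrp u w) = cs.special A) := by
  have hdec : Λ.IsDecompositionOf (cs.special (Ψ.vset v)) := hΛ.1.decomp
  have hex : ∃ (n : ℕ) (Ψ₁ : VisualGraph B (Fin n)), Ψ₁.IsDerivedFrom cs (Ψ.vset v) Λ :=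
    (cs.visualBassSerre_isConvex hdec).exists_isReduction cs
  refine ⟨hex, fun ρ Ψ₁ h => ⟨h.isJSJ hΛ, ?_⟩, fun u w huw => ?_⟩
  · exact hdec.existsUnique_equiv hΛ.1.reduced (h.isDecompositionOf hdec) h.1
      (h.elliptic_vgrp hΛ) h.elliptic_vset
  · obtain ⟨n, Ψ₁, h⟩ := hex
    have hconj := hdec.exists_conjBy_eq hΛ.1.reduced (h.elliptic_vgrp hΛ) h.elliptic_vset
    obtain ⟨a, g, hg, ha⟩ := hconj u
    obtain ⟨b, g', hg', hb⟩ := hconj w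
    -- The edge group is the intersection of the two adjacent vertex groups. Conjugation by `g`
    -- turns the first into a special subgroup and the second into the conjugate of one by `g *
    -- g'⁻¹`.
    obtain ⟨A, hA, k, hk, he⟩ :=
      cs.exists_special_eq_inf_conjBy (Ψ₁.vset a) (Ψ₁.vset b) (g * g'⁻¹)
    refine ⟨A, hA.trans (h.vset_subset a), k * g,
      mul_mem (cs.special_mono (h.vset_subset a) hk) hg, ?_⟩
    rw [← he, ← hdec.inf_eq_egrp huw, ← conjBy_conjBy, conjBy_inf g, ha]
    congr 2
    change _ = conjBy _ ((Ψ₁.groups cs).vgrp b)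
    rw [← hb, conjBy_conjBy, inv_mul_cancel_right]
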